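/- \textbf{Conventions.} The Thompson group $F$ is the group of classes of pairs $(T_+,T_-)$ of finite rooted plane binary trees with the same number of leaves, up to insertion and cancellation of opposing carets, with $(T_+,T)\cdot(T,T_-)=(T_+,T_-)$; $F_+$ is the monoid generated by the standard generators $x_0,x_1,x_2,\dots$. The Tait graph $\Gamma(T_+,T_-)$ has one vertex immediately to the left of each leaf and one edge across each left edge of $T_+$ and of $T_-$ (an edge from a caret to its left child); $\vec F\subset F$ consists of the elements for which $\Gamma(T_+,T_-)$ is bipartite, and $\vec F_+=\vec F\cap F_+$. The oriented link diagram $\vec{\mathcal L}(T_+,T_-)$ of a pair with bipartite $\Gamma(T_+,T_-)$ is obtained by drawing $T_+$ above $T_-$ with the leaves glued, joining the two roots by a strand at the left, adding below each caret of $T_+$ and above each caret of $T_-$ a vertical strand from its vertex to the horizontal axis, so that all vertices become $4$-valent, and turning each of them into a crossing in which the arc through the left and right branches passes over the vertical strand. It is oriented as the boundary of its black checkerboard regions, where the colours $\pm$ of the vertices of $\Gamma(T_+,T_-)$, with $+$ at the leftmost vertex, give the orientations of the regions. For a plane rooted ternary tree $T$ let $\alpha(T)$ be the binary tree obtained by replacing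 each vertex with children $a,b,c$ by a caret with left child $a$ whose right child is a caret with children $b,c$, and let $\vec{\mathcal L}(T)=\vec{\mathcal L}(\alpha(T),T_-)$, where $T_-$ is the right comb (all left children are leaves) with the same number of leaves. We say that $T$ represents $g$ if $(\alpha(T),T_-)$ does. Let $\ell$ be the ternary tree without carets, let $(a,b,c)$ denote the ternary tree with subtrees $a,b,c$ at the root, and let $C=(\ell,\ell,\ell)$. The seven moves replace a subtree, all of whose leaves are leaves of the whole tree, as follows: 1) $(C,\ell,\ell)\to C$; 2) $(\ell,C,\ell)\to C$; 3) $(\ell,\ell,C)\to C$; 4) $(\ell,C,C)\to C$; 5) $(C,\ell,C)\to C$; 6) $(C,C,\ell)\to \ell$; 7) $(C,C,C)\to C$. A reduction of $T$ is a sequence of moves that ends at a trivial tree, i.e. at $\ell$ or at $C$ (a single caret cancels against the opposing caret of the bottom tree). \textbf{Theorem 2.} (a) Every ternary tree has a reduction. (b) If $T'$ arises from $T$ by a move other than 6, then $\vec{\mathcal L}(T')$ arises from $\vec{\mathcal L}(T)$ by planar isotopy, Reidemeister moves of type I and II, and deletions of split unknots. (c) If $T'$ arises from $T$ by move 6, then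 $\vec{\mathcal L}(T')$ arises from $\vec{\mathcal L}(T)$ by operations as in (b) together with a single crossing change, which turns a positive crossing into a negative one. (d) Every $g\in\vec F_+$ is represented by a ternary tree. For every such $g$ and every pair $(T_+,T_-)$ that describes $g$, $\vec{\mathcal L}(T_+,T_-)$ is an oriented link diagram, and the unknotting number of its link is at most the number of applications of move 6 in any reduction of any ternary tree that represents $g$. (e) The bound is attained by chain links: for every $n\ge 0$ there are an element of $\vec F_+$ and a ternary tree $T$ that represents it and has a reduction with exactly $n$ applications of move 6, such that $\vec{\mathcal L}(T)$ becomes, by operations as in (b), the chain of $n+1$ unknotted rings in which consecutive rings form a positive Hopf link, and such that the unknotting number of $\vec{\mathcal L}(T)$ is exactly $n$. -/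

import Mathlib

open Relation

/-! ### Binary trees, tree pairs and the Thompson group -/

/-- Finite rooted planar binary trees; `node l r` is a caret with left subtree `l` and right
subtree `r`. -/
inductive BTree where
  | leaf : BTree
  | node (l r : BTree) : BTree

namespace BTree

/-- Number of leaves. -/
def leaves : BTree → ℕ
  | leaf => 1
  | node l r => l.leaves + r.leaves

theorem leaves_pos : ∀ T : BTree, 0 < T.leaves
  | leaf => Nat.one_pos
  | node l _ => Nat.add_pos_left l.leaves_pos _

/-- Points of the Cantor set are infinite binary words.  `T.locate s` is the pair `(i, t)` such
that `s` is the address of the `i`-th leaf of `T` (from the left, starting at `0`, with `false` for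
left and `true` for right), followed by `t`. -/
def locate : BTree → Stream' Bool → ℕ × Stream' Bool
  | leaf, s => (0, s)
  | node l r, s =>
    if s.head = false then l.locate s.tail
    else (l.leaves + (r.locate s.tail).1, (r.locate s.tail).2)

/-- The address of the `i`-th leaf of `T`, followed by `t` (for `i < T.leaves`). -/
def place : BTree → ℕ → Stream' Bool → Stream' Bool
  | leaf, _, t => t
  | node l r, i, t =>
    if i < l.leaves then Stream'.cons false (l.place i t)
    else Stream'.cons true (r.place (i - l.leaves) t)

theorem locate_lt : ∀ (T : BTree) (s : Stream' Bool), (T.locate s).1 < T.leaves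
  | leaf, _ => Nat.one_pos
  | node l r, s => by
    have h1 := l.locate_lt s.tail
    have h2 := r.locate_lt s.tail
    change _ < l.leaves + r.leaves
    unfold locate
    split_ifs
    · omega
    · simpa using h2

theorem locate_place : ∀ (T : BTree) (i : ℕ) (t : Stream' Bool), i < T.leaves →
    T.locate (T.place i t) = (i, t)
  | leaf, i, t, h => by
    have : i = 0 := by simpa [leaves] using h
    simp [locate, place, this]
  | node l r, i, t, h => by
    unfold place
    split_ifs with hi
    · simp [locate, l.locate_place i t hi]
    · have hr : i - l.leaves < r.leaves := by
        simp only [leaves] at h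
        omega
      simp only [locate, Stream'.head_cons, Stream'.tail_cons, r.locate_place _ t hr]
      simp
      omega

theorem place_locate : ∀ (T : BTree) (s : Stream' Bool),
    T.place (T.locate s).1 (T.locate s).2 = s
  | leaf, _ => rfl
  | node l r, s => by
    unfold locate
    split_ifs with hs
    · have h1 := l.locate_lt s.tail
      simp only [place, h1, if_true, l.place_locate s.tail]
      rw [← hs]
      exact s.eta
    · have hs' : s.head = true := by simpa using hs
      simp only [place]
      rw [if_neg (by omega), Nat.add_sub_cancel_left, r.place_locate s.tail, ← hs']
      exact s.eta

/-- The right comb with `n` carets, whose left children are all leaves: the standard (bottom)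
tree of a positive element. -/
def rightComb : ℕ → BTree
  | 0 => leaf
  | n + 1 => node leaf (rightComb n)

theorem leaves_rightComb : ∀ n : ℕ, (rightComb n).leaves = n + 1
  | 0 => rfl
  | n + 1 => by
    simp only [rightComb, leaves, leaves_rightComb n]
    omega

/-- Edges of the half `Γ_±(T)` of the Tait graph.  There is one vertex immediately to the left of
each leaf; the vertices of `T` are numbered `k, k + 1, …` from left to right.  Each left edge of
`T` (from a caret to its left child `l`) is crossed by one edge of the graph, which joins the vertex
at the far left of `l` to the vertex between `l` and its sibling. -/
def taitEdges : BTree → ℕ → List (ℕ × ℕ)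
  | leaf, _ => []
  | node l r, k => (k, k + l.leaves) :: (l.taitEdges k ++ r.taitEdges (k + l.leaves))

end BTree

/-- A pair `(T₊, T₋)` of binary trees with the same number of leaves. -/
structure TreePair where
  top : BTree
  bot : BTree
  leaves_eq : top.leaves = bot.leaves

namespace TreePair

/-- The element of the Thompson group `F` described by `(T₊, T₋)`, as a homeomorphism of the Cantor
set: it maps the interval of the `i`-th leaf of `T₋` canonically onto that of the `i`-th leaf of
`T₊`.  Two pairs describe the same element iff they are equivalent through insertions and
cancellations of opposing carets, and `(T₊, T) * (T, T₋) = (T₊, T₋)`. -/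
def toPerm (P : TreePair) : Equiv.Perm (Stream' Bool) where
  toFun s := P.top.place (P.bot.locate s).1 (P.bot.locate s).2
  invFun s := P.bot.place (P.top.locate s).1 (P.top.locate s).2
  left_inv s := by
    have h := P.bot.locate_lt s
    rw [← P.leaves_eq] at h
    simp only [P.top.locate_place _ _ h, P.bot.place_locate]
  right_inv s := by
    have h := P.top.locate_lt s
    rw [P.leaves_eq] at h
    simp only [P.bot.locate_place _ _ h, P.top.place_locate]

/-- The shift `φ` on tree pairs: a new root caret whose left child is a leaf, on both sides. -/
def shift (P : TreePair) : TreePair where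
  top := BTree.node BTree.leaf P.top
  bot := BTree.node BTree.leaf P.bot
  leaves_eq := by simp only [BTree.leaves, P.leaves_eq]

/-- The standard generators `x₀, x₁, x₂, …` of `F`. -/
def gen : ℕ → TreePair
  | 0 =>
    { top := BTree.node (BTree.node BTree.leaf BTree.leaf) BTree.leaf
      bot := BTree.node BTree.leaf (BTree.node BTree.leaf BTree.leaf)
      leaves_eq := rfl }
  | n + 1 => (gen n).shift

/-- The Tait graph `Γ(T₊, T₋)` (as a simple graph: multiple edges do not matter for
bipartiteness). -/
def tait (P : TreePair) : SimpleGraph (Fin P.top.leaves) :=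
  SimpleGraph.fromRel fun i j =>
    ((i : ℕ), (j : ℕ)) ∈ P.top.taitEdges 0 ∨ ((i : ℕ), (j : ℕ)) ∈ P.bot.taitEdges 0

end TreePair

/-- The Thompson group `F`, as a set of homeomorphisms of the Cantor set. -/
def thompsonF : Set (Equiv.Perm (Stream' Bool)) := Set.range TreePair.toPerm

/-- The monoid `F₊` of positive elements, generated by `x₀, x₁, x₂, …`. -/
def positiveF : Submonoid (Equiv.Perm (Stream' Bool)) :=
  Submonoid.closure (Set.range fun n => (TreePair.gen n).toPerm)

/-- The oriented Thompson group: the elements of `F` with bipartite Tait graph. -/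
def orientedF : Set (Equiv.Perm (Stream' Bool)) :=
  {g | ∃ P : TreePair, P.toPerm = g ∧ P.tait.IsBipartite}

/-- The positive elements of the oriented Thompson group. -/
def orientedPositiveF : Set (Equiv.Perm (Stream' Bool)) :=
  orientedF ∩ (positiveF : Set (Equiv.Perm (Stream' Bool)))

/-! ### Oriented link diagrams

A diagram in general position with respect to the height function is read from top to bottom as
a list of elementary slices.  Between two slices there are finitely many strands, numbered from the
left starting at `0`; the list of their orientations (`true` = up, `false` = down) is the state. -/

/-- Elementary slices.
* `birth i s`: a local maximum `∩`; its two legs become the strands `i` and `i + 1` and have the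
  orientations `s` and `!s`.
* `death i`: a local minimum `∪` that joins the strands `i` and `i + 1`.
* `cross i e`: a crossing of the strands `i` and `i + 1`; the strand that runs from the top left to
  the bottom right is the upper one if `e = true` and the lower one if `e = false`. -/
inductive Slice where
  | birth (i : ℕ) (s : Bool) : Slice
  | death (i : ℕ) : Slice
  | cross (i : ℕ) (e : Bool) : Slice

namespace Slice

/-- Effect of a slice on the state, `none` if the slice does not fit. -/
def act : Slice → List Bool → Option (List Bool)
  | birth i s, st => if i ≤ st.length then some (st.take i ++ s :: (!s) :: st.drop i) else none
  | death i, st =>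
    match st.drop i with
    | a :: b :: rest => if a = b then none else some (st.take i ++ rest)
    | _ => none
  | cross i _, st =>
    match st.drop i with
    | a :: b :: rest => some (st.take i ++ b :: a :: rest)
    | _ => none

/-- Position of the leftmost strand involved. -/
def pos : Slice → ℕ
  | birth i _ => i
  | death i => i
  | cross i _ => i

/-- The same slice at another position. -/
def moveTo : Slice → ℕ → Slice
  | birth _ s, j => birth j s
  | death _, j => death j
  | cross _ e, j => cross j e

/-- Number of strands that enter the slice from above. -/
def ins : Slice → ℕ
  | birth _ _ => 0
  | death _ => 2
  | cross _ _ => 2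

/-- Number of strands that leave the slice below. -/
def outs : Slice → ℕ
  | birth _ _ => 2
  | death _ => 0
  | cross _ _ => 2

end Slice

/-- The state below a list of slices, given the state above it. -/
def run : List Bool → List Slice → Option (List Bool)
  | st, [] => some st
  | st, x :: w => (x.act st).bind fun st' => run st' w

/-- The list of slices is an oriented link diagram. -/
def IsDiagram (w : List Slice) : Prop := run [] w = some []

/-- Planar isotopy, as local moves: exchange of the heights of two distant slices,
straightening of a zigzag, and sliding a strand across a maximum or a minimum. -/
inductive PlanarMove : List Slice → List Slice → Prop
  | exchange (a b : Slice) (d : ℕ) :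
      PlanarMove [a, b.moveTo (a.pos + a.outs + d)] [b.moveTo (a.pos + a.ins + d), a]
  | zigzagLeft (i : ℕ) (s : Bool) : PlanarMove [Slice.birth i s, Slice.death (i + 1)] []
  | zigzagRight (i : ℕ) (s : Bool) : PlanarMove [Slice.birth (i + 1) s, Slice.death i] []
  | slideMax (i : ℕ) (s e : Bool) :
      PlanarMove [Slice.birth i s, Slice.cross (i + 1) e]
        [Slice.birth (i + 1) s, Slice.cross i (!e)]
  | slideMin (i : ℕ) (e : Bool) :
      PlanarMove [Slice.cross (i + 1) e, Slice.death i]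
        [Slice.cross i (!e), Slice.death (i + 1)]

/-- Reidemeister moves of type I (a kink at a maximum or at a minimum) and II. -/
inductive ReidemeisterOneTwo : List Slice → List Slice → Prop
  | oneMax (i : ℕ) (s e : Bool) :
      ReidemeisterOneTwo [Slice.birth i s, Slice.cross i e] [Slice.birth i (!s)]
  | oneMin (i : ℕ) (e : Bool) :
      ReidemeisterOneTwo [Slice.cross i e, Slice.death i] [Slice.death i]
  | two (i : ℕ) (e : Bool) :
      ReidemeisterOneTwo [Slice.cross i e, Slice.cross i (!e)] []

/-- Reidemeister moves of type III; the signs `a b c` say which of each two of the three strands is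
the upper one, and the excluded cases are those without a top strand. -/
inductive ReidemeisterThree : List Slice → List Slice → Prop
  | three (i : ℕ) (a b c : Bool) (h : a = c → b = a) :
      ReidemeisterThree
        [Slice.cross i a, Slice.cross (i + 1) b, Slice.cross i c]
        [Slice.cross (i + 1) c, Slice.cross i b, Slice.cross (i + 1) a]

/-- Removal of an unknotted circle that bounds a disc disjoint from the rest of the diagram. -/
inductive UnknotRemoval : List Slice → List Slice → Prop
  | circle (i : ℕ) (s : Bool) : UnknotRemoval [Slice.birth i s, Slice.death i] []

/-- A local move applied inside a link diagram, with a link diagram as the result. -/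
def InDiagram (R : List Slice → List Slice → Prop) (D D' : List Slice) : Prop :=
  IsDiagram D ∧ IsDiagram D' ∧
    ∃ u v x y, R x y ∧ D = u ++ x ++ v ∧ D' = u ++ y ++ v

/-- Isotopy of oriented links, in terms of diagrams. -/
def Isotopic : List Slice → List Slice → Prop :=
  EqvGen (InDiagram fun x y => PlanarMove x y ∨ ReidemeisterOneTwo x y ∨ ReidemeisterThree x y)

/-- `D'` arises from `D` through planar isotopy, Reidemeister moves of type I and II (in either
direction) and deletions of split unknots. -/
def SimplifiesTo : List Slice → List Slice → Prop :=
  ReflTransGen fun D D' =>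
    InDiagram (fun x y => PlanarMove x y ∨ ReidemeisterOneTwo x y) D D' ∨
    InDiagram (fun x y => PlanarMove x y ∨ ReidemeisterOneTwo x y) D' D ∨
    InDiagram UnknotRemoval D D'

/-- `D'` arises from `D` through one crossing change. -/
def CrossingChange (D D' : List Slice) : Prop :=
  IsDiagram D ∧ ∃ u v i e,
    D = u ++ Slice.cross i e :: v ∧ D' = u ++ Slice.cross i (!e) :: v

/-- Sign of a crossing `cross i e` whose upper left and upper right ends have the orientations `a`
and `b`: `true` for a positive crossing (that of the positive braid generator with upward strands,
in which the strand from the bottom left to the top right is the upper one). -/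
def crossingPositive (a b e : Bool) : Bool := e == (a != b)

/-- `D'` arises from `D` by turning one positive crossing into a negative one. -/
def PositiveToNegative (D D' : List Slice) : Prop :=
  IsDiagram D ∧ ∃ u v i e p a b q,
    D = u ++ Slice.cross i e :: v ∧ D' = u ++ Slice.cross i (!e) :: v ∧
    run [] u = some (p ++ a :: b :: q) ∧ p.length = i ∧ crossingPositive a b e = true

/-- The standard diagram of the unlink with `m` components. -/
def unlinkDiagram (m : ℕ) : List Slice :=
  (List.replicate m [Slice.birth 0 true, Slice.death 0]).flatten

/-- The link of the diagram can be turned into an unlink with `k` crossing changes, with isotopies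
before, between and after them. -/
inductive UnknottedBy : List Slice → ℕ → Prop
  | unlink {D : List Slice} (m : ℕ) (h : Isotopic D (unlinkDiagram m)) (hD : IsDiagram D) :
      UnknottedBy D 0
  | change {D D₁ D₂ : List Slice} {k : ℕ} (h₁ : Isotopic D D₁) (h₂ : CrossingChange D₁ D₂)
      (h₃ : UnknottedBy D₂ k) : UnknottedBy D (k + 1)

/-- The unknotting number of the link of a diagram: the least number of crossing changes that
turn it into an unlink. -/
noncomputable def unknottingNumber (D : List Slice) : ℕ∞ :=
  sInf {x : ℕ∞ | ∃ k : ℕ, x = k ∧ UnknottedBy D k}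

/-- The chain with `n + 1` unknotted rings: consecutive rings form a positive Hopf link. -/
def chainDiagram (n : ℕ) : List Slice :=
  ((List.range (n + 1)).map fun j => Slice.birth (2 * j) (decide (j % 2 = 1))) ++
  ((List.range n).flatMap fun j =>
    [Slice.cross (2 * j + 1) false, Slice.cross (2 * j + 1) false]) ++
  List.replicate (n + 1) (Slice.death 0)

/-! ### The oriented link of a tree pair -/

namespace BTree

/-- The upper tangle.  Each caret becomes a crossing of a vertical strand, which comes from the root
of the caret and ends between its two subtrees, with an arc that joins the roots of the two subtrees
and passes over the vertical strand.  The root of the tree is the strand `p`, and `c` is the colour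
(`true` for `+`) of the vertex of the Tait graph at the left of the tree.  Adjacent vertices have
opposite colours, and the right boundary of a black region is oriented upward iff its colour is
`+`, its left boundary iff its colour is `-`. -/
def upperTangle : BTree → Bool → ℕ → List Slice
  | leaf, _, _ => []
  | node l r, c, p =>
    Slice.birth p c :: Slice.cross (p + 1) true ::
      (r.upperTangle (!c) (p + 2) ++ l.upperTangle c p)

/-- The lower tangle: the mirror image of the upper tangle under the reflection in the horizontal
axis. -/
def lowerTangle : BTree → ℕ → List Slice
  | leaf, _ => []
  | node l r, p =>
    l.lowerTangle p ++ r.lowerTangle (p + 2) ++ [Slice.cross (p + 1) false, Slice.death p]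

end BTree

/-- The diagram of the oriented link of `(T₊, T₋)`: the two tangles, with their roots joined by a
strand at the left.  The leftmost vertex of the Tait graph has the colour `+`. -/
def TreePair.link (P : TreePair) : List Slice :=
  Slice.birth 0 false :: (P.top.upperTangle true 1 ++ P.bot.lowerTangle 1 ++ [Slice.death 0])

/-! ### Ternary trees and the reduction moves -/

/-- Finite rooted planar ternary trees. -/
inductive TTree where
  | leaf : TTree
  | node (a b c : TTree) : TTree

namespace TTree

/-- The map `α` from ternary to binary trees. -/
def alpha : TTree → BTree
  | leaf => BTree.leaf
  | node a b c => BTree.node a.alpha (BTree.node b.alpha c.alpha)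

/-- The pair that consists of `α(T)` and the right comb with the same number of leaves: the image of
the positive element of the Brown-Thompson group `F₃` with top tree `T`. -/
def positivePair (T : TTree) : TreePair where
  top := T.alpha
  bot := BTree.rightComb (T.alpha.leaves - 1)
  leaves_eq := by
    have := T.alpha.leaves_pos
    rw [BTree.leaves_rightComb]
    omega

/-- The ternary tree with one inner vertex. -/
def caret : TTree := node leaf leaf leaf

end TTree

open TTree in
/-- `Move m T T'`: the tree `T'` arises from `T` by an application of the `m`-th reduction move at
some subtree all of whose leaves are leaves of `T`. -/
inductive Move : ℕ → TTree → TTree → Prop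
  | move1 : Move 1 (node caret leaf leaf) caret
  | move2 : Move 2 (node leaf caret leaf) caret
  | move3 : Move 3 (node leaf leaf caret) caret
  | move4 : Move 4 (node leaf caret caret) caret
  | move5 : Move 5 (node caret leaf caret) caret
  | move6 : Move 6 (node caret caret leaf) leaf
  | move7 : Move 7 (node caret caret caret) caret
  | left {m : ℕ} {a a' : TTree} (b c : TTree) (h : Move m a a') :
      Move m (node a b c) (node a' b c)
  | middle {m : ℕ} (a : TTree) {b b' : TTree} (c : TTree) (h : Move m b b') :
      Move m (node a b c) (node a b' c)
  | right {m : ℕ} (a b : TTree) {c c' : TTree} (h : Move m c c') :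
      Move m (node a b c) (node a b c')

/-- `Reduction T k`: there is a sequence of moves from `T` to a trivial tree in which the sixth
move is applied exactly `k` times.  Trivial are the tree without carets and the tree with a single
caret, which cancels against the opposing caret of the bottom tree. -/
inductive Reduction : TTree → ℕ → Prop
  | empty : Reduction TTree.leaf 0
  | caret : Reduction TTree.caret 0
  | other {m : ℕ} {T T' : TTree} {k : ℕ} (h : Move m T T') (hm : m ≠ 6) (hk : Reduction T' k) :
      Reduction T k
  | six {T T' : TTree} {k : ℕ} (h : Move 6 T T') (hk : Reduction T' k) : Reduction T (k + 1)

/-! The bottom tree of a positive pair is a right comb, whose lower tangle treats the leaves one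
after the other from the right. The link of a ternary tree can therefore be cut along its subtrees.
A subtree of `α(T)`, together with the strip of the comb below it, is a tangle with three incoming
strands (its root and two strands from the right) and one outgoing strand. A caret becomes an
operation `joinTangle` on such tangles, `TTree.tangle` is the resulting recursion, and
`TTree.link_positivePair` identifies the link with the closure of this tangle.

Up to planar isotopy, Reidemeister moves I and II and split circles, the local pieces in the moves
are only a leaf, a cap (the root runs on downward), `death 0`, and a clasp, which is a leaf with its
crossing changed. A short table of joins, checked by computation, gives all moves: a single caret is
a cap with one circle, the left sides of moves 1–5 and 7 are caps with at least one circle, and the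
left side of move 6 is a clasp with two circles. Changing the crossing of the clasp, which is
positive, gives the leaf. Since the relation is local, this holds at every subtree (`Move.splitsTo`,
`Move.changesPositive`).

The bound requires that split circles do not affect the unknotting number, because moves and
insertions of opposing carets both produce them. The difficult direction is to delete circles from
an unknotting sequence. For this the strands are labelled, and the labels are carried along
isotopies and crossing changes (`Isotopic.transport`, `CrossingChange.transport`). Erasing the
strands with label `0` turns an unknotting of a link into an unknotting of a sublink that is no
longer than the original one (`UnknottedBy.erase`). Two tree pairs of the same element have a common
expansion, and each expansion step adds one circle, so the bound passes to all pairs.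

The same labels provide linking numbers: the sum of the signs of the crossings between different
labels, weighted by a symmetric function vanishing on the diagonal, is an isotopy invariant. A
crossing change alters at most one of the linking numbers of consecutive rings, and that one by at
most one, so a chain with `n` consecutive positive Hopf links needs `n` changes
(`UnknottedBy.le_of_chainDiagram`). The chain itself comes from subtrees `(C, C, ℓ)`, since a clasp
joined with a cap puts a ring around a strand (`joinTangle_clasp`).

On the algebraic side, a positive element is the pair of a binary tree and a right comb. If its Tait
graph is bipartite, the colours of the leaves must agree with those of the comb, that is, alternate.
This forces the left subtrees along the right spine to have odd numbers of leaves, and a recursion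
shows that the tree, perhaps with a caret at its last leaf, is `α` of a ternary tree
(`BTree.exists_ternary`). Reductions exist because the seven moves cover all triples of leaves and
carets except the single caret. -/

/-! ### Words of slices on larger states -/

namespace Slice

/-- The slice with `k` further strands at its left. -/
def shift (k : ℕ) : Slice → Slice
  | birth i s => birth (i + k) s
  | death i => death (i + k)
  | cross i e => cross (i + k) e

theorem moveTo_pos (x : Slice) : x.moveTo x.pos = x := by cases x <;> rfl

theorem shift_eq_moveTo (k : ℕ) (x : Slice) : x.shift k = x.moveTo (x.pos + k) := by
  cases x <;> rfl

theorem pos_moveTo (x : Slice) (i : ℕ) : (x.moveTo i).pos = i := by cases x <;> rfl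

theorem pos_shift (x : Slice) (k : ℕ) : (x.shift k).pos = x.pos + k := by cases x <;> rfl

theorem ins_shift (x : Slice) (k : ℕ) : (x.shift k).ins = x.ins := by cases x <;> rfl

theorem outs_shift (x : Slice) (k : ℕ) : (x.shift k).outs = x.outs := by cases x <;> rfl

theorem shift_moveTo (x : Slice) (i k : ℕ) : (x.moveTo i).shift k = x.moveTo (i + k) := by
  cases x <;> rfl

theorem shift_zero (x : Slice) : x.shift 0 = x := by cases x <;> rfl

theorem shift_shift (x : Slice) (j k : ℕ) : (x.shift j).shift k = x.shift (j + k) := by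
  cases x <;> simp [shift, Nat.add_assoc]

theorem act_shift (x : Slice) (A st : List Bool) :
    (x.shift A.length).act (A ++ st) = (x.act st).map (A ++ ·) := by
  cases x with
  | birth i s =>
    by_cases h : i ≤ st.length
    · simp [shift, act, h, Nat.add_comm i, List.take_append, List.drop_append,
        List.take_of_length_le]
    · simp [shift, act, h, Nat.add_comm i]
  | death i =>
    simp only [shift, act, Nat.add_comm i, List.drop_append, List.take_append,
      Nat.add_sub_cancel_left, List.drop_of_length_le (Nat.le_add_right _ _),
      List.take_of_length_le (Nat.le_add_right A.length i), List.nil_append]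
    rcases st.drop i with _ | ⟨a, _ | ⟨b, r⟩⟩ <;> simp
    split_ifs <;> simp
  | cross i e =>
    simp only [shift, act, Nat.add_comm i, List.drop_append, List.take_append,
      Nat.add_sub_cancel_left, List.drop_of_length_le (Nat.le_add_right _ _),
      List.take_of_length_le (Nat.le_add_right A.length i), List.nil_append]
    rcases st.drop i with _ | ⟨a, _ | ⟨b, r⟩⟩ <;> simp

/-- Unlike strands on the left, further strands on the right can make a slice fit that did not fit
before. Hence only the successful case carries over. -/
theorem act_append (x : Slice) {st st' : List Bool} (B : List Bool) (h : x.act st = some st') :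
    x.act (st ++ B) = some (st' ++ B) := by
  cases x with
  | birth i s =>
    simp only [act] at h ⊢
    split_ifs at h with hi
    have h' : i ≤ (st ++ B).length := by simp; omega
    rw [if_pos h', List.take_append_of_le_length hi, List.drop_append_of_le_length hi]
    simp only [Option.some.injEq] at h
    simp [← h]
  | death i =>
    simp only [act] at h ⊢
    have hi : i ≤ st.length := by
      by_contra hc
      rw [List.drop_of_length_le (by omega)] at h
      simp at h
    rw [List.take_append_of_le_length hi, List.drop_append_of_le_length hi]
    rcases hd : st.drop i with _ | ⟨a, _ | ⟨b, r⟩⟩ <;> simp only [hd, reduceCtorEq] at h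
    simp only [List.cons_append]
    split_ifs at h ⊢
    simp only [Option.some.injEq] at h
    simp [← h]
  | cross i e =>
    simp only [act] at h ⊢
    have hi : i ≤ st.length := by
      by_contra hc
      rw [List.drop_of_length_le (by omega)] at h
      simp at h
    rw [List.take_append_of_le_length hi, List.drop_append_of_le_length hi]
    rcases hd : st.drop i with _ | ⟨a, _ | ⟨b, r⟩⟩ <;> simp only [hd, reduceCtorEq] at h
    simp only [Option.some.injEq] at h
    simp [← h]

/-- A slice that fits replaces `ins` strands by `outs` strands. -/
theorem length_of_act (x : Slice) {st st' : List Bool} (h : x.act st = some st') :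
    x.pos + x.ins ≤ st.length ∧ st'.length + x.ins = st.length + x.outs := by
  cases x with
  | birth i s =>
    simp only [act] at h
    split_ifs at h with hi
    simp only [Option.some.injEq] at h
    subst h
    simp [pos, ins, outs]
    omega
  | death i =>
    simp only [act] at h
    have hl := congrArg List.length (List.take_append_drop i st)
    rcases hd : st.drop i with _ | ⟨a, _ | ⟨b, r⟩⟩ <;> simp only [hd, reduceCtorEq] at h
    have hl2 := congrArg List.length hd
    split_ifs at h
    simp only [Option.some.injEq] at h
    subst h
    simp [pos, ins, outs] at hl2 ⊢
    omega
  | cross i e =>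
    simp only [act] at h
    rcases hd : st.drop i with _ | ⟨a, _ | ⟨b, r⟩⟩ <;> simp only [hd, reduceCtorEq] at h
    have hl2 := congrArg List.length hd
    simp only [Option.some.injEq] at h
    subst h
    simp [pos, ins, outs] at hl2 ⊢
    omega

end Slice

/-- The word with `k` further strands at its left. -/
def sh (k : ℕ) (w : List Slice) : List Slice := w.map (Slice.shift k)

@[simp] theorem sh_nil (k : ℕ) : sh k [] = [] := rfl

@[simp] theorem sh_cons (k : ℕ) (x : Slice) (w : List Slice) :
    sh k (x :: w) = x.shift k :: sh k w := rfl

@[simp] theorem sh_append (k : ℕ) (u v : List Slice) : sh k (u ++ v) = sh k u ++ sh k v :=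
  List.map_append

theorem sh_zero (w : List Slice) : sh 0 w = w := by
  simp [sh, funext Slice.shift_zero]

theorem sh_sh (j k : ℕ) (w : List Slice) : sh k (sh j w) = sh (j + k) w := by
  simp [sh, Slice.shift_shift]

@[simp] theorem run_nil (st : List Bool) : run st [] = some st := rfl

theorem run_cons (st : List Bool) (x : Slice) (w : List Slice) :
    run st (x :: w) = (x.act st).bind fun st' => run st' w := rfl

theorem run_append (u v : List Slice) : ∀ st : List Bool,
    run st (u ++ v) = (run st u).bind fun st' => run st' v := by
  induction u with
  | nil => intro st; rfl
  | cons x u ih =>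
    intro st
    simp only [List.cons_append, run_cons, Option.bind_assoc]
    congr 1
    funext st'
    exact ih st'

theorem run_append_of {u v : List Slice} {st st' : List Bool} (h : run st u = some st') :
    run st (u ++ v) = run st' v := by
  rw [run_append, h]; rfl

theorem run_sh (w : List Slice) (A : List Bool) : ∀ st : List Bool,
    run (A ++ st) (sh A.length w) = (run st w).map (A ++ ·) := by
  induction w with
  | nil => intro st; rfl
  | cons x w ih =>
    intro st
    simp only [sh_cons, run_cons, Slice.act_shift]
    rcases x.act st with _ | st'
    · rfl
    · simpa using ih st'

theorem run_append_right (w : List Slice) (B : List Bool) : ∀ {st st' : List Bool},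
    run st w = some st' → run (st ++ B) w = some (st' ++ B) := by
  induction w with
  | nil => intro st st' h; simp_all
  | cons x w ih =>
    intro st st' h
    simp only [run_cons] at h ⊢
    rcases hx : x.act st with _ | s1
    · simp [hx] at h
    · rw [hx] at h
      rw [x.act_append B hx]
      exact ih h

theorem run_whisker {w : List Slice} {st st' : List Bool} (A B : List Bool)
    (h : run st w = some st') :
    run (A ++ st ++ B) (sh A.length w) = some (A ++ st' ++ B) := by
  apply run_append_right
  rw [run_sh, h]
  rfl

/-! ### Tangles up to Reidemeister moves I and II -/

theorem PlanarMove.shift {x y : List Slice} (k : ℕ) (h : PlanarMove x y) :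
    PlanarMove (sh k x) (sh k y) := by
  cases h with
  | exchange a b d =>
    have h := PlanarMove.exchange (a.shift k) b d
    rw [Slice.pos_shift, Slice.ins_shift, Slice.outs_shift] at h
    simp only [sh_cons, sh_nil, Slice.shift_moveTo]
    rwa [show a.pos + a.outs + d + k = a.pos + k + a.outs + d by omega,
      show a.pos + a.ins + d + k = a.pos + k + a.ins + d by omega]
  | zigzagLeft i s =>
    have h := PlanarMove.zigzagLeft (i + k) s
    rwa [Nat.add_right_comm] at h
  | zigzagRight i s =>
    have h := PlanarMove.zigzagRight (i + k) s
    rwa [Nat.add_right_comm] at h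
  | slideMax i s e =>
    have h := PlanarMove.slideMax (i + k) s e
    rwa [Nat.add_right_comm] at h
  | slideMin i e =>
    have h := PlanarMove.slideMin (i + k) e
    rwa [Nat.add_right_comm] at h

theorem ReidemeisterOneTwo.shift {x y : List Slice} (k : ℕ) (h : ReidemeisterOneTwo x y) :
    ReidemeisterOneTwo (sh k x) (sh k y) := by
  cases h with
  | oneMax i s e => exact .oneMax (i + k) s e
  | oneMin i e => exact .oneMin (i + k) e
  | two i e => exact .two (i + k) e

/-- Two words, read from the same incoming strands `st`, are related by planar isotopy and
Reidemeister moves of type I and II. -/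
inductive TangleEq : List Bool → List Slice → List Slice → Prop
  | refl (st : List Bool) (w : List Slice) : TangleEq st w w
  | step {st r : List Bool} {x y : List Slice} (h : PlanarMove x y ∨ ReidemeisterOneTwo x y)
      (hx : run st x = some r) (hy : run st y = some r) : TangleEq st x y
  | symm {st : List Bool} {x y : List Slice} (h : TangleEq st x y) : TangleEq st y x
  | trans {st : List Bool} {x y z : List Slice} (h : TangleEq st x y) (h' : TangleEq st y z) :
      TangleEq st x z
  | congr {st st₁ : List Bool} {u x y : List Slice} (v : List Slice) (hu : run st u = some st₁)
      (h : TangleEq st₁ x y) : TangleEq st (u ++ x ++ v) (u ++ y ++ v)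

namespace TangleEq

/-- Each local step has the same outgoing strands on both sides. So if one of two equal tangles fits
into a diagram, the other does too. -/
theorem run_eq {st : List Bool} {x y : List Slice} (h : TangleEq st x y) :
    run st x = run st y := by
  induction h with
  | refl => rfl
  | step h hx hy => rw [hx, hy]
  | symm _ ih => exact ih.symm
  | trans _ _ ih ih' => exact ih.trans ih'
  | congr v hu _ ih =>
    rw [run_append, run_append _ v, run_append_of hu, run_append_of hu, ih]

theorem append_left {st st₁ : List Bool} {u x y : List Slice} (hu : run st u = some st₁)
    (h : TangleEq st₁ x y) : TangleEq st (u ++ x) (u ++ y) := by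
  simpa using congr [] hu h

theorem append_right {st : List Bool} {x y : List Slice} (v : List Slice)
    (h : TangleEq st x y) : TangleEq st (x ++ v) (y ++ v) := by
  simpa using congr (u := []) v rfl h

theorem append {st st₁ : List Bool} {x y x' y' : List Slice} (h : TangleEq st x y)
    (hx : run st x = some st₁) (h' : TangleEq st₁ x' y') : TangleEq st (x ++ x') (y ++ y') :=
  (append_left hx h').trans (append_right _ h)

theorem of_eq (st : List Bool) {x y : List Slice} (h : x = y) : TangleEq st x y := h ▸ .refl st x

theorem whisker {st : List Bool} {x y : List Slice} (A B : List Bool) (h : TangleEq st x y) :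
    TangleEq (A ++ st ++ B) (sh A.length x) (sh A.length y) := by
  induction h with
  | refl => exact .refl _ _
  | step h hx hy =>
    exact .step (h.imp (·.shift _) (·.shift _)) (run_whisker A B hx) (run_whisker A B hy)
  | symm _ ih => exact ih.symm
  | trans _ _ ih ih' => exact ih.trans ih'
  | congr v hu _ ih =>
    simp only [sh_append]
    exact .congr _ (run_whisker A B hu) ih

theorem whisker_left {st : List Bool} {x y : List Slice} (A : List Bool) (h : TangleEq st x y) :
    TangleEq (A ++ st) (sh A.length x) (sh A.length y) := by
  simpa using h.whisker A []

theorem whisker_right {st : List Bool} {x y : List Slice} (B : List Bool)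
    (h : TangleEq st x y) : TangleEq (st ++ B) x y := by
  simpa [sh_zero] using h.whisker [] B

/-- Equal tangles in a link diagram give diagrams that simplify to each other. -/
theorem simplifiesTo_aux {st : List Bool} {x y : List Slice} (h : TangleEq st x y) :
    ∀ u v : List Slice, run [] u = some st → IsDiagram (u ++ x ++ v) →
      EqvGen (InDiagram fun x y => PlanarMove x y ∨ ReidemeisterOneTwo x y)
        (u ++ x ++ v) (u ++ y ++ v) := by
  have key : ∀ {st : List Bool} {x y : List Slice} (u v : List Slice), TangleEq st x y →
      run [] u = some st → IsDiagram (u ++ x ++ v) → IsDiagram (u ++ y ++ v) := by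
    intro st x y u v h hu hd
    unfold IsDiagram at *
    rwa [List.append_assoc, run_append_of hu, run_append, ← h.run_eq, ← run_append,
      ← run_append_of hu, ← List.append_assoc]
  induction h with
  | refl => intro u v _ _; exact .refl _
  | @step st r x y h hx hy =>
    intro u v hu hd
    exact .rel _ _ ⟨hd, key u v (.step h hx hy) hu hd, u, v, x, y, h, rfl, rfl⟩
  | symm h ih =>
    intro u v hu hd
    exact .symm _ _ (ih u v hu (key u v h.symm hu hd))
  | trans h _ ih ih' =>
    intro u v hu hd
    exact .trans _ _ _ (ih u v hu hd) (ih' u v hu (key u v h hu hd))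
  | @congr st st₁ u' x y v' hu' _ ih =>
    intro u v hu hd
    have h := ih (u ++ u') (v' ++ v) (by rw [run_append_of hu, hu']) (by simpa using hd)
    simpa using h

theorem simplifiesTo {D D' : List Slice} (h : TangleEq [] D D') (hD : IsDiagram D) :
    SimplifiesTo D D' := by
  have h' := h.simplifiesTo_aux [] [] rfl (by simpa using hD)
  simp only [List.nil_append, List.append_nil] at h'
  have : ∀ {D D' : List Slice},
      EqvGen (InDiagram fun x y => PlanarMove x y ∨ ReidemeisterOneTwo x y) D D' →
      SimplifiesTo D D' ∧ SimplifiesTo D' D := by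
    intro D D' h
    induction h with
    | rel x y h => exact ⟨.single (.inl h), .single (.inr (.inl h))⟩
    | refl x => exact ⟨.refl, .refl⟩
    | symm _ _ _ ih => exact ih.symm
    | trans _ _ _ _ _ ih ih' => exact ⟨ih.1.trans ih'.1, ih'.2.trans ih.2⟩
  exact (this h').1

theorem isotopic {D D' : List Slice} (h : TangleEq [] D D') (hD : IsDiagram D) :
    Isotopic D D' := by
  have h' := h.simplifiesTo_aux [] [] rfl (by simpa using hD)
  simp only [List.nil_append, List.append_nil] at h'
  refine EqvGen.mono ?_ _ _ h'
  rintro a b ⟨h1, h2, u, v, x, y, hxy, h3⟩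
  exact ⟨h1, h2, u, v, x, y, by tauto, h3⟩

/-! ### Exchanging distant tangles -/

theorem exchange_slice {s s' t t' : List Bool} {a b : Slice} (ha : a.act s = some s')
    (hb : b.act t = some t') :
    TangleEq (s ++ t) [a, b.shift s'.length] [b.shift s.length, a] := by
  obtain ⟨h1, h2⟩ := a.length_of_act ha
  -- The distance of the two slices: the strands of `s` to the right of `a`, and those of `t` to the
  -- left of `b`.
  have h := PlanarMove.exchange a b (s.length - (a.pos + a.ins) + b.pos)
  have e1 : a.pos + a.outs + (s.length - (a.pos + a.ins) + b.pos) = b.pos + s'.length := by omega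
  have e2 : a.pos + a.ins + (s.length - (a.pos + a.ins) + b.pos) = b.pos + s.length := by omega
  rw [e1, e2, ← Slice.shift_eq_moveTo, ← Slice.shift_eq_moveTo] at h
  refine .step (r := s' ++ t') (.inl h) ?_ ?_
  · simp [run_cons, a.act_append t ha, Slice.act_shift, hb]
  · simp [run_cons, a.act_append t' ha, Slice.act_shift, hb]

theorem exchange_slice_word {a : Slice} (b : List Slice) : ∀ {s s' t t' : List Bool},
    a.act s = some s' → run t b = some t' →
    TangleEq (s ++ t) (a :: sh s'.length b) (sh s.length b ++ [a]) := by
  induction b with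
  | nil => intro s s' t t' _ _; exact .refl _ _
  | cons x b ih =>
    intro s s' t t' ha hb
    rw [run_cons] at hb
    rcases hx : x.act t with _ | t1
    · simp [hx] at hb
    · rw [hx] at hb
      have h1 := (exchange_slice ha hx).append_right (sh s'.length b)
      have h2 := ih (t := t1) ha hb
      have h3 : run (s ++ t) [x.shift s.length] = some (s ++ t1) := by
        simp [run_cons, Slice.act_shift, hx]
      exact h1.trans (append_left h3 h2)

/-- Tangles on disjoint sets of strands may be exchanged. -/
theorem exchange (a : List Slice) {b : List Slice} {t t' : List Bool} :
    ∀ {s s' : List Bool}, run s a = some s' → run t b = some t' →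
    TangleEq (s ++ t) (a ++ sh s'.length b) (sh s.length b ++ a) := by
  induction a with
  | nil =>
    intro s s' ha hb
    simp only [run_nil, Option.some.injEq] at ha
    subst ha
    simpa using TangleEq.refl _ _
  | cons x a ih =>
    intro s s' ha hb
    rw [run_cons] at ha
    rcases hx : x.act s with _ | s1
    · simp [hx] at ha
    · rw [hx] at ha
      have h1 := ih ha hb
      have h2 := (exchange_slice_word b hx hb).append_right a
      have h3 : run (s ++ t) [x] = some (s1 ++ t) := by
        simp [run_cons, x.act_append t hx]
      refine (append_left (u := [x]) h3 h1).trans ?_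
      simpa using h2

/-! ### Rewriting two consecutive slices -/

end TangleEq

namespace Slice

/-- Exchange of the heights of two slices that involve different strands. -/
def swapWith (a b : Slice) : Option (List Slice) :=
  if a.pos + a.outs ≤ b.pos then some [b.moveTo (b.pos - a.outs + a.ins), a]
  else if b.pos + b.ins ≤ a.pos then some [b, a.moveTo (a.pos - b.ins + b.outs)]
  else none

/-- Slide of a strand across a maximum or a minimum. -/
def slideWith : Slice → Slice → Option (List Slice)
  | birth i s, cross j e =>
    if j = i + 1 then some [birth (i + 1) s, cross i (!e)]
    else if i = j + 1 then some [birth j s, cross (j + 1) (!e)]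
    else none
  | cross j e, death i =>
    if j = i + 1 then some [cross i (!e), death (i + 1)]
    else if i = j + 1 then some [cross (j + 1) (!e), death j]
    else none
  | _, _ => none

/-- Removal of a zigzag, a kink or a bigon. -/
def cancelWith : Slice → Slice → Option (List Slice)
  | birth i _, death j => if j = i + 1 ∨ i = j + 1 then some [] else none
  | birth i s, cross j _ => if j = i then some [birth i (!s)] else none
  | cross j _, death i => if j = i then some [death i] else none
  | cross i e, cross j e' => if j = i ∧ e' = !e then some [] else none
  | _, _ => none

/-- The ways of rewriting two consecutive slices. -/
inductive Rewriting where
  | swap | slide | cancel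

/-- Rewriting of two consecutive slices. -/
def rewrite : Rewriting → Slice → Slice → Option (List Slice)
  | .swap => swapWith
  | .slide => slideWith
  | .cancel => cancelWith

end Slice

namespace TangleEq

theorem of_swapWith {a b : Slice} {z : List Slice} {st r : List Bool}
    (h : a.swapWith b = some z) (hx : run st [a, b] = some r) (hz : run st z = some r) :
    TangleEq st [a, b] z := by
  unfold Slice.swapWith at h
  split_ifs at h with h1 h2
  · obtain ⟨d, hd⟩ := Nat.exists_eq_add_of_le h1
    have hp := PlanarMove.exchange a b d
    rw [← hd, Slice.moveTo_pos, show a.pos + a.ins + d = b.pos - a.outs + a.ins by omega] at hp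
    simp only [Option.some.injEq] at h
    subst h
    exact .step (.inl hp) hx hz
  · obtain ⟨d, hd⟩ := Nat.exists_eq_add_of_le h2
    have hp := PlanarMove.exchange b a d
    rw [← hd, Slice.moveTo_pos, show b.pos + b.outs + d = a.pos - b.ins + b.outs by omega] at hp
    simp only [Option.some.injEq] at h
    subst h
    exact .symm (.step (.inl hp) hz hx)

theorem of_slideWith {a b : Slice} {z : List Slice} {st r : List Bool}
    (h : a.slideWith b = some z) (hx : run st [a, b] = some r) (hz : run st z = some r) :
    TangleEq st [a, b] z := by
  unfold Slice.slideWith at h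
  split at h
  · split_ifs at h with h1 h2 <;> simp only [Option.some.injEq] at h <;> subst h
    · subst h1
      exact .step (.inl (.slideMax _ _ _)) hx hz
    · subst h2
      refine .symm (.step (.inl ?_) hz hx)
      simpa using PlanarMove.slideMax _ _ (!_)
  · split_ifs at h with h1 h2 <;> simp only [Option.some.injEq] at h <;> subst h
    · subst h1
      exact .step (.inl (.slideMin _ _)) hx hz
    · subst h2
      refine .symm (.step (.inl ?_) hz hx)
      simpa using PlanarMove.slideMin _ (!_)
  · simp at h

theorem of_cancelWith {a b : Slice} {z : List Slice} {st r : List Bool}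
    (h : a.cancelWith b = some z) (hx : run st [a, b] = some r) (hz : run st z = some r) :
    TangleEq st [a, b] z := by
  unfold Slice.cancelWith at h
  split at h
  · split_ifs at h with h1
    simp only [Option.some.injEq] at h
    subst h
    rcases h1 with rfl | rfl
    · exact .step (.inl (.zigzagLeft _ _)) hx hz
    · exact .step (.inl (.zigzagRight _ _)) hx hz
  · split_ifs at h with h1
    simp only [Option.some.injEq] at h
    subst h h1
    exact .step (.inr (.oneMax _ _ _)) hx hz
  · split_ifs at h with h1
    simp only [Option.some.injEq] at h
    subst h h1
    exact .step (.inr (.oneMin _ _)) hx hz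
  · split_ifs at h with h1
    simp only [Option.some.injEq] at h
    subst h
    obtain ⟨rfl, rfl⟩ := h1
    exact .step (.inr (.two _ _)) hx hz
  · simp at h

/-- Rewrite the slices `n` and `n + 1` of a word. -/
def rewriteAt (st : List Bool) (n : ℕ) (k : Slice.Rewriting) (w : List Slice) :
    Option (List Slice) :=
  match w.drop n with
  | a :: b :: v =>
    (Slice.rewrite k a b).bind fun z =>
      (run st (w.take n)).bind fun s =>
        (run s [a, b]).bind fun r =>
          if run s z = some r then some (w.take n ++ z ++ v) else none
  | _ => none

/-- Perform a list of rewritings. -/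
def rewriteList (st : List Bool) : List (ℕ × Slice.Rewriting) → List Slice → Option (List Slice)
  | [], w => some w
  | p :: ps, w => (rewriteAt st p.1 p.2 w).bind (rewriteList st ps)

theorem of_rewriteAt {st : List Bool} {n : ℕ} {k : Slice.Rewriting} {w w' : List Slice}
    (h : rewriteAt st n k w = some w') : TangleEq st w w' := by
  unfold rewriteAt at h
  split at h
  · rename_i a b v hd
    simp only [Option.bind_eq_some_iff] at h
    obtain ⟨z, hz, s, hs, r, hr, h⟩ := h
    split_ifs at h with hz'
    simp only [Option.some.injEq] at h
    subst h
    have hw : w = w.take n ++ [a, b] ++ v := by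
      conv_lhs => rw [← List.take_append_drop n w, hd]
      simp
    have : TangleEq s [a, b] z := by
      cases k
      · exact of_swapWith hz hr hz'
      · exact of_slideWith hz hr hz'
      · exact of_cancelWith hz hr hz'
    exact (of_eq st hw).trans (.congr v hs this)
  · simp at h

/-- Turns an explicit isotopy into a computation: a list of positions and kinds of rewriting
describes it, and evaluation of `rewriteList` on concrete orientations checks it, including that the
intermediate words fit. -/
theorem of_rewriteList {st : List Bool} (ps : List (ℕ × Slice.Rewriting)) :
    ∀ {w w' : List Slice}, rewriteList st ps w = some w' → TangleEq st w w' := by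
  induction ps with
  | nil =>
    intro w w' h
    simp only [rewriteList, Option.some.injEq] at h
    exact of_eq st h
  | cons p ps ih =>
    intro w w' h
    simp only [rewriteList, Option.bind_eq_some_iff] at h
    obtain ⟨w1, h1, h2⟩ := h
    exact (of_rewriteAt h1).trans (ih h2)

end TangleEq

/-! ### Split circles -/

theorem unlinkDiagram_succ (m : ℕ) :
    unlinkDiagram (m + 1) = [Slice.birth 0 true, Slice.death 0] ++ unlinkDiagram m := by
  simp [unlinkDiagram, List.replicate_succ]

theorem unlinkDiagram_zero : unlinkDiagram 0 = [] := rfl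

theorem unlinkDiagram_add (m n : ℕ) :
    unlinkDiagram (m + n) = unlinkDiagram m ++ unlinkDiagram n := by
  simp only [unlinkDiagram, List.replicate_add, List.flatten_append]

theorem run_unlinkDiagram (st : List Bool) (m : ℕ) : run st (unlinkDiagram m) = some st := by
  induction m with
  | zero => rfl
  | succ m ih =>
    rw [unlinkDiagram_succ, run_append_of (st' := st) (by simp [run_cons, Slice.act]), ih]

namespace TangleEq

/-- A circle can be moved to the far left and given the standard orientation. -/
theorem circle_whisker (s : Bool) (A : List Bool) : ∀ B : List Bool,
    TangleEq (A ++ B) [Slice.birth A.length s, Slice.death A.length] (unlinkDiagram 1) := by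
  induction A using List.reverseRecOn with
  | nil =>
    intro B
    suffices h : TangleEq [] [Slice.birth 0 s, Slice.death 0] (unlinkDiagram 1) from
      h.whisker_right B
    cases s
    -- A circle with one kink: read as a kink at the maximum it gives one orientation, read as a
    -- kink at the minimum the other.
    · exact (of_rewriteList (w := [Slice.birth 0 true, Slice.cross 0 true, Slice.death 0])
        [(0, .cancel)] rfl).symm.trans (of_rewriteList [(1, .cancel)] rfl)
    · exact .refl _ _
  | append_singleton A a ih =>
    intro B
    have h1 : TangleEq [a] [Slice.birth 1 s, Slice.death 1] [Slice.birth 0 s, Slice.death 0] := by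
      -- The circle passes the strand at its left: a bigon is inserted in the middle of the circle,
      -- maximum and minimum slide across the strand, and the bigon that remains is removed.
      refine (of_rewriteList (w := [Slice.birth 1 s, Slice.cross 0 true, Slice.cross 0 false,
        Slice.death 1]) [(1, .cancel)] ?_).symm.trans
        (of_rewriteList [(0, .slide), (2, .slide), (1, .cancel)] ?_) <;>
      cases s <;> cases a <;> rfl
    have h2 := h1.whisker A B
    have h3 := ih (a :: B)
    simp only [sh_cons, Slice.shift, sh_nil, Nat.zero_add, Nat.add_comm 1] at h2
    simp only [List.length_append, List.length_singleton]
    refine h2.trans ?_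
    simpa using h3

theorem circle {st : List Bool} {i : ℕ} (s : Bool) (hi : i ≤ st.length) :
    TangleEq st [Slice.birth i s, Slice.death i] (unlinkDiagram 1) := by
  have h := circle_whisker s (st.take i) (st.drop i)
  rwa [List.take_append_drop, List.length_take_of_le hi] at h

/-- Split circles can be moved through any tangle. -/
theorem unlinkDiagram_comm {st st' : List Bool} {w : List Slice} (m : ℕ)
    (h : run st w = some st') : TangleEq st (unlinkDiagram m ++ w) (w ++ unlinkDiagram m) := by
  have h1 := exchange (unlinkDiagram m) (run_unlinkDiagram [] m) h
  simpa [sh_zero] using h1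

theorem sh_unlinkDiagram (A st : List Bool) (m : ℕ) :
    TangleEq (A ++ st) (sh A.length (unlinkDiagram m)) (unlinkDiagram m) := by
  induction m with
  | zero => exact .refl _ _
  | succ m ih =>
    rw [unlinkDiagram_succ, sh_append]
    have h : TangleEq (A ++ st) (sh A.length [Slice.birth 0 true, Slice.death 0])
        [Slice.birth 0 true, Slice.death 0] := by
      have h := circle_whisker true A st
      simpa [Slice.shift, unlinkDiagram_succ, unlinkDiagram_zero] using h
    exact h.append (by rw [h.run_eq]; exact run_unlinkDiagram _ 1) ih

end TangleEq

/-- The tangle `x` is the tangle `y` together with `j` split circles. -/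
def SplitsTo (st : List Bool) (j : ℕ) (x y : List Slice) : Prop :=
  TangleEq st x (y ++ unlinkDiagram j)

theorem TangleEq.splitsTo {st : List Bool} {x y : List Slice} (h : TangleEq st x y) :
    SplitsTo st 0 x y := by
  simpa [SplitsTo, unlinkDiagram_zero] using h

namespace SplitsTo

variable {st st₁ st₂ : List Bool} {i j : ℕ} {u v x y z x' y' : List Slice}

theorem refl (st : List Bool) (x : List Slice) : SplitsTo st 0 x x := (TangleEq.refl st x).splitsTo

theorem run_eq (h : SplitsTo st j x y) : run st x = run st y := by
  have h' := TangleEq.run_eq h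
  rw [run_append] at h'
  simpa [run_unlinkDiagram] using h'

theorem trans (h : SplitsTo st i x y) (h' : SplitsTo st j y z) : SplitsTo st (i + j) x z := by
  have h2 := TangleEq.append_right (unlinkDiagram i) h'
  rw [List.append_assoc, ← unlinkDiagram_add, Nat.add_comm j] at h2
  exact TangleEq.trans h h2

/-- The circles of the first factor slide down through `y'` and join those of the second. -/
theorem append (hx : run st x = some st₁) (h : SplitsTo st i x y) (hx' : run st₁ x' = some st₂)
    (h' : SplitsTo st₁ j x' y') : SplitsTo st (i + j) (x ++ x') (y ++ y') := by
  have hy : run st y = some st₁ := by rw [← h.run_eq, hx]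
  have hy' : run st₁ y' = some st₂ := by rw [← h'.run_eq, hx']
  have h1 := TangleEq.append h hx h'
  have h2 : TangleEq st₁ (unlinkDiagram i ++ (y' ++ unlinkDiagram j))
      (y' ++ unlinkDiagram i ++ unlinkDiagram j) := by
    rw [← List.append_assoc]
    exact (TangleEq.unlinkDiagram_comm i hy').append_right _
  refine h1.trans ?_
  have h3 := TangleEq.append_left hy h2
  simpa [unlinkDiagram_add] using h3

theorem append_left (hu : run st u = some st₁) (hx : run st₁ x = some st₂)
    (h : SplitsTo st₁ j x y) : SplitsTo st j (u ++ x) (u ++ y) := by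
  simpa using append hu (refl st u) hx h

theorem append_right (hx : run st x = some st₁) (hv : run st₁ v = some st₂)
    (h : SplitsTo st j x y) : SplitsTo st j (x ++ v) (y ++ v) := by
  simpa using append hx h hv (refl st₁ v)

theorem whisker (A B : List Bool) (hx : run st x = some st₁) (h : SplitsTo st j x y) :
    SplitsTo (A ++ st ++ B) j (sh A.length x) (sh A.length y) := by
  have hy : run st y = some st₁ := by rw [← h.run_eq, hx]
  have h1 := TangleEq.whisker A B h
  rw [sh_append] at h1
  refine h1.trans (TangleEq.append_left (run_whisker A B hy) ?_)
  rw [List.append_assoc]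
  exact TangleEq.sh_unlinkDiagram _ _ _

end SplitsTo

/-! ### Tangles of trees with a strip of the bottom tree -/

/-- The tangle of a leaf: the leaf is joined with the third strand over the second one. -/
def leafTangle : List Slice := [.cross 1 false, .death 0]

/-- The tangle of a leaf after a crossing change. -/
def claspTangle : List Slice := [.cross 1 true, .death 0]

/-- The tangle in which the root is continued downward. -/
def capTangle : List Slice := [.death 1]

/-- The tangle of a caret of colour `c` with subtangles `L` and `R`. -/
def joinTangle (c : Bool) (L R : List Slice) : List Slice :=
  [.birth 0 c, .cross 1 true] ++ sh 2 R ++ L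

theorem run_joinTangle {c x y : Bool} {L R : List Slice} (hR : run [!c, x, y] R = some [!c])
    (hL : run [c, c, !c] L = some [c]) : run [c, x, y] (joinTangle c L R) = some [c] := by
  unfold joinTangle
  rw [run_append_of (st' := [c, c, !c]), hL]
  rw [run_append_of (st' := [c, c] ++ [!c, x, y]) (by simp [run_cons, Slice.act])]
  have h := run_sh R [c, c] [!c, x, y]
  rw [hR] at h
  exact h

theorem joinTangle_congr {c x y : Bool} {L L' R R' : List Slice} {i j : ℕ}
    (hR : run [!c, x, y] R = some [!c]) (hL : run [c, c, !c] L = some [c])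
    (h : SplitsTo [!c, x, y] i R R') (h' : SplitsTo [c, c, !c] j L L') :
    SplitsTo [c, x, y] (i + j) (joinTangle c L R) (joinTangle c L' R') := by
  have h1 : run [c, x, y] [.birth 0 c, .cross 1 true] = some ([c, c] ++ [!c, x, y] ++ []) := by
    simp [run_cons, Slice.act]
  have h2 := run_whisker [c, c] [] hR
  exact .append (by rw [run_append_of h1]; exact h2)
    (.append_left h1 h2 (h.whisker [c, c] [] hR)) hL h'

/-- This lemma and the next five form the table of joins behind the moves. Each entry is an explicit
isotopy, apart from the one circle in `joinTangle_leaf_cap`. -/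
theorem joinTangle_leaf_leaf (c : Bool) :
    TangleEq [c, !c, c] (joinTangle c leafTangle leafTangle) capTangle :=
  .of_rewriteList [(2, .slide), (0, .slide), (1, .swap), (2, .swap), (0, .slide), (1, .swap),
    (0, .cancel), (2, .slide), (1, .cancel), (0, .cancel)] (by cases c <;> rfl)

theorem joinTangle_cap_cap (c x : Bool) :
    TangleEq [c, x, !x] (joinTangle c capTangle capTangle) capTangle :=
  .of_rewriteList [(1, .swap), (2, .cancel), (0, .swap), (1, .cancel)]
    (by cases c <;> cases x <;> rfl)

theorem joinTangle_leaf_cap (c x : Bool) :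
    SplitsTo [c, x, !x] 1 (joinTangle c leafTangle capTangle) capTangle := by
  have h : TangleEq [c, x, !x] (joinTangle c leafTangle capTangle)
      (capTangle ++ [.birth 0 c, .death 0]) :=
    .of_rewriteList [(1, .swap), (2, .cancel), (0, .swap)] (by cases c <;> cases x <;> rfl)
  refine h.trans (.append_left (st₁ := [c]) (by cases c <;> cases x <;> rfl) ?_)
  exact .circle c (Nat.zero_le _)

theorem joinTangle_cap_leaf (c : Bool) :
    TangleEq [c, !c, c] (joinTangle c capTangle leafTangle) [.death 0] :=
  .of_rewriteList [(2, .slide), (0, .slide), (1, .swap), (2, .swap), (0, .slide), (1, .swap),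
    (0, .cancel), (1, .slide), (0, .cancel)] (by cases c <;> rfl)

theorem joinTangle_leaf_death (c : Bool) :
    TangleEq [c, c, !c] (joinTangle c leafTangle [.death 0]) capTangle :=
  .of_rewriteList [(0, .slide), (1, .swap), (0, .cancel), (1, .slide), (0, .cancel)]
    (by cases c <;> rfl)

/-- The result differs from `leafTangle` only in the type of its crossing. This is the source of the
crossing change in move 6. -/
theorem joinTangle_cap_death (c : Bool) :
    TangleEq [c, c, !c] (joinTangle c capTangle [.death 0]) claspTangle :=
  .of_rewriteList [(0, .slide), (1, .swap), (0, .cancel), (0, .slide)]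
    (by cases c <;> rfl)

/-- A ring around a strand of orientation `c`, whose right side carries the tangle `K`. -/
def ringAround (c : Bool) (K : List Slice) : List Slice :=
  [.birth 1 c, .cross 0 false, .cross 0 false] ++ sh 2 K ++ [.death 1]

theorem run_ringAround {c : Bool} {K : List Slice} (hK : run [!c] K = some [!c]) :
    run [c] (ringAround c K) = some [c] := by
  unfold ringAround
  rw [List.append_assoc, run_append_of (st' := [c, c] ++ [!c]) (by simp [run_cons, Slice.act]),
    run_append_of (st' := [c, c] ++ [!c])]
  · simp [run_cons, Slice.act]
  · have h := run_sh K [c, c] [!c]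
    rw [hK] at h
    exact h

/-- The maximum of the caret becomes the maximum of a ring. The crossing of the caret and that of
the clasp slide to the left side of this ring, where they link it with the root strand, and `K`
stays on its right side. -/
theorem joinTangle_clasp {c x : Bool} {K : List Slice} (hK : run [!c] K = some [!c]) :
    TangleEq [c, x, !x] (joinTangle c claspTangle (capTangle ++ K))
      (capTangle ++ ringAround c K) := by
  have h1 : TangleEq [c, x, !x] [.birth 0 c, .cross 1 true, .death 3]
      [.death 1, .birth 1 c, .cross 0 false] :=
    .of_rewriteList [(1, .swap), (0, .swap), (1, .slide)] (by cases c <;> cases x <;> rfl)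
  have hr1 : run [c, x, !x] [.death 1, .birth 1 c, .cross 0 false] = some ([c, c] ++ [!c]) := by
    cases c <;> cases x <;> rfl
  have h2 : TangleEq [c, c, !c] claspTangle [.cross 0 false, .death 1] :=
    .of_rewriteList [(0, .slide)] (by cases c <;> rfl)
  have hr2 : run ([c, c] ++ [!c]) (sh 2 K) = some ([c, c] ++ [!c]) := by
    have h := run_sh K [c, c] [!c]
    rw [hK] at h
    exact h
  -- `K` lives on the third strand only, so the second crossing of the ring may be moved above it,
  -- next to the first.
  have h3 : TangleEq ([c, c] ++ [!c]) (sh 2 K ++ [.cross 0 false]) ([.cross 0 false] ++ sh 2 K) :=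
    (TangleEq.exchange [.cross 0 false] (s := [c, c]) (s' := [c, c])
      (by simp [run_cons, Slice.act]) hK).symm
  have e1 : joinTangle c claspTangle (capTangle ++ K) =
      [.birth 0 c, .cross 1 true, .death 3] ++ (sh 2 K ++ claspTangle) := by
    simp [joinTangle, capTangle, Slice.shift]
  have e2 : capTangle ++ ringAround c K =
      [.death 1, .birth 1 c, .cross 0 false] ++ ([.cross 0 false] ++ sh 2 K ++ [.death 1]) := by
    simp [ringAround, capTangle]
  rw [e1, e2]
  refine (h1.append_right _).trans (.append_left hr1 ?_)
  refine (TangleEq.append_left hr2 h2).trans ?_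
  simpa using h3.append_right [.death 1]

/-! ### Tangles of ternary trees and the moves other than the sixth -/

namespace TTree

/-- The tangle of a ternary tree whose leftmost vertex has the colour `c`, together with the strip
of the bottom comb below it. -/
def tangle : TTree → Bool → List Slice
  | leaf, _ => leafTangle
  | node a b e, c => joinTangle c (a.tangle c) (joinTangle (!c) (b.tangle (!c)) (e.tangle c))

theorem run_tangle : ∀ (T : TTree) (c : Bool), run [c, c, !c] (T.tangle c) = some [c]
  | leaf, c => by cases c <;> rfl
  | node a b e, c => by
    refine run_joinTangle (run_joinTangle ?_ (b.run_tangle (!c))) (a.run_tangle c)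
    simpa using e.run_tangle c

theorem run_tangle_inner (a b : TTree) (c : Bool) :
    run [c, !c, c] (joinTangle c (a.tangle c) (b.tangle (!c))) = some [c] := by
  refine run_joinTangle ?_ (a.run_tangle c)
  simpa using b.run_tangle (!c)

section

variable {a a' b b' e e' : TTree} {c : Bool} {i j k : ℕ} {A B E : List Slice}

theorem splitsTo_inner (hb : SplitsTo [c, c, !c] i (b.tangle c) B)
    (he : SplitsTo [!c, !c, c] j (e.tangle (!c)) E) :
    SplitsTo [c, !c, c] (j + i) (joinTangle c (b.tangle c) (e.tangle (!c)))
      (joinTangle c B E) :=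
  joinTangle_congr (by simpa using e.run_tangle (!c)) (b.run_tangle c) he hb

theorem splitsTo_node (ha : SplitsTo [c, c, !c] i (a.tangle c) A)
    (h : SplitsTo [!c, c, !c] j (joinTangle (!c) (b.tangle (!c)) (e.tangle c)) B) :
    SplitsTo [c, c, !c] (j + i) ((node a b e).tangle c) (joinTangle c A B) :=
  joinTangle_congr (by simpa using run_tangle_inner b e (!c)) (a.run_tangle c) h ha

theorem splitsTo_tangle_node (ha : SplitsTo [c, c, !c] i (a.tangle c) A)
    (hb : SplitsTo [!c, !c, c] j (b.tangle (!c)) B)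
    (he : SplitsTo [c, c, !c] k (e.tangle c) E) :
    SplitsTo [c, c, !c] (k + j + i) ((node a b e).tangle c)
      (joinTangle c A (joinTangle (!c) B E)) := by
  refine splitsTo_node ha ?_
  have h := splitsTo_inner (c := !c) (i := j) (j := k) (b := b) (e := e) (B := B) (E := E)
    (by simpa using hb) (by simpa using he)
  simpa using h

end

theorem splitsTo_leaf (c : Bool) : SplitsTo [c, c, !c] 0 (leaf.tangle c) leafTangle :=
  .refl _ _

theorem splitsTo_inner_leaf_leaf (c : Bool) :
    SplitsTo [c, !c, c] 0 (joinTangle c (leaf.tangle c) (leaf.tangle (!c))) capTangle :=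
  (joinTangle_leaf_leaf c).splitsTo

/-- The two right leaves give a cap, and a leaf joined with a cap gives a cap and a circle. Trees
that yield caps can therefore be compared with a single caret by counting circles. -/
theorem splitsTo_caret (c : Bool) : SplitsTo [c, c, !c] 1 (caret.tangle c) capTangle := by
  have h := splitsTo_node (splitsTo_leaf c) (by simpa using splitsTo_inner_leaf_leaf (!c))
  exact h.trans (joinTangle_leaf_cap c c)

theorem splitsTo_caret' (c : Bool) : SplitsTo [!c, !c, c] 1 (caret.tangle (!c)) capTangle := by
  simpa using splitsTo_caret (!c)

theorem splitsTo_inner_leaf_caret (c : Bool) :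
    SplitsTo [c, !c, c] 2 (joinTangle c (leaf.tangle c) (caret.tangle (!c))) capTangle :=
  (splitsTo_inner (splitsTo_leaf c) (splitsTo_caret' c)).trans
    (by simpa using joinTangle_leaf_cap c (!c))

theorem splitsTo_inner_caret_caret (c : Bool) :
    SplitsTo [c, !c, c] 2 (joinTangle c (caret.tangle c) (caret.tangle (!c))) capTangle :=
  (splitsTo_inner (splitsTo_caret c) (splitsTo_caret' c)).trans
    (by simpa using (joinTangle_cap_cap c (!c)).splitsTo)

theorem splitsTo_inner_caret_leaf (c : Bool) :
    SplitsTo [c, !c, c] 1 (joinTangle c (caret.tangle c) (leaf.tangle (!c))) [.death 0] :=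
  (splitsTo_inner (e := leaf) (E := leafTangle) (splitsTo_caret c) (.refl _ _)).trans
    (joinTangle_cap_leaf c).splitsTo

theorem splitsTo_node_leaf {b e : TTree} {c : Bool} {j : ℕ}
    (h : SplitsTo [!c, !!c, !c] j (joinTangle (!c) (b.tangle (!c)) (e.tangle (!!c))) capTangle) :
    SplitsTo [c, c, !c] (j + 1) ((node leaf b e).tangle c) capTangle := by
  simp only [Bool.not_not] at h
  exact (splitsTo_node (splitsTo_leaf c) h).trans (joinTangle_leaf_cap c c)

theorem splitsTo_node_caret {b e : TTree} {c : Bool} {j : ℕ}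
    (h : SplitsTo [!c, !!c, !c] j (joinTangle (!c) (b.tangle (!c)) (e.tangle (!!c))) capTangle) :
    SplitsTo [c, c, !c] (j + 1) ((node caret b e).tangle c) capTangle := by
  simp only [Bool.not_not] at h
  exact (splitsTo_node (splitsTo_caret c) h).trans (joinTangle_cap_cap c c).splitsTo

/-- Both carets are caps, with one circle each. The middle one and the leaf combine to `death 0`,
and the left cap joined with this is the clasp. -/
theorem splitsTo_six (c : Bool) :
    SplitsTo [c, c, !c] 2 ((node caret caret leaf).tangle c) claspTangle :=
  (splitsTo_node (splitsTo_caret c) (by simpa using splitsTo_inner_caret_leaf (!c))).trans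
    (joinTangle_cap_death c).splitsTo

/-- As for move 6, the middle caret and the right leaf give `death 0`; but the left subtree is a
leaf, whose crossing cancels, so that a cap results. -/
theorem splitsTo_two (c : Bool) :
    SplitsTo [c, c, !c] 1 ((node leaf caret leaf).tangle c) capTangle :=
  (splitsTo_node (splitsTo_leaf c) (by simpa using splitsTo_inner_caret_leaf (!c))).trans
    (joinTangle_leaf_death c).splitsTo

/-- A tree that yields a cap and circles becomes a single caret and circles. -/
theorem splitsTo_caret_of {T : TTree} {c : Bool} {j : ℕ}
    (h : SplitsTo [c, c, !c] (j + 1) (T.tangle c) capTangle) :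
    SplitsTo [c, c, !c] j (T.tangle c) (caret.tangle c) := by
  have h1 := TangleEq.append_right (unlinkDiagram j) (splitsTo_caret c)
  rw [List.append_assoc, ← unlinkDiagram_add, Nat.add_comm] at h1
  exact TangleEq.trans h h1.symm

/-- A move other than the sixth only splits off circles. -/
theorem _root_.Move.splitsTo {m : ℕ} {T T' : TTree} (h : Move m T T') (hm : m ≠ 6) :
    ∀ c : Bool, ∃ j, SplitsTo [c, c, !c] j (T.tangle c) (T'.tangle c) := by
  induction h with
  | move1 => exact fun c => ⟨_, splitsTo_caret_of (splitsTo_node_caret (splitsTo_inner_leaf_leaf _))⟩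
  | move2 => exact fun c => ⟨_, splitsTo_caret_of (splitsTo_two c)⟩
  | move3 => exact fun c => ⟨_, splitsTo_caret_of (splitsTo_node_leaf (splitsTo_inner_leaf_caret _))⟩
  | move4 => exact fun c => ⟨_, splitsTo_caret_of (splitsTo_node_leaf (splitsTo_inner_caret_caret _))⟩
  | move5 => exact fun c => ⟨_, splitsTo_caret_of (splitsTo_node_caret (splitsTo_inner_leaf_caret _))⟩
  | move6 => exact absurd rfl hm
  | move7 => exact fun c => ⟨_, splitsTo_caret_of (splitsTo_node_caret (splitsTo_inner_caret_caret _))⟩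
  | left b e _ ih =>
    intro c
    obtain ⟨j, hj⟩ := ih hm c
    exact ⟨_, splitsTo_tangle_node hj (.refl _ _) (.refl _ _)⟩
  | middle a e _ ih =>
    intro c
    obtain ⟨j, hj⟩ := ih hm (!c)
    exact ⟨_, splitsTo_tangle_node (.refl _ _) (by simpa using hj) (.refl _ _)⟩
  | right a b _ ih =>
    intro c
    obtain ⟨j, hj⟩ := ih hm c
    exact ⟨_, splitsTo_tangle_node (.refl _ _) (.refl _ _) hj⟩

end TTree

/-- Locally, `y` arises from `x` by turning one positive crossing into a negative one. -/
def ChangesPositive (st : List Bool) (x y : List Slice) : Prop :=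
  ∃ u v i e p a b q, x = u ++ Slice.cross i e :: v ∧ y = u ++ Slice.cross i (!e) :: v ∧
    run st u = some (p ++ a :: b :: q) ∧ p.length = i ∧ crossingPositive a b e = true

namespace ChangesPositive

variable {st st₁ : List Bool} {x y : List Slice}

theorem append_left {w : List Slice} (hw : run st w = some st₁) (h : ChangesPositive st₁ x y) :
    ChangesPositive st (w ++ x) (w ++ y) := by
  obtain ⟨u, v, i, e, p, a, b, q, rfl, rfl, hu, hp, hs⟩ := h
  exact ⟨w ++ u, v, i, e, p, a, b, q, by simp, by simp, by rw [run_append_of hw, hu], hp, hs⟩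

theorem append_right (w : List Slice) (h : ChangesPositive st x y) :
    ChangesPositive st (x ++ w) (y ++ w) := by
  obtain ⟨u, v, i, e, p, a, b, q, rfl, rfl, hu, hp, hs⟩ := h
  exact ⟨u, v ++ w, i, e, p, a, b, q, by simp, by simp, hu, hp, hs⟩

theorem whisker (A B : List Bool) (h : ChangesPositive st x y) :
    ChangesPositive (A ++ st ++ B) (sh A.length x) (sh A.length y) := by
  obtain ⟨u, v, i, e, p, a, b, q, rfl, rfl, hu, hp, hs⟩ := h
  refine ⟨sh A.length u, sh A.length v, i + A.length, e, A ++ p, a, b, q ++ B, by simp [Slice.shift],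
    by simp [Slice.shift], ?_, by simp [hp, Nat.add_comm], hs⟩
  rw [run_whisker A B hu]
  simp

theorem joinTangle_left {c x' y' : Bool} {L L' R : List Slice}
    (hR : run [!c, x', y'] R = some [!c]) (h : ChangesPositive [c, c, !c] L L') :
    ChangesPositive [c, x', y'] (joinTangle c L R) (joinTangle c L' R) := by
  refine append_left ?_ h
  rw [run_append_of (st' := [c, c] ++ [!c, x', y']) (by simp [run_cons, Slice.act])]
  have h := run_sh R [c, c] [!c, x', y']
  rw [hR] at h
  exact h

theorem joinTangle_right {c x' y' : Bool} {L R R' : List Slice}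
    (h : ChangesPositive [!c, x', y'] R R') :
    ChangesPositive [c, x', y'] (joinTangle c L R) (joinTangle c L R') := by
  refine append_right _ (append_left (st₁ := [c, c] ++ [!c, x', y'] ++ [])
    (by simp [run_cons, Slice.act]) ?_)
  exact whisker [c, c] [] h

end ChangesPositive

/-- The sixth move splits off circles and turns a positive crossing into a negative one. -/
theorem Move.changesPositive {m : ℕ} {T T' : TTree} (h : Move m T T') (hm : m = 6) :
    ∀ c : Bool, ∃ j w, SplitsTo [c, c, !c] j (T.tangle c) w ∧
      ChangesPositive [c, c, !c] w (T'.tangle c) := by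
  induction h with
  | move1 | move2 | move3 | move4 | move5 | move7 => simp at hm
  | move6 =>
    intro c
    -- The clasp and the tangle of a leaf agree except for the type of the crossing. Its strands
    -- have opposite orientations `c` and `!c`, so the type `true` is positive for both values of
    -- `c`.
    refine ⟨2, _, TTree.splitsTo_six c, [], [.death 0], 1, true, [c], c, !c, [], rfl, rfl, rfl,
      rfl, by cases c <;> rfl⟩
  | @left m a a' b e _ ih =>
    intro c
    obtain ⟨j, w, hj, hw⟩ := ih hm c
    refine ⟨_, _, TTree.splitsTo_tangle_node hj (.refl _ _) (.refl _ _), hw.joinTangle_left ?_⟩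
    simpa using TTree.run_tangle_inner b e (!c)
  | @middle m a b b' e _ ih =>
    intro c
    obtain ⟨j, w, hj, hw⟩ := ih hm (!c)
    refine ⟨_, _, TTree.splitsTo_tangle_node (.refl _ _) (by simpa using hj) (.refl _ _),
      .joinTangle_right ?_⟩
    refine hw.joinTangle_left ?_
    simpa using e.run_tangle c
  | right a b _ ih =>
    intro c
    obtain ⟨j, w, hj, hw⟩ := ih hm c
    refine ⟨_, _, TTree.splitsTo_tangle_node (.refl _ _) (.refl _ _) hj,
      .joinTangle_right (.joinTangle_right ?_)⟩
    simpa using hw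

namespace BTree

/-! ### Strands and colours -/

theorem upperTangle_add (k : ℕ) : ∀ (T : BTree) (c : Bool) (p : ℕ),
    T.upperTangle c (p + k) = sh k (T.upperTangle c p)
  | leaf, _, _ => rfl
  | node l r, c, p => by
    simp only [upperTangle, sh_cons, sh_append, Slice.shift, ← l.upperTangle_add k,
      ← r.upperTangle_add k, Nat.add_right_comm _ k]

theorem lowerTangle_add (k : ℕ) : ∀ (T : BTree) (p : ℕ),
    T.lowerTangle (p + k) = sh k (T.lowerTangle p)
  | leaf, _ => rfl
  | node l r, p => by
    simp only [lowerTangle, sh_cons, sh_append, Slice.shift, ← l.lowerTangle_add k,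
      ← r.lowerTangle_add k, Nat.add_right_comm _ k, sh_nil]

theorem upperTangle_eq_sh (T : BTree) (c : Bool) (p : ℕ) :
    T.upperTangle c p = sh p (T.upperTangle c 0) := by
  simpa using T.upperTangle_add p c 0

theorem lowerTangle_eq_sh (T : BTree) (p : ℕ) : T.lowerTangle p = sh p (T.lowerTangle 0) := by
  simpa using T.lowerTangle_add p 0

/-- Orientations of the strands below the upper tangle. -/
def strands : BTree → Bool → List Bool
  | leaf, c => [c]
  | node l r, c => l.strands c ++ c :: r.strands (!c)

/-- Colours of the vertices of the Tait graph of a tree. -/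
def colours : BTree → Bool → List Bool
  | leaf, c => [c]
  | node l r, c => l.colours c ++ r.colours (!c)

theorem length_colours : ∀ (T : BTree) (c : Bool), (T.colours c).length = T.leaves
  | leaf, _ => rfl
  | node l r, c => by
    rw [colours, List.length_append, l.length_colours, r.length_colours, leaves]

theorem length_strands : ∀ (T : BTree) (c : Bool), (T.strands c).length + 1 = 2 * T.leaves
  | leaf, _ => rfl
  | node l r, c => by
    have hl := l.length_strands c
    have hr := r.length_strands (!c)
    simp only [strands, leaves, List.length_append, List.length_cons]
    omega

/-- A black region of colour `d` has left boundary `!d` and right boundary `d`. Once the left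
boundary of the first region is added, the strands come in such pairs. In particular the colours
determine the strands. -/
theorem cons_strands : ∀ (T : BTree) (c : Bool),
    (!c) :: T.strands c = (T.colours c).flatMap fun d => [!d, d]
  | leaf, _ => rfl
  | node l r, c => by
    have hr := r.cons_strands (!c)
    rw [Bool.not_not] at hr
    rw [strands, colours, List.flatMap_append, ← l.cons_strands c, ← hr]
    rfl

theorem strands_congr {T S : BTree} {c : Bool} (h : T.colours c = S.colours c) :
    T.strands c = S.strands c := by
  have h1 := T.cons_strands c
  rw [h, ← S.cons_strands c] at h1
  exact (List.cons.inj h1).2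

theorem run_upperTangle : ∀ (T : BTree) (c : Bool),
    run [c] (T.upperTangle c 0) = some (T.strands c)
  | leaf, _ => rfl
  | node l r, c => by
    have h1 : run ([c, c] ++ [!c] ++ []) (sh 2 (r.upperTangle (!c) 0)) =
        some ([c, c] ++ r.strands (!c) ++ []) := run_whisker [c, c] [] (r.run_upperTangle (!c))
    have h2 := run_append_right _ (c :: r.strands (!c)) (l.run_upperTangle c)
    have h0 : run [c] [.birth 0 c, .cross 1 true] = some ([c, c] ++ [!c] ++ []) := by
      simp [run_cons, Slice.act]
    have e : (node l r).upperTangle c 0 = [.birth 0 c, .cross 1 true] ++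
        (sh 2 (r.upperTangle (!c) 0) ++ l.upperTangle c 0) := by
      rw [upperTangle, r.upperTangle_eq_sh _ (0 + 2)]; rfl
    rw [e, run_append_of h0, run_append_of h1]
    simpa [strands] using h2

theorem run_lowerTangle : ∀ (T : BTree) (c : Bool),
    run (T.strands c) (T.lowerTangle 0) = some [c]
  | leaf, _ => rfl
  | node l r, c => by
    have h1 := run_whisker [c, c] [] (r.run_lowerTangle (!c))
    have h2 := run_append_right _ (c :: r.strands (!c)) (l.run_lowerTangle c)
    have e : (node l r).lowerTangle 0 =
        l.lowerTangle 0 ++ (sh 2 (r.lowerTangle 0) ++ [.cross 1 false, .death 0]) := by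
      rw [lowerTangle, r.lowerTangle_eq_sh (0 + 2)]; simp
    have h3 : run [c, c, !c] [.cross 1 false, .death 0] = some [c] := by cases c <;> rfl
    rw [e, strands, run_append_of h2, run_append_of (by simpa using h1)]
    simpa using h3

/-- The colours `c`, `!c`, `c`, … -/
def alternating : ℕ → Bool → List Bool
  | 0, _ => []
  | n + 1, c => c :: alternating n (!c)

theorem alternating_add (m n : ℕ) : ∀ c : Bool, alternating (m + n) c =
    alternating m c ++ alternating n (if Even m then c else !c) := by
  induction m with
  | zero => intro c; simp [alternating]
  | succ m ih =>
    intro c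
    rw [Nat.add_right_comm, alternating, ih, alternating]
    by_cases h : Even m <;> simp [h, Nat.even_add_one]

theorem length_alternating (n : ℕ) : ∀ c : Bool, (alternating n c).length = n := by
  induction n with
  | zero => intro c; rfl
  | succ n ih => intro c; simp [alternating, ih]

theorem colours_rightComb (n : ℕ) : ∀ c : Bool,
    (rightComb n).colours c = alternating (n + 1) c := by
  induction n with
  | zero => intro c; rfl
  | succ n ih => intro c; rw [rightComb, colours, ih, alternating]; rfl

end BTree

/-! ### Colours of ternary trees alternate -/

namespace TTree

theorem odd_leaves_alpha : ∀ T : TTree, Odd T.alpha.leaves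
  | leaf => odd_one
  | node a b e => by
    have ha := a.odd_leaves_alpha
    have hb := b.odd_leaves_alpha
    have he := e.odd_leaves_alpha
    simp only [alpha, BTree.leaves]
    exact ha.add_even (hb.add_odd he)

/-- The three subtrees start with the colours `c`, `!c`, `c`. As they have oddly many leaves, these
are the colours with which an alternating sequence reaches them. -/
theorem colours_alpha : ∀ (T : TTree) (c : Bool),
    T.alpha.colours c = BTree.alternating T.alpha.leaves c
  | leaf, _ => rfl
  | node a b e, c => by
    simp only [alpha, BTree.colours, BTree.leaves, a.colours_alpha, b.colours_alpha,
      e.colours_alpha, BTree.alternating_add, Nat.not_even_iff_odd.2 a.odd_leaves_alpha,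
      Nat.not_even_iff_odd.2 b.odd_leaves_alpha, if_false]

theorem colours_positivePair (T : TTree) (c : Bool) :
    T.positivePair.top.colours c = T.positivePair.bot.colours c := by
  have := T.alpha.leaves_pos
  simp only [positivePair]
  rw [colours_alpha, BTree.colours_rightComb, Nat.sub_add_cancel this]

end TTree

namespace TreePair

/-- Both trees induce the same colours. -/
def Coloured (P : TreePair) : Prop := P.top.colours true = P.bot.colours true

theorem link_eq (P : TreePair) : P.link = [.birth 0 false] ++
    sh 1 (P.top.upperTangle true 0 ++ P.bot.lowerTangle 0) ++ [.death 0] := by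
  rw [link, P.top.upperTangle_eq_sh, P.bot.lowerTangle_eq_sh]
  simp

/-- The two tangles can be glued along the horizontal axis because equal colours give equal
orientations there. -/
theorem Coloured.isDiagram {P : TreePair} (h : P.Coloured) : IsDiagram P.link := by
  have h1 := P.top.run_upperTangle true
  rw [BTree.strands_congr h] at h1
  have h2 : run [true] (P.top.upperTangle true 0 ++ P.bot.lowerTangle 0) = some [true] := by
    rw [run_append_of h1, P.bot.run_lowerTangle]
  have h3 : run ([false] ++ [true] ++ [])
      (sh 1 (P.top.upperTangle true 0 ++ P.bot.lowerTangle 0)) = some ([false] ++ [true] ++ []) :=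
    run_whisker [false] [] h2
  rw [IsDiagram, link_eq, List.append_assoc,
    run_append_of (st' := [false] ++ [true] ++ []) rfl, run_append_of h3]
  rfl

end TreePair

/-! ### The link of a ternary tree as the closure of its tangle -/

/-- The lower tangle of the right comb, applied to `m` leaves and two further strands. -/
def combSteps : ℕ → List Slice
  | 0 => []
  | m + 1 => sh 2 (combSteps m) ++ leafTangle

/-- The strip of the `n` right leaves comes first and acts to the right of the two strands that each
of the `m` left leaves contributes. -/
theorem combSteps_add (m n : ℕ) : combSteps (m + n) = sh (2 * m) (combSteps n) ++ combSteps m := by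
  induction m with
  | zero => simp [combSteps, sh_zero]
  | succ m ih =>
    rw [Nat.add_right_comm, combSteps, ih, combSteps, sh_append, sh_sh, List.append_assoc,
      Nat.mul_succ]

theorem BTree.lowerTangle_rightComb (n : ℕ) : (rightComb n).lowerTangle 0 = combSteps n := by
  induction n with
  | zero => rfl
  | succ n ih =>
    rw [rightComb, lowerTangle, lowerTangle_eq_sh _ (0 + 2), ih, combSteps]
    rfl

/-- The left upper part `uL` acts on the first strand only and the right strip `kR` to the right of
it, so their heights can be exchanged. Then the whole upper tangle lies above both strips. -/
theorem joinTangle_split {c x y : Bool} {L R uL uR kL kR : List Slice} {sL sR : List Bool}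
    (hL : TangleEq [c, c, !c] L (uL ++ kL)) (hR : TangleEq [!c, x, y] R (uR ++ kR))
    (huL : run [c] uL = some sL) (huR : run [!c] uR = some sR)
    (hR' : run [!c, x, y] R = some [!c]) :
    TangleEq [c, x, y] (joinTangle c L R)
      ([.birth 0 c, .cross 1 true] ++ sh 2 uR ++ uL ++ (sh (sL.length + 1) kR ++ kL)) := by
  have h0 : run [c, x, y] [.birth 0 c, .cross 1 true] = some ([c, c] ++ [!c, x, y] ++ []) := by
    simp [run_cons, Slice.act]
  have h1 : TangleEq ([c, c] ++ [!c, x, y] ++ []) (sh 2 R ++ L) (sh 2 (uR ++ kR) ++ (uL ++ kL)) :=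
    .append (hR.whisker [c, c] []) (run_whisker [c, c] [] hR') hL
  have h2 : run ([c, c] ++ [!c, x, y] ++ []) (sh 2 uR) = some ([c] ++ (c :: (sR ++ [x, y]))) := by
    have h : run ([c, c] ++ [!c] ++ [x, y]) (sh 2 uR) = some ([c, c] ++ sR ++ [x, y]) :=
      run_whisker [c, c] [x, y] huR
    simpa using h
  have hk : run (sR ++ [x, y]) kR = some [!c] := by
    rw [← run_append_of (run_append_right _ [x, y] huR)]
    exact hR.run_eq.symm.trans hR'
  have h3 : run (c :: (sR ++ [x, y])) (sh 1 kR) = some [c, !c] := by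
    have h : run ([c] ++ (sR ++ [x, y]) ++ []) (sh 1 kR) = some ([c] ++ [!c] ++ []) :=
      run_whisker [c] [] hk
    simpa using h
  have ex := (TangleEq.exchange uL huL h3).symm
  rw [sh_sh, Nat.add_comm 1] at ex
  have h4 := (ex.append_right kL).append_left (u := [.birth 0 c, .cross 1 true] ++ sh 2 uR)
    (by rw [run_append_of h0, h2])
  refine (TangleEq.of_eq _ ?_).trans ((h1.append_left h0).trans ((TangleEq.of_eq _ ?_).trans
    (h4.trans (TangleEq.of_eq _ ?_))))
  · simp [joinTangle]
  · simp
  · simp [sh_sh, Nat.add_comm]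

theorem BTree.upperTangle_node (l r : BTree) (c : Bool) : (node l r).upperTangle c 0 =
    [.birth 0 c, .cross 1 true] ++ sh 2 (r.upperTangle (!c) 0) ++ l.upperTangle c 0 := by
  rw [upperTangle, r.upperTangle_eq_sh _ (0 + 2)]
  simp

theorem BTree.joinTangle_tangle {c x y : Bool} {L R : List Slice} {l r : BTree}
    (hL : TangleEq [c, c, !c] L (l.upperTangle c 0 ++ combSteps l.leaves))
    (hR : TangleEq [!c, x, y] R (r.upperTangle (!c) 0 ++ combSteps r.leaves))
    (hR' : run [!c, x, y] R = some [!c]) :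
    TangleEq [c, x, y] (joinTangle c L R)
      ((node l r).upperTangle c 0 ++ combSteps (node l r).leaves) := by
  have h := joinTangle_split hL hR (l.run_upperTangle c) (r.run_upperTangle (!c)) hR'
  -- The strands of `l` and the vertical strand next to them are `2 * l.leaves` in number, which is
  -- the shift in `combSteps_add`.
  rwa [l.length_strands, ← combSteps_add, ← upperTangle_node] at h

/-- The tangle of a ternary tree is its upper tangle followed by a strip of the lower tangle of the
right comb. -/
theorem TTree.tangle_eq : ∀ (T : TTree) (c : Bool), TangleEq [c, c, !c] (T.tangle c)
    (T.alpha.upperTangle c 0 ++ combSteps T.alpha.leaves)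
  | leaf, c => .of_eq _ rfl
  | node a b e, c => by
    have hb := b.tangle_eq (!c)
    have he : TangleEq [!!c, c, !c] (e.tangle c)
        (e.alpha.upperTangle (!!c) 0 ++ combSteps e.alpha.leaves) := by
      simpa using e.tangle_eq c
    have hi := BTree.joinTangle_tangle (x := c) (y := !c) hb he (by simpa using e.run_tangle c)
    exact BTree.joinTangle_tangle (a.tangle_eq c) hi
      (by simpa using run_tangle_inner b e (!c))

/-- The closure of a tangle with three incoming strands and one outgoing strand. -/
def closeTangle (w : List Slice) : List Slice :=
  [.birth 0 false, .birth 2 true] ++ sh 1 w ++ [.death 0]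

theorem BTree.strands_rightComb (n : ℕ) : ∀ c : Bool, ∃ S : List Bool,
    (rightComb n).strands c = S ++ [if Even n then c else !c] ∧ S.length = 2 * n := by
  induction n with
  | zero => exact fun c => ⟨[], by simp [rightComb, strands]⟩
  | succ n ih =>
    intro c
    obtain ⟨S, h, hl⟩ := ih (!c)
    refine ⟨c :: c :: S, ?_, by simp [hl, Nat.mul_succ]⟩
    rw [rightComb, strands, h]
    by_cases hn : Even n <;> simp [hn, Nat.even_add_one, strands]

/-- The comb has one caret fewer than leaves, so its last leaf has no step of the strip. A zigzag
with a kink on the last strand supplies this step. Its maximum then moves to the top of the upper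
tangle, where it provides the two strip strands needed by `T.tangle true`. -/
theorem TTree.link_positivePair (T : TTree) :
    TangleEq [] T.positivePair.link (closeTangle (T.tangle true)) := by
  obtain ⟨n, hn⟩ := T.odd_leaves_alpha
  have hcol : T.alpha.strands true = (BTree.rightComb (T.alpha.leaves - 1)).strands true :=
    BTree.strands_congr (T.colours_positivePair true)
  obtain ⟨S, hS, hl⟩ := BTree.strands_rightComb (2 * n) true
  rw [hn, Nat.add_sub_cancel, hS] at hcol
  simp only [even_two, Even.mul_right, if_true] at hcol
  have hu := T.alpha.run_upperTangle true
  rw [hcol] at hu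
  have hbot : T.positivePair.bot.lowerTangle 0 = combSteps (2 * n) := by
    change (BTree.rightComb (T.alpha.leaves - 1)).lowerTangle 0 = _
    rw [hn, BTree.lowerTangle_rightComb, Nat.add_sub_cancel]
  -- the last leaf is straightened
  have h1 : TangleEq [true] [.birth 1 true, .cross 1 false, .death 0] [] :=
    .of_rewriteList [(0, .cancel), (0, .cancel)] rfl
  have h2 : TangleEq (S ++ [true]) ([.birth (S.length + 1) true] ++ combSteps (2 * n + 1))
      (combSteps (2 * n)) := by
    have h := (h1.whisker_left S).append_right (combSteps (2 * n))
    rw [combSteps_add, hl]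
    simpa [Slice.shift, combSteps, leafTangle, hl, Nat.add_comm 1] using h
  have h3 : TangleEq ([true] ++ []) (T.alpha.upperTangle true 0 ++ [.birth (S.length + 1) true])
      ([.birth 1 true] ++ T.alpha.upperTangle true 0) := by
    have h := TangleEq.exchange (T.alpha.upperTangle true 0) hu
      (show run [] [.birth 0 true] = some [true, false] from rfl)
    simpa [Slice.shift] using h
  have h4 : TangleEq [true] (T.alpha.upperTangle true 0 ++ combSteps (2 * n))
      ([.birth 1 true] ++ T.tangle true) := by
    refine (h2.symm.append_left hu).trans ?_
    rw [← List.append_assoc]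
    refine (h3.append_right _).trans ?_
    rw [List.append_assoc, ← hn]
    exact (T.tangle_eq true).symm.append_left (st₁ := [true, true, false]) rfl
  have h5 := ((h4.whisker [false] []).append_right [.death 0]).append_left
    (u := [.birth 0 false]) (st := []) rfl
  rw [TreePair.link_eq, hbot]
  refine (TangleEq.of_eq _ ?_).trans (h5.trans (TangleEq.of_eq _ ?_))
  · simp [positivePair]
  · simp [closeTangle, Slice.shift]

theorem run_closeTangle_left : run [] [.birth 0 false, .birth 2 true] =
    some ([false] ++ [true, true, !true] ++ []) := rfl

theorem isDiagram_closeTangle {w : List Slice} (h : run [true, true, !true] w = some [true]) :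
    IsDiagram (closeTangle w) := by
  have h1 : run ([false] ++ [true, true, !true] ++ []) (sh 1 w) = some ([false] ++ [true] ++ []) :=
    run_whisker [false] [] h
  rw [IsDiagram, closeTangle, List.append_assoc, run_append_of run_closeTangle_left,
    run_append_of h1]
  rfl

theorem SplitsTo.closeTangle {j : ℕ} {x y : List Slice}
    (hx : run [true, true, !true] x = some [true]) (h : SplitsTo [true, true, !true] j x y) :
    SplitsTo [] j (closeTangle x) (closeTangle y) := by
  have h1 := run_whisker [false] [] hx
  exact .append_right (st₁ := [false, true]) (by rw [run_append_of run_closeTangle_left]; exact h1)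
    (st₂ := []) rfl (.append_left run_closeTangle_left h1 (h.whisker [false] [] hx))

theorem ChangesPositive.closeTangle {x y : List Slice}
    (h : ChangesPositive [true, true, !true] x y) :
    ChangesPositive [] (closeTangle x) (closeTangle y) :=
  .append_right _ (.append_left run_closeTangle_left (h.whisker [false] []))

theorem ChangesPositive.positiveToNegative {D D' : List Slice} (h : ChangesPositive [] D D')
    (hD : IsDiagram D) : PositiveToNegative D D' := ⟨hD, h⟩

/-- Split circles may be deleted. -/
theorem simplifiesTo_of_unlinkDiagram {D : List Slice} (hD : IsDiagram D) (j : ℕ) :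
    SimplifiesTo (D ++ unlinkDiagram j) D := by
  induction j with
  | zero =>
    rw [unlinkDiagram_zero, List.append_nil]
    exact .refl
  | succ j ih =>
    refine .head (.inr (.inr ⟨?_, ?_, D, unlinkDiagram j, _, _, .circle 0 true, ?_, ?_⟩)) ih
    · rw [IsDiagram, run_append_of hD, run_unlinkDiagram]
    · rw [IsDiagram, run_append_of hD, run_unlinkDiagram]
    · simp [unlinkDiagram_succ]
    · simp

theorem SplitsTo.isDiagram {D D' : List Slice} {j : ℕ} (h : SplitsTo [] j D D')
    (hD : IsDiagram D) : IsDiagram D' := by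
  rwa [IsDiagram, ← h.run_eq]

theorem SplitsTo.simplifiesTo {D D' : List Slice} {j : ℕ} (h : SplitsTo [] j D D')
    (hD : IsDiagram D) : SimplifiesTo D D' :=
  (TangleEq.simplifiesTo h hD).trans (simplifiesTo_of_unlinkDiagram (h.isDiagram hD) j)

/-! ### The effect of the moves on links -/

namespace TTree

theorem isDiagram_positivePair (T : TTree) : IsDiagram T.positivePair.link :=
  TreePair.Coloured.isDiagram (T.colours_positivePair true)

theorem isDiagram_close (T : TTree) : IsDiagram (closeTangle (T.tangle true)) :=
  isDiagram_closeTangle (T.run_tangle true)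

end TTree

theorem Move.splitsTo_link {m : ℕ} {T T' : TTree} (h : Move m T T') (hm : m ≠ 6) :
    ∃ j, SplitsTo [] j T.positivePair.link T'.positivePair.link := by
  obtain ⟨j, hj⟩ := h.splitsTo hm true
  have h1 := T.link_positivePair.splitsTo.trans
    ((hj.closeTangle (T.run_tangle true)).trans T'.link_positivePair.symm.splitsTo)
  exact ⟨_, h1⟩

theorem Move.splitsTo_link_six {T T' : TTree} (h : Move 6 T T') :
    ∃ j D D', SplitsTo [] j T.positivePair.link D ∧ PositiveToNegative D D' ∧
      TangleEq [] D' T'.positivePair.link := by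
  obtain ⟨j, w, hj, hw⟩ := h.changesPositive rfl true
  have h1 := hj.closeTangle (T.run_tangle true)
  exact ⟨_, closeTangle w, closeTangle (T'.tangle true), T.link_positivePair.splitsTo.trans h1,
    hw.closeTangle.positiveToNegative (h1.isDiagram T.isDiagram_close),
    T'.link_positivePair.symm⟩

/-! ### Chains -/

/-- A strand of orientation `c` with a chain of `n` rings at its right. -/
def chainStrand : ℕ → Bool → List Slice
  | 0, _ => []
  | n + 1, c => ringAround c (chainStrand n (!c))

theorem run_chainStrand (n : ℕ) : ∀ c : Bool, run [c] (chainStrand n c) = some [c] := by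
  induction n with
  | zero => exact fun _ => rfl
  | succ n ih => exact fun c => run_ringAround (ih (!c))

/-- A ternary tree whose link is a chain of `n + 1` rings. -/
def chainTree : ℕ → TTree
  | 0 => .caret
  | 1 => .node (.node .caret .caret .leaf) .leaf .leaf
  | n + 2 => .node (.node .caret .caret .leaf) (.node .caret .caret .leaf) (chainTree n)

/-- Every subtree `(C, C, ℓ)` is a clasp up to circles, and by `joinTangle_clasp` it puts a ring
around its strand which carries the rest of the chain. The recursion has step two because a ternary
caret offers two places for a clasp before its right subtree. -/
theorem splitsTo_chainTree : ∀ (n : ℕ) (c : Bool),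
    ∃ j, SplitsTo [c, c, !c] j ((chainTree n).tangle c) (capTangle ++ chainStrand n c)
  | 0, c => ⟨1, TTree.splitsTo_caret c⟩
  | 1, c => by
    have h := TTree.splitsTo_node (TTree.splitsTo_six c)
      (by simpa using TTree.splitsTo_inner_leaf_leaf (!c))
    have h2 := (joinTangle_clasp (c := c) (x := c) (K := []) rfl).splitsTo
    rw [List.append_nil] at h2
    exact ⟨_, h.trans h2⟩
  | n + 2, c => by
    obtain ⟨j, hj⟩ := splitsTo_chainTree n c
    have h1 := TTree.splitsTo_inner (c := !c) (TTree.splitsTo_six (!c)) (by simpa using hj)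
    simp only [Bool.not_not] at h1
    have h2 := h1.trans (joinTangle_clasp (c := !c) (x := c) (K := chainStrand n c)
      (by simpa using run_chainStrand n c)).splitsTo
    have h3 := TTree.splitsTo_node (TTree.splitsTo_six c) (by simpa using h2)
    have h4 := joinTangle_clasp (c := c) (x := c) (run_chainStrand (n + 1) (!c))
    refine ⟨_, h3.trans (SplitsTo.trans (TangleEq.of_eq _ ?_).splitsTo h4.splitsTo)⟩
    simp [chainStrand]

theorem reduction_chainTree : ∀ n : ℕ, Reduction (chainTree n) n
  | 0 => .caret
  | 1 => .six (.left _ _ .move6) .caret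
  | n + 2 => by
    -- After the two clasps have become leaves, the tree is `(ℓ, ℓ, T)`. A reduction of `T` runs
    -- inside it; at the end either a single caret is left or one application of move 3 makes it so,
    -- and no further move 6 is needed.
    have key : ∀ {T : TTree} {k : ℕ}, Reduction T k → Reduction (.node .leaf .leaf T) k := by
      intro T k h
      induction h with
      | empty => exact .caret
      | caret => exact .other .move3 (by decide) .caret
      | other h hm _ ih => exact .other (.right _ _ h) hm ih
      | six h _ ih => exact .six (.right _ _ h) ih
    exact .six (.left _ _ .move6) (.six (.middle _ _ .move6) (key (reduction_chainTree n)))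

/-- The maxima of the rings of a chain. -/
def ringMaxima : ℕ → Bool → List Slice
  | 0, _ => []
  | n + 1, c => .birth 0 c :: sh 2 (ringMaxima n (!c))

/-- The clasps of a chain. -/
def ringClasps : ℕ → List Slice
  | 0 => []
  | n + 1 => [.cross 1 false, .cross 1 false] ++ sh 2 (ringClasps n)

theorem ringMaxima_eq (n : ℕ) : ∀ c : Bool, ringMaxima n c =
    (List.range n).map fun j => Slice.birth (2 * j) (c != decide (j % 2 = 1)) := by
  induction n with
  | zero => exact fun _ => rfl
  | succ n ih =>
    intro c
    rw [ringMaxima, ih, List.range_succ_eq_map, sh, List.map_map, List.map_cons, List.map_map]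
    congr 1
    · simp
    · refine List.map_congr_left fun j _ => ?_
      simp only [Function.comp_apply, Slice.shift, Nat.mul_succ]
      congr 1
      rcases Nat.mod_two_eq_zero_or_one j with h | h <;> cases c <;>
        simp [h, Nat.succ_eq_add_one, Nat.add_mod]

theorem ringClasps_eq (n : ℕ) : ringClasps n = (List.range n).flatMap fun j =>
    [Slice.cross (2 * j + 1) false, Slice.cross (2 * j + 1) false] := by
  induction n with
  | zero => rfl
  | succ n ih =>
    rw [ringClasps, ih, List.range_succ_eq_map, List.flatMap_cons, sh, List.map_flatMap,
      List.flatMap_map]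
    congr 1

theorem chainDiagram_eq (n : ℕ) : chainDiagram n =
    ringMaxima (n + 1) false ++ ringClasps n ++ List.replicate (n + 1) (Slice.death 0) := by
  rw [chainDiagram, ringMaxima_eq, ringClasps_eq]
  simp

/-- In `chainStrand` the rings are nested in height. By induction all maxima rise above the outer
clasp and the minimum of the outer ring moves up in front of the inner ones. The statements on `run`
supply the boundary data for these exchanges. -/
theorem sh_chainStrand (n : ℕ) : ∀ c : Bool,
    TangleEq [!c, c] (sh 1 (chainStrand n c) ++ [.death 0])
      (sh 2 (ringMaxima n c) ++ ringClasps n ++ List.replicate (n + 1) (Slice.death 0)) ∧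
    run [!c, c] (sh 1 (chainStrand n c) ++ [.death 0]) = some [] ∧
    ∃ s, run [] (ringMaxima n c) = some s := by
  induction n with
  | zero => exact fun c => ⟨.refl _ _, by cases c <;> rfl, [], rfl⟩
  | succ n ih =>
    intro c
    obtain ⟨h1, hr, s, hs⟩ := ih (!c)
    rw [Bool.not_not] at h1 hr
    have e1 : sh 1 (chainStrand (n + 1) c) ++ [.death 0] =
        [.birth 2 c, .cross 1 false, .cross 1 false] ++
          (sh 2 (sh 1 (chainStrand n (!c)) ++ [.death 0]) ++ [.death 0]) := by
      simp [chainStrand, ringAround, sh_sh, Slice.shift]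
    have hr0 : run [!c, c] [.birth 2 c] = some ([!c, c] ++ [c, !c] ++ []) := by cases c <;> rfl
    have hr1 : run [!c, c] [.birth 2 c, .cross 1 false, .cross 1 false] =
        some ([!c, c] ++ [c, !c] ++ []) := by cases c <;> rfl
    have hr2 : run ([!c, c] ++ [c, !c] ++ [])
        (sh 2 (sh 1 (chainStrand n (!c)) ++ [.death 0])) = some ([!c, c] ++ [] ++ []) :=
      run_whisker [!c, c] [] hr
    have hs' : ∃ s', run [c, !c] (sh 2 (ringMaxima n (!c))) = some s' := by
      have h := run_sh (ringMaxima n (!c)) [c, !c] []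
      rw [hs] at h
      exact ⟨_, h⟩
    refine ⟨?_, ?_, ?_⟩
    · rw [e1]
      have h2 := (h1.whisker [!c, c] []).append_right [.death 0] |>.append_left hr1
      refine h2.trans ?_
      -- the clasp below the outer maxima
      have h3 : TangleEq ([!c, c, c, !c] ++ [])
          ([.cross 1 false, .cross 1 false] ++ sh 4 (ringMaxima n (!c)))
          (sh 4 (ringMaxima n (!c)) ++ [.cross 1 false, .cross 1 false]) :=
        .exchange (s' := [!c, c, c, !c]) _ (by cases c <;> rfl) hs
      obtain ⟨s', hs'⟩ := hs'
      have hm : run ([!c, c] ++ [c, !c] ++ []) (sh 2 (sh 2 (ringMaxima n (!c)))) =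
          some ([!c, c] ++ s' ++ []) := run_whisker [!c, c] [] hs'
      rw [h1.run_eq, List.append_assoc, run_append_of hs', run_append] at hr
      obtain ⟨s'', hc, hd⟩ := Option.bind_eq_some_iff.1 hr
      have hc' : run ([!c, c] ++ s' ++ []) (sh 2 (ringClasps n)) = some ([!c, c] ++ s'' ++ []) :=
        run_whisker [!c, c] [] hc
      -- The two leftmost strands are no longer involved in any crossing, so their minimum may
      -- precede the others, which then also have the position `0`.
      have h4 : TangleEq ([!c, c] ++ s'')
          ([.death 0] ++ sh 0 (List.replicate (n + 1) (Slice.death 0)))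
          (sh 2 (List.replicate (n + 1) (Slice.death 0)) ++ [.death 0]) :=
        .exchange (s := [!c, c]) (s' := []) _ (by cases c <;> rfl) hd
      rw [sh_zero] at h4
      have h5 := (h3.append_right (sh 2 (ringClasps n) ++
        (sh 2 (List.replicate (n + 1) (Slice.death 0)) ++ [.death 0]))).append_left hr0
      have hx : run ([!c, c] ++ [c, !c] ++ []) ([.cross 1 false, .cross 1 false]) =
        some ([!c, c] ++ [c, !c] ++ []) := by cases c <;> rfl
      have hm2 : run [!c, c] ([.birth 2 c, .cross 1 false, .cross 1 false] ++
          sh 4 (ringMaxima n (!c)) ++ sh 2 (ringClasps n)) = some ([!c, c] ++ s'') := by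
        have e : sh 2 (sh 2 (ringMaxima n (!c))) = sh 4 (ringMaxima n (!c)) := sh_sh 2 2 _
        rw [← e, List.append_assoc, run_append_of hr1, run_append_of hm, hc']
        simp
      have h6 := h4.symm.append_left hm2
      refine (TangleEq.of_eq _ ?_).trans (h6.trans ((TangleEq.of_eq _ ?_).trans
        (((h3.append_right (sh 2 (ringClasps n) ++
          ([.death 0] ++ List.replicate (n + 1) (Slice.death 0)))).append_left hr0).trans
            (TangleEq.of_eq _ ?_))))
      · simp [sh_sh]
      · simp
      · simp [ringMaxima, ringClasps, sh_sh, Slice.shift, List.replicate_succ]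
    · rw [e1, run_append_of hr1, run_append_of hr2]
      cases c <;> rfl
    · obtain ⟨s', hs'⟩ := hs'
      exact ⟨s', by rw [ringMaxima, run_cons]; simpa [Slice.act] using hs'⟩

/-- The cap closes the second maximum of `closeTangle` directly; this is the split circle. What
remains is the leftmost ring with the chain at its right. -/
theorem closeTangle_chain (n : ℕ) :
    SplitsTo [] 1 (closeTangle (capTangle ++ chainStrand n true)) (chainDiagram n) := by
  obtain ⟨h1, hr, s, hs⟩ := sh_chainStrand n true
  have h2 := h1.append_left (st := []) (u := [.birth 0 false]) rfl
  have h3 : TangleEq [false, true] [.birth 2 true, .death 2] (unlinkDiagram 1) :=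
    .circle true (by simp)
  have h4 := (TangleEq.unlinkDiagram_comm 1 hr).append_left (st := []) (u := [.birth 0 false]) rfl
  have h5 := (h3.append_right (sh 1 (chainStrand n true) ++ [.death 0])).append_left (st := [])
    (u := [.birth 0 false]) rfl
  have h6 := h2.append_right (unlinkDiagram 1)
  refine (TangleEq.of_eq _ ?_).trans (h5.trans (h4.trans ((TangleEq.of_eq _ ?_).trans
    (h6.trans (TangleEq.of_eq _ ?_)))))
  · simp [closeTangle, capTangle, Slice.shift]
  · simp
  · simp [chainDiagram_eq, ringMaxima]

theorem splitsTo_chainDiagram (n : ℕ) :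
    ∃ j, SplitsTo [] j (chainTree n).positivePair.link (chainDiagram n) := by
  obtain ⟨j, hj⟩ := splitsTo_chainTree n true
  exact ⟨_, (chainTree n).link_positivePair.splitsTo.trans
    ((hj.closeTangle ((chainTree n).run_tangle true)).trans (closeTangle_chain n))⟩

/-! ### Labelled diagrams

A label is chosen at every maximum, follows the strands and has to agree at every minimum. -/

namespace Slice

/-- Effect of a slice on a labelled state; `l` is the label of the strands of a maximum. -/
def lact : Slice → ℕ → List (Bool × ℕ) → Option (List (Bool × ℕ))
  | birth i s, l, st =>
    if i ≤ st.length then some (st.take i ++ (s, l) :: (!s, l) :: st.drop i) else none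
  | death i, _, st =>
    match st.drop i with
    | a :: b :: rest => if a.1 = b.1 ∨ a.2 ≠ b.2 then none else some (st.take i ++ rest)
    | _ => none
  | cross i _, _, st =>
    match st.drop i with
    | a :: b :: rest => some (st.take i ++ b :: a :: rest)
    | _ => none

/-- Contribution of a slice to the weight of a diagram: the sign of a crossing, times the value of
`f` at the labels of its strands. -/
def weight (f : ℕ → ℕ → ℤ) : Slice → List (Bool × ℕ) → ℤ
  | cross i e, st =>
    match st.drop i with
    | a :: b :: _ => if crossingPositive a.1 b.1 e then f a.2 b.2 else -f a.2 b.2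
    | _ => 0
  | _, _ => 0

end Slice

/-- Removal of the strands with label `0` from a state. -/
def eraseState (st : List (Bool × ℕ)) : List Bool := (st.filter fun p => p.2 ≠ 0).map Prod.fst

namespace Slice

/-- Removal of the strands with label `0` from a slice. -/
def erase : Slice → ℕ → List (Bool × ℕ) → List Slice
  | birth i s, l, st => if l = 0 then [] else [birth (eraseState (st.take i)).length s]
  | death i, _, st =>
    match st.drop i with
    | a :: _ => if a.2 = 0 then [] else [death (eraseState (st.take i)).length]
    | _ => []
  | cross i e, _, st =>
    match st.drop i with
    | a :: b :: _ => if a.2 = 0 ∨ b.2 = 0 then [] else [cross (eraseState (st.take i)).length e]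
    | _ => []

end Slice

@[simp] theorem eraseState_append (A B : List (Bool × ℕ)) :
    eraseState (A ++ B) = eraseState A ++ eraseState B := by simp [eraseState]

@[simp] theorem eraseState_nil : eraseState [] = [] := rfl

@[simp] theorem eraseState_cons (a : Bool) (l : ℕ) (A : List (Bool × ℕ)) :
    eraseState ((a, l) :: A) = if l = 0 then eraseState A else a :: eraseState A := by
  by_cases h : l = 0 <;> simp [eraseState, h]

namespace Slice

theorem exists_of_lact {x : Slice} {l : ℕ} {st st' : List (Bool × ℕ)}
    (h : x.lact l st = some st') :
    (∃ i s A B, x = birth i s ∧ i = A.length ∧ st = A ++ B ∧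
      st' = A ++ (s, l) :: (!s, l) :: B) ∨
    (∃ i A a m B, x = death i ∧ i = A.length ∧ st = A ++ (a, m) :: (!a, m) :: B ∧ st' = A ++ B) ∨
    (∃ i e A a b B, x = cross i e ∧ i = A.length ∧ st = A ++ a :: b :: B ∧
      st' = A ++ b :: a :: B) := by
  cases x with
  | birth i s =>
    simp only [lact] at h
    split_ifs at h with hi
    simp only [Option.some.injEq] at h
    exact .inl ⟨i, s, st.take i, st.drop i, rfl, (List.length_take_of_le hi).symm, (List.take_append_drop i st).symm, h.symm⟩
  | death i =>
    simp only [lact] at h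
    have hst := (List.take_append_drop i st).symm
    rcases hd : st.drop i with _ | ⟨⟨a, m⟩, _ | ⟨⟨b, m'⟩, r⟩⟩ <;> simp only [hd, reduceCtorEq] at h
    have hi : i ≤ st.length := by
      by_contra hc
      rw [List.drop_of_length_le (by omega)] at hd
      simp at hd
    split_ifs at h with hc
    simp only [Option.some.injEq] at h
    push Not at hc
    obtain ⟨hc1, rfl⟩ := hc
    have hb : b = !a := by cases a <;> cases b <;> first | rfl | exact absurd rfl hc1
    subst hb
    rw [hd] at hst
    exact .inr (.inl ⟨i, st.take i, a, m, r, rfl, (List.length_take_of_le hi).symm, hst, h.symm⟩)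
  | cross i e =>
    simp only [lact] at h
    have hst := (List.take_append_drop i st).symm
    rcases hd : st.drop i with _ | ⟨a, _ | ⟨b, r⟩⟩ <;> simp only [hd, reduceCtorEq] at h
    have hi : i ≤ st.length := by
      by_contra hc
      rw [List.drop_of_length_le (by omega)] at hd
      simp at hd
    simp only [Option.some.injEq] at h
    rw [hd] at hst
    exact .inr (.inr ⟨i, e, st.take i, a, b, r, rfl, (List.length_take_of_le hi).symm, hst, h.symm⟩)

theorem lact_cross (e : Bool) (l : ℕ) (a b : Bool × ℕ) (A B : List (Bool × ℕ)) :
    (cross A.length e).lact l (A ++ a :: b :: B) = some (A ++ b :: a :: B) := by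
  simp [lact]

theorem lact_shift (x : Slice) (l : ℕ) (A st : List (Bool × ℕ)) :
    (x.shift A.length).lact l (A ++ st) = (x.lact l st).map (A ++ ·) := by
  cases x with
  | birth i s =>
    by_cases h : i ≤ st.length
    · simp [shift, lact, h, Nat.add_comm i, List.take_append, List.drop_append,
        List.take_of_length_le]
    · simp [shift, lact, h, Nat.add_comm i]
  | death i =>
    simp only [shift, lact, Nat.add_comm i, List.drop_append, List.take_append,
      Nat.add_sub_cancel_left, List.drop_of_length_le (Nat.le_add_right _ _),
      List.take_of_length_le (Nat.le_add_right A.length i), List.nil_append]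
    rcases st.drop i with _ | ⟨a, _ | ⟨b, r⟩⟩ <;> simp only [Option.map_none]
    split_ifs <;> simp
  | cross i e =>
    simp only [shift, lact, Nat.add_comm i, List.drop_append, List.take_append,
      Nat.add_sub_cancel_left, List.drop_of_length_le (Nat.le_add_right _ _),
      List.take_of_length_le (Nat.le_add_right A.length i), List.nil_append]
    rcases st.drop i with _ | ⟨a, _ | ⟨b, r⟩⟩ <;> simp

theorem weight_shift (f : ℕ → ℕ → ℤ) (x : Slice) (A st : List (Bool × ℕ)) :
    (x.shift A.length).weight f (A ++ st) = x.weight f st := by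
  cases x with
  | cross i e =>
    simp only [shift, weight, Nat.add_comm i, List.drop_append,
      Nat.add_sub_cancel_left, List.drop_of_length_le (Nat.le_add_right _ _), List.nil_append]
  | _ => rfl

theorem erase_shift (x : Slice) (l : ℕ) (A st : List (Bool × ℕ)) :
    (x.shift A.length).erase l (A ++ st) = sh (eraseState A).length (x.erase l st) := by
  cases x with
  | birth i s =>
    by_cases h : l = 0
    · simp [shift, erase, h]
    · simp [shift, erase, h, Nat.add_comm i, List.take_append, List.take_of_length_le,
        Nat.add_comm (eraseState A).length]
  | death i =>
    simp only [shift, erase, Nat.add_comm i, List.drop_append, List.take_append,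
      Nat.add_sub_cancel_left, List.drop_of_length_le (Nat.le_add_right _ _),
      List.take_of_length_le (Nat.le_add_right A.length i), List.nil_append]
    rcases st.drop i with _ | ⟨a, r⟩
    · simp
    · by_cases h : a.2 = 0 <;> simp [h, shift, Nat.add_comm (eraseState A).length]
  | cross i e =>
    simp only [shift, erase, Nat.add_comm i, List.drop_append, List.take_append,
      Nat.add_sub_cancel_left, List.drop_of_length_le (Nat.le_add_right _ _),
      List.take_of_length_le (Nat.le_add_right A.length i), List.nil_append]
    rcases st.drop i with _ | ⟨a, _ | ⟨b, r⟩⟩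
    · simp
    · simp
    · by_cases h : a.2 = 0 ∨ b.2 = 0 <;> simp [h, shift, Nat.add_comm (eraseState A).length]

/-- A slice that fits and begins at the first strand changes only its own strands; removal of
strands makes it empty or keeps it as it is. -/
theorem exists_of_lact_of_pos {x : Slice} {l : ℕ} {st st' : List (Bool × ℕ)} (hx : x.pos = 0)
    (h : x.lact l st = some st') :
    ∃ M M' S, st = M ++ S ∧ st' = M' ++ S ∧ M.length = x.ins ∧ M'.length = x.outs ∧
      (∀ S, x.lact l (M ++ S) = some (M' ++ S)) ∧
      (∃ w : (ℕ → ℕ → ℤ) → ℤ, ∀ S f, x.weight f (M ++ S) = w f) ∧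
      ((∀ S, x.erase l (M ++ S) = []) ∧ (eraseState M).length = (eraseState M').length ∨
        (∀ S, x.erase l (M ++ S) = [x]) ∧ (eraseState M).length = x.ins ∧
          (eraseState M').length = x.outs) := by
  rcases exists_of_lact h with ⟨i, s, A, B, rfl, hi, rfl, rfl⟩ | ⟨i, A, a, m, B, rfl, hi, rfl, rfl⟩ |
    ⟨i, e, A, ⟨a, m⟩, ⟨b, n⟩, B, rfl, hi, rfl, rfl⟩ <;>
  · simp only [pos] at hx
    subst hx
    obtain rfl : A = [] := List.length_eq_zero_iff.1 hi.symm
    first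
    | refine ⟨[], [(s, l), (!s, l)], B, rfl, rfl, rfl, rfl, ?_, ⟨fun _ => 0, ?_⟩, ?_⟩
      · simp [lact]
      · simp [weight]
      · by_cases hl : l = 0 <;> simp [erase, hl, ins, outs]
    | refine ⟨[(a, m), (!a, m)], [], B, rfl, rfl, rfl, rfl, ?_, ⟨fun _ => 0, ?_⟩, ?_⟩
      · simp [lact]
      · simp [weight]
      · by_cases hl : m = 0 <;> simp [erase, hl, ins, outs]
    | refine ⟨[(a, m), (b, n)], [(b, n), (a, m)], B, rfl, rfl, rfl, rfl, ?_,
        ⟨fun f => if crossingPositive a b e then f m n else -f m n, ?_⟩, ?_⟩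
      · simp [lact]
      · simp [weight]
      · by_cases hl : m = 0 <;> by_cases hl' : n = 0 <;> simp [erase, hl, hl', ins, outs]

theorem erase_eq (x : Slice) (l : ℕ) (st : List (Bool × ℕ)) :
    x.erase l st = [] ∨ ∃ y, x.erase l st = [y] := by
  cases x <;> simp only [erase] <;> split <;> first | (split_ifs <;> simp) | simp

theorem act_of_lact {x : Slice} {l : ℕ} {st st' : List (Bool × ℕ)} (h : x.lact l st = some st') :
    x.act (st.map Prod.fst) = some (st'.map Prod.fst) := by
  rcases exists_of_lact h with ⟨i, s, A, B, rfl, rfl, rfl, rfl⟩ |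
    ⟨i, A, a, m, B, rfl, rfl, rfl, rfl⟩ | ⟨i, e, A, a, b, B, rfl, rfl, rfl, rfl⟩
  · simp [act]
  · simp [act]
  · simp [act]

theorem run_erase {x : Slice} {l : ℕ} {st st' : List (Bool × ℕ)} (h : x.lact l st = some st') :
    run (eraseState st) (x.erase l st) = some (eraseState st') := by
  rcases exists_of_lact h with ⟨i, s, A, B, rfl, rfl, rfl, rfl⟩ |
    ⟨i, A, a, m, B, rfl, rfl, rfl, rfl⟩ | ⟨i, e, A, ⟨a, m⟩, ⟨b, n⟩, B, rfl, rfl, rfl, rfl⟩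
  · by_cases hl : l = 0
    · simp [erase, hl]
    · simp [act, erase, hl, run_cons]
  · by_cases hl : m = 0
    · simp [erase, hl]
    · simp [act, erase, hl, run_cons]
  · by_cases hl : m = 0
    · simp [erase, hl]
    · by_cases hl' : n = 0
      · simp [erase, hl, hl']
      · simp [act, erase, hl, hl', run_cons]

end Slice

/-- Words of labelled slices. -/
abbrev LWord := List (Slice × ℕ)

/-- The labelled state below a labelled word. -/
def lrun : List (Bool × ℕ) → LWord → Option (List (Bool × ℕ))
  | st, [] => some st
  | st, p :: w => (p.1.lact p.2 st).bind fun st' => lrun st' w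

/-- The weight of a labelled word. -/
def weight (f : ℕ → ℕ → ℤ) : List (Bool × ℕ) → LWord → ℤ
  | _, [] => 0
  | st, p :: w => p.1.weight f st + ((p.1.lact p.2 st).map fun st' => weight f st' w).getD 0

/-- Removal of the strands with label `0` from a labelled word. -/
def erase : List (Bool × ℕ) → LWord → List Slice
  | _, [] => []
  | st, p :: w => p.1.erase p.2 st ++ ((p.1.lact p.2 st).map fun st' => erase st' w).getD []

theorem lrun_append (u v : LWord) : ∀ st, lrun st (u ++ v) =
    (lrun st u).bind fun st' => lrun st' v := by
  induction u with
  | nil => intro st; rfl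
  | cons p u ih =>
    intro st
    simp only [List.cons_append, lrun, Option.bind_assoc, ih]

theorem lrun_append_of {u v : LWord} {st st' : List (Bool × ℕ)} (h : lrun st u = some st') :
    lrun st (u ++ v) = lrun st' v := by
  rw [lrun_append, h]; rfl

theorem weight_append_of (f : ℕ → ℕ → ℤ) {v : LWord} (u : LWord) : ∀ {st st' : List (Bool × ℕ)},
    lrun st u = some st' → weight f st (u ++ v) = weight f st u + weight f st' v := by
  induction u with
  | nil => intro st st' h; simp_all [lrun, weight]
  | cons p u ih =>
    intro st st' h
    simp only [lrun, Option.bind_eq_some_iff] at h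
    obtain ⟨s, hs, h⟩ := h
    simp [weight, hs, ih h, add_assoc]

theorem erase_append_of {v : LWord} (u : LWord) : ∀ {st st' : List (Bool × ℕ)},
    lrun st u = some st' → erase st (u ++ v) = erase st u ++ erase st' v := by
  induction u with
  | nil => intro st st' h; simp_all [lrun, erase]
  | cons p u ih =>
    intro st st' h
    simp only [lrun, Option.bind_eq_some_iff] at h
    obtain ⟨s, hs, h⟩ := h
    simp [erase, hs, ih h]

theorem run_of_lrun (w : LWord) : ∀ {st st' : List (Bool × ℕ)}, lrun st w = some st' →
    run (st.map Prod.fst) (w.map Prod.fst) = some (st'.map Prod.fst) := by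
  induction w with
  | nil => intro st st' h; simp_all [lrun]
  | cons p w ih =>
    intro st st' h
    simp only [lrun, Option.bind_eq_some_iff] at h
    obtain ⟨s, hs, h⟩ := h
    simp [run_cons, Slice.act_of_lact hs, ih h]

theorem run_erase (w : LWord) : ∀ {st st' : List (Bool × ℕ)}, lrun st w = some st' →
    run (eraseState st) (erase st w) = some (eraseState st') := by
  induction w with
  | nil => intro st st' h; simp_all [lrun, erase]
  | cons p w ih =>
    intro st st' h
    simp only [lrun, Option.bind_eq_some_iff] at h
    obtain ⟨s, hs, h⟩ := h
    simp [erase, hs, run_append_of (Slice.run_erase hs), ih h]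

/-- The labelled word with `k` further strands at its left. -/
def lsh (k : ℕ) (w : LWord) : LWord := w.map fun p => (p.1.shift k, p.2)

theorem map_fst_lsh (k : ℕ) (w : LWord) : (lsh k w).map Prod.fst = sh k (w.map Prod.fst) := by
  simp [lsh, sh, Function.comp_def]

theorem exists_lsh {k : ℕ} {x : List Slice} : ∀ {w : LWord}, w.map Prod.fst = sh k x →
    ∃ w', w = lsh k w' ∧ w'.map Prod.fst = x := by
  induction x with
  | nil => intro w h; exact ⟨[], by simpa [lsh] using h, rfl⟩
  | cons y x ih =>
    intro w h
    rcases w with _ | ⟨⟨z, l⟩, w⟩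
    · simp at h
    · simp only [List.map_cons, sh_cons, List.cons.injEq] at h
      obtain ⟨w', rfl, h'⟩ := ih h.2
      exact ⟨(y, l) :: w', by simp [lsh, h.1], by simp [h']⟩

theorem lrun_lsh (w : LWord) (A : List (Bool × ℕ)) : ∀ st,
    lrun (A ++ st) (lsh A.length w) = (lrun st w).map (A ++ ·) := by
  induction w with
  | nil => intro st; rfl
  | cons p w ih =>
    intro st
    simp only [lsh, List.map_cons, lrun, Slice.lact_shift] at ih ⊢
    rcases p.1.lact p.2 st with _ | st'
    · rfl
    · simpa using ih st'

theorem weight_lsh (f : ℕ → ℕ → ℤ) (w : LWord) (A : List (Bool × ℕ)) : ∀ st,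
    weight f (A ++ st) (lsh A.length w) = weight f st w := by
  induction w with
  | nil => intro st; rfl
  | cons p w ih =>
    intro st
    simp only [lsh, List.map_cons, weight, Slice.lact_shift, Slice.weight_shift] at ih ⊢
    rcases p.1.lact p.2 st with _ | st'
    · rfl
    · simpa using ih st'

theorem erase_lsh (w : LWord) (A : List (Bool × ℕ)) : ∀ st,
    erase (A ++ st) (lsh A.length w) = sh (eraseState A).length (erase st w) := by
  induction w with
  | nil => intro st; rfl
  | cons p w ih =>
    intro st
    simp only [lsh, List.map_cons, erase, Slice.lact_shift, Slice.erase_shift] at ih ⊢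
    rcases p.1.lact p.2 st with _ | st'
    · simp
    · simpa using ih st'

/-! ### Labels, weights and removals along isotopies -/

/-- The local moves of isotopies. -/
def IsotopyMove (x y : List Slice) : Prop :=
  PlanarMove x y ∨ ReidemeisterOneTwo x y ∨ ReidemeisterThree x y

theorem IsotopyMove.shift {x y : List Slice} (k : ℕ) (h : IsotopyMove x y) :
    IsotopyMove (sh k x) (sh k y) := by
  refine h.imp (·.shift k) (Or.imp (·.shift k) fun hh => ?_)
  cases hh with
  | three i a b c habc =>
    have h' := ReidemeisterThree.three (i + k) a b c habc
    rwa [Nat.add_right_comm] at h'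

/-- Labels carry over from `x` to `y`, with equal weights, and removals of strands from `x` and `y`
are related by at most one isotopy move. -/
def Transports (x y : List Slice) : Prop :=
  ∀ (w : LWord) (st st' : List (Bool × ℕ)), w.map Prod.fst = x → lrun st w = some st' →
    (run (st.map Prod.fst) y).isSome →
    ∃ w' : LWord, w'.map Prod.fst = y ∧ lrun st w' = some st' ∧
      (∀ f : ℕ → ℕ → ℤ, (∀ a b, f a b = f b a) → (∀ a, f a a = 0) →
        weight f st w = weight f st w') ∧
      (erase st w = erase st w' ∨ IsotopyMove (erase st w) (erase st w') ∨
        IsotopyMove (erase st w') (erase st w))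

theorem le_length_of_run_sh {k : ℕ} {x : List Slice} {st : List Bool} (hx : x ≠ [])
    (h : (run st (sh k x)).isSome) : k ≤ st.length := by
  rcases x with _ | ⟨a, x⟩
  · exact absurd rfl hx
  · rw [sh_cons, run_cons] at h
    rcases ha : (a.shift k).act st with _ | st'
    · simp [ha] at h
    · have := (Slice.length_of_act _ ha).1
      rw [Slice.pos_shift] at this
      omega

theorem Transports.shift {x y : List Slice} (k : ℕ) (hxy : x ≠ [] ∨ y ≠ [])
    (h : Transports x y) : Transports (sh k x) (sh k y) := by
  intro w st st' hw hr hy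
  have hx := run_of_lrun w hr
  rw [hw] at hx
  -- A nonempty shifted word that fits requires at least `k` strands. If both words were empty, the
  -- state could be shorter than `k` and could not be cut into `A ++ B`.
  have hk : k ≤ st.length := by
    have : k ≤ (st.map Prod.fst).length := by
      rcases hxy with h | h
      · exact le_length_of_run_sh h (by rw [hx]; rfl)
      · exact le_length_of_run_sh h hy
    simpa using this
  obtain ⟨A, B, rfl, rfl⟩ : ∃ A B, st = A ++ B ∧ A.length = k :=
    ⟨st.take k, st.drop k, by simp, by simp [hk]⟩
  obtain ⟨w0, rfl, hw0⟩ := exists_lsh hw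
  rw [lrun_lsh, Option.map_eq_some_iff] at hr
  obtain ⟨s, hs, rfl⟩ := hr
  have hy' : (run (B.map Prod.fst) y).isSome := by
    have h := run_sh y (A.map Prod.fst) (B.map Prod.fst)
    rw [List.length_map, ← List.map_append] at h
    rw [h] at hy
    simpa using hy
  obtain ⟨w', h1, h2, h3, h4⟩ := h w0 B s hw0 hs hy'
  refine ⟨lsh A.length w', by rw [map_fst_lsh, h1], by rw [lrun_lsh, h2]; rfl, ?_, ?_⟩
  · intro f hf hf'
    rw [weight_lsh, weight_lsh, h3 f hf hf']
  · rw [erase_lsh, erase_lsh]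
    exact h4.imp (fun h => by rw [h]) (Or.imp (·.shift _) (·.shift _))

theorem map_fst_eq_pair {w : LWord} {a b : Slice} (h : w.map Prod.fst = [a, b]) :
    ∃ l m, w = [(a, l), (b, m)] := by
  rcases w with _ | ⟨⟨x, l⟩, _ | ⟨⟨y, m⟩, _ | _⟩⟩ <;> simp at h
  exact ⟨l, m, by rw [h.1, h.2]⟩

theorem map_fst_eq_single {w : LWord} {a : Slice} (h : w.map Prod.fst = [a]) :
    ∃ l, w = [(a, l)] := by
  rcases w with _ | ⟨⟨x, l⟩, _ | _⟩ <;> simp at h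
  exact ⟨l, by rw [h]⟩

theorem map_fst_eq_triple {w : LWord} {a b c : Slice} (h : w.map Prod.fst = [a, b, c]) :
    ∃ l m n, w = [(a, l), (b, m), (c, n)] := by
  rcases w with _ | ⟨⟨x, l⟩, _ | ⟨⟨y, m⟩, _ | ⟨⟨z, n⟩, _ | _⟩⟩⟩ <;> simp at h
  exact ⟨l, m, n, by rw [h.1, h.2.1, h.2.2]⟩

/-- With `a` at position `0`, the state splits into the strands of `a` and those of `b`. Under
erasure `a` either vanishes, and then equally many of its strands survive above and below it, so `b`
gets the same position in both words; or `a` remains entire, and the erased words are again related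
by an exchange unless `b` vanishes. -/
theorem transports_exchange (a b : Slice) (d : ℕ) (ha : a.pos = 0) :
    Transports [a, (b.moveTo d).shift a.outs] [(b.moveTo d).shift a.ins, a] ∧
    Transports [(b.moveTo d).shift a.ins, a] [a, (b.moveTo d).shift a.outs] := by
  generalize b.moveTo d = b
  have key : ∀ (l m : ℕ) (M M' S S' : List (Bool × ℕ)), M.length = a.ins → M'.length = a.outs →
      (∀ S, a.lact l (M ++ S) = some (M' ++ S)) →
      (∃ w : (ℕ → ℕ → ℤ) → ℤ, ∀ S f, a.weight f (M ++ S) = w f) →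
      ((∀ S, a.erase l (M ++ S) = []) ∧ (eraseState M).length = (eraseState M').length ∨
        (∀ S, a.erase l (M ++ S) = [a]) ∧ (eraseState M).length = a.ins ∧
          (eraseState M').length = a.outs) →
      b.lact m S = some S' →
      lrun (M ++ S) [(a, l), (b.shift a.outs, m)] = some (M' ++ S') ∧
      lrun (M ++ S) [(b.shift a.ins, m), (a, l)] = some (M' ++ S') ∧
      (∀ f, weight f (M ++ S) [(a, l), (b.shift a.outs, m)] =
        weight f (M ++ S) [(b.shift a.ins, m), (a, l)]) ∧
      (erase (M ++ S) [(a, l), (b.shift a.outs, m)] =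
        erase (M ++ S) [(b.shift a.ins, m), (a, l)] ∨
      IsotopyMove (erase (M ++ S) [(a, l), (b.shift a.outs, m)])
        (erase (M ++ S) [(b.shift a.ins, m), (a, l)])) := by
    intro l m M M' S S' hM hM' h1 h2 h3 hb
    obtain ⟨w, hw⟩ := h2
    rw [← hM, ← hM']
    refine ⟨by simp [lrun, h1, Slice.lact_shift, hb], by simp [lrun, h1, Slice.lact_shift, hb],
      ?_, ?_⟩
    · intro f
      simp [weight, h1, Slice.lact_shift, hb, Slice.weight_shift, hw, add_comm]
    · simp only [erase, h1, Slice.lact_shift, hb, Slice.erase_shift, Option.map_some,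
        Option.getD_some, List.append_nil]
      rcases h3 with ⟨h3, h4⟩ | ⟨h3, h4, h5⟩
      · left
        rw [h3, h3, h4]
        simp
      · rw [h3, h3, h4, h5]
        rcases b.erase_eq m S with hb' | ⟨y, hb'⟩
        · left
          simp [hb']
        · right
          left
          have h := PlanarMove.exchange a y y.pos
          rw [ha, Nat.zero_add, Nat.zero_add, Nat.add_comm _ y.pos, Nat.add_comm _ y.pos,
            ← Slice.shift_eq_moveTo, ← Slice.shift_eq_moveTo] at h
          simpa [hb'] using h
  constructor
  · intro w st st' hw hr _
    obtain ⟨l, m, rfl⟩ := map_fst_eq_pair hw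
    simp only [lrun, Option.bind_eq_some_iff] at hr
    obtain ⟨s1, hs1, s2, hs2, h⟩ := hr
    obtain ⟨M, M', S, rfl, rfl, h1, h2, h3, h4, h5⟩ := Slice.exists_of_lact_of_pos ha hs1
    rw [← h2, Slice.lact_shift, Option.map_eq_some_iff] at hs2
    obtain ⟨S', hS', rfl⟩ := hs2
    simp only [Option.some.injEq] at h
    subst h
    obtain ⟨k1, k2, k3, k4⟩ := key l m M M' S S' h1 h2 h3 h4 h5 hS'
    exact ⟨[(b.shift a.ins, m), (a, l)], rfl, k2, fun f _ _ => k3 f, k4.imp id .inl⟩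
  · intro w st st' hw hr _
    obtain ⟨m, l, rfl⟩ := map_fst_eq_pair hw
    simp only [lrun, Option.bind_eq_some_iff] at hr
    obtain ⟨s1, hs1, s2, hs2, h⟩ := hr
    have hlen : a.ins ≤ st.length := by
      have h := (Slice.length_of_act _ (Slice.act_of_lact hs1)).1
      rw [Slice.pos_shift, List.length_map] at h
      omega
    obtain ⟨M, S, rfl, hM⟩ : ∃ A B, st = A ++ B ∧ A.length = a.ins :=
      ⟨st.take a.ins, st.drop a.ins, by simp, by simp [hlen]⟩
    rw [← hM, Slice.lact_shift, Option.map_eq_some_iff] at hs1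
    obtain ⟨S', hS', rfl⟩ := hs1
    obtain ⟨N, M', T, e1, rfl, h1, h2, h3, h4, h5⟩ := Slice.exists_of_lact_of_pos ha hs2
    obtain ⟨rfl, rfl⟩ := List.append_inj e1 (by rw [hM, h1])
    simp only [Option.some.injEq] at h
    subst h
    obtain ⟨k1, k2, k3, k4⟩ := key l m M M' S S' h1 h2 h3 h4 h5 hS'
    exact ⟨[(a, l), (b.shift a.outs, m)], rfl, k1, fun f _ _ => (k3 f).symm,
      k4.imp Eq.symm .inr⟩

/-- Removing the zigzag keeps the label because the minimum forces the label of the maximum to be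
that of the strand. Conversely a new maximum receives the label of the strand it is cut from. The
labels attached to minima and crossings are never read, so `0` is used for them. -/
theorem transports_zigzagLeft (s : Bool) :
    Transports [.birth 0 s, .death 1] [] ∧ Transports [] [.birth 0 s, .death 1] := by
  constructor
  · intro w st st' hw hr hy
    obtain ⟨l, m, rfl⟩ := map_fst_eq_pair hw
    rcases st with _ | ⟨⟨a, la⟩, st⟩
    · simp [lrun, Slice.lact] at hr
    · simp [lrun, Slice.lact] at hr
      obtain ⟨⟨h1, rfl⟩, rfl⟩ := hr
      have ha : a = s := by cases a <;> cases s <;> simp_all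
      subst ha
      refine ⟨[], rfl, rfl, ?_, ?_⟩
      · intro f _ _
        simp [weight, Slice.weight, Slice.lact]
      · by_cases hl : l = 0
        · left; simp [erase, Slice.erase, Slice.lact, hl]
        · right; left; left
          simpa [erase, Slice.erase, Slice.lact, hl] using PlanarMove.zigzagLeft 0 a
  · intro w st st' hw hr hy
    obtain rfl : w = [] := by simpa using hw
    rcases st with _ | ⟨⟨a, l⟩, st⟩
    · simp [run_cons, Slice.act] at hy
    · simp [run_cons, Slice.act] at hy
      have ha : a = s := by cases a <;> cases s <;> simp_all
      subst ha
      refine ⟨[(.birth 0 a, l), (.death 1, 0)], rfl, by simpa [lrun, Slice.lact] using hr, ?_, ?_⟩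
      · intro f _ _
        simp [weight, Slice.weight, Slice.lact]
      · by_cases hl : l = 0
        · left; simp [erase, Slice.erase, Slice.lact, hl]
        · right; right; left
          simpa [erase, Slice.erase, Slice.lact, hl] using PlanarMove.zigzagLeft 0 a

theorem transports_zigzagRight (s : Bool) :
    Transports [.birth 1 s, .death 0] [] ∧ Transports [] [.birth 1 s, .death 0] := by
  constructor
  · intro w st st' hw hr hy
    obtain ⟨l, m, rfl⟩ := map_fst_eq_pair hw
    rcases st with _ | ⟨⟨a, la⟩, st⟩
    · simp [lrun, Slice.lact] at hr
    · simp [lrun, Slice.lact] at hr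
      obtain ⟨⟨h1, rfl⟩, rfl⟩ := hr
      obtain rfl : a = !s := by cases a <;> cases s <;> simp_all
      refine ⟨[], rfl, rfl, ?_, ?_⟩
      · intro f _ _
        simp [weight, Slice.weight, Slice.lact]
      · by_cases hl : la = 0
        · left; simp [erase, Slice.erase, Slice.lact, hl]
        · right; left; left
          simpa [erase, Slice.erase, Slice.lact, hl] using PlanarMove.zigzagRight 0 s
  · intro w st st' hw hr hy
    obtain rfl : w = [] := by simpa using hw
    rcases st with _ | ⟨⟨a, l⟩, st⟩
    · simp [run_cons, Slice.act] at hy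
    · simp [run_cons, Slice.act] at hy
      obtain rfl : a = !s := by cases a <;> cases s <;> simp_all
      refine ⟨[(.birth 1 s, l), (.death 0, 0)], rfl, by simpa [lrun, Slice.lact] using hr, ?_, ?_⟩
      · intro f _ _
        simp [weight, Slice.weight, Slice.lact]
      · by_cases hl : l = 0
        · left; simp [erase, Slice.erase, Slice.lact, hl]
        · right; right; left
          simpa [erase, Slice.erase, Slice.lact, hl] using PlanarMove.zigzagRight 0 s

/-- The strand meets the other leg of the maximum, which has the opposite orientation, and the
crossing type is reversed too, so the sign is unchanged. The labels meet in the other order, whence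
the symmetry of `f`. -/
theorem transports_slideMax (s e : Bool) :
    Transports [.birth 0 s, .cross 1 e] [.birth 1 s, .cross 0 (!e)] ∧
    Transports [.birth 1 s, .cross 0 (!e)] [.birth 0 s, .cross 1 e] := by
  have hw : ∀ (f : ℕ → ℕ → ℤ) (l m : ℕ) (a la) (st : List (Bool × ℕ)), (∀ a b, f a b = f b a) →
      weight f ((a, la) :: st) [(.birth 0 s, l), (.cross 1 e, m)] =
        weight f ((a, la) :: st) [(.birth 1 s, l), (.cross 0 (!e), m)] := by
    intro f l m a la st hf
    rw [show weight f ((a, la) :: st) [(.birth 0 s, l), (.cross 1 e, m)] =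
      if crossingPositive (!s) a e then f l la else -f l la by
        simp [weight, Slice.weight, Slice.lact]]
    rw [show weight f ((a, la) :: st) [(.birth 1 s, l), (.cross 0 (!e), m)] =
      if crossingPositive a s (!e) then f la l else -f la l by
        simp [weight, Slice.weight, Slice.lact]]
    rw [hf l la]
    cases a <;> cases s <;> cases e <;> rfl
  have he : ∀ (l m : ℕ) (a la) (st : List (Bool × ℕ)),
      erase ((a, la) :: st) [(.birth 0 s, l), (.cross 1 e, m)] =
        erase ((a, la) :: st) [(.birth 1 s, l), (.cross 0 (!e), m)] ∨
      IsotopyMove (erase ((a, la) :: st) [(.birth 0 s, l), (.cross 1 e, m)])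
        (erase ((a, la) :: st) [(.birth 1 s, l), (.cross 0 (!e), m)]) := by
    intro l m a la st
    by_cases hl : l = 0
    · left; simp [erase, Slice.erase, Slice.lact, hl]
    · by_cases hl' : la = 0
      · left; simp [erase, Slice.erase, Slice.lact, hl, hl']
      · right; left
        simpa [erase, Slice.erase, Slice.lact, hl, hl'] using PlanarMove.slideMax 0 s e
  constructor
  · intro w st st' h hr hy
    obtain ⟨l, m, rfl⟩ := map_fst_eq_pair h
    rcases st with _ | ⟨⟨a, la⟩, st⟩
    · simp [lrun, Slice.lact] at hr
    · refine ⟨[(.birth 1 s, l), (.cross 0 (!e), m)], rfl, ?_, fun f hf _ => hw f l m a la st hf,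
        (he l m a la st).imp id .inl⟩
      simpa [lrun, Slice.lact] using hr
  · intro w st st' h hr hy
    obtain ⟨l, m, rfl⟩ := map_fst_eq_pair h
    rcases st with _ | ⟨⟨a, la⟩, st⟩
    · simp [lrun, Slice.lact] at hr
    · refine ⟨[(.birth 0 s, l), (.cross 1 e, m)], rfl, ?_,
        fun f hf _ => (hw f l m a la st hf).symm, (he l m a la st).imp Eq.symm .inr⟩
      simpa [lrun, Slice.lact] using hr

theorem transports_slideMin (e : Bool) :
    Transports [.cross 1 e, .death 0] [.cross 0 (!e), .death 1] ∧
    Transports [.cross 0 (!e), .death 1] [.cross 1 e, .death 0] := by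
  have hw : ∀ (f : ℕ → ℕ → ℤ) (l m : ℕ) (a b c la lb) (st : List (Bool × ℕ)),
      (∀ a b, f a b = f b a) → a ≠ c →
      weight f ((a, la) :: (b, lb) :: (c, la) :: st) [(.cross 1 e, l), (.death 0, m)] =
        weight f ((a, la) :: (b, lb) :: (c, la) :: st) [(.cross 0 (!e), l), (.death 1, m)] := by
    intro f l m a b c la lb st hf hac
    rw [show weight f ((a, la) :: (b, lb) :: (c, la) :: st) [(.cross 1 e, l), (.death 0, m)] =
      if crossingPositive b c e then f lb la else -f lb la by
        simp [weight, Slice.weight, Slice.lact, hac]]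
    rw [show weight f ((a, la) :: (b, lb) :: (c, la) :: st) [(.cross 0 (!e), l), (.death 1, m)] =
      if crossingPositive a b (!e) then f la lb else -f la lb by
        simp [weight, Slice.weight, Slice.lact, hac]]
    rw [hf lb la]
    cases a <;> cases b <;> cases c <;> cases e <;> first | exact absurd rfl hac | rfl
  have he : ∀ (l m : ℕ) (a b c la lb) (st : List (Bool × ℕ)), a ≠ c →
      erase ((a, la) :: (b, lb) :: (c, la) :: st) [(.cross 1 e, l), (.death 0, m)] =
        erase ((a, la) :: (b, lb) :: (c, la) :: st) [(.cross 0 (!e), l), (.death 1, m)] ∨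
      IsotopyMove (erase ((a, la) :: (b, lb) :: (c, la) :: st) [(.cross 1 e, l), (.death 0, m)])
        (erase ((a, la) :: (b, lb) :: (c, la) :: st) [(.cross 0 (!e), l), (.death 1, m)]) := by
    intro l m a b c la lb st hac
    by_cases hl : la = 0
    · left; simp [erase, Slice.erase, Slice.lact, hl, hac]
    · by_cases hl' : lb = 0
      · left; simp [erase, Slice.erase, Slice.lact, hl, hl', hac]
      · right; left
        simpa [erase, Slice.erase, Slice.lact, hl, hl', hac] using PlanarMove.slideMin 0 e
  constructor
  · intro w st st' h hr hy
    obtain ⟨l, m, rfl⟩ := map_fst_eq_pair h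
    rcases st with _ | ⟨⟨a, la⟩, _ | ⟨⟨b, lb⟩, _ | ⟨⟨c, lc⟩, st⟩⟩⟩
    · simp [lrun, Slice.lact] at hr
    · simp [lrun, Slice.lact] at hr
    · simp [lrun, Slice.lact] at hr
    · simp [lrun, Slice.lact] at hr
      obtain ⟨⟨hac, rfl⟩, rfl⟩ := hr
      refine ⟨[(.cross 0 (!e), l), (.death 1, m)], rfl, by simp [lrun, Slice.lact, hac],
        fun f hf _ => hw f l m a b c la lb st hf hac, (he l m a b c la lb st hac).imp id .inl⟩
  · intro w st st' h hr hy
    obtain ⟨l, m, rfl⟩ := map_fst_eq_pair h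
    rcases st with _ | ⟨⟨a, la⟩, _ | ⟨⟨b, lb⟩, _ | ⟨⟨c, lc⟩, st⟩⟩⟩
    · simp [lrun, Slice.lact] at hr
    · simp [lrun, Slice.lact] at hr
    · simp [lrun, Slice.lact] at hr
    · simp [lrun, Slice.lact] at hr
      obtain ⟨⟨hac, rfl⟩, rfl⟩ := hr
      refine ⟨[(.cross 1 e, l), (.death 0, m)], rfl, by simp [lrun, Slice.lact, hac],
        fun f hf _ => (hw f l m a b c la lb st hf hac).symm,
        (he l m a b c la lb st hac).imp Eq.symm .inr⟩

/-- The crossing of a kink joins a label to itself and does not count, since `f` vanishes on the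
diagonal. -/
theorem transports_oneMax (s e : Bool) :
    Transports [.birth 0 s, .cross 0 e] [.birth 0 (!s)] ∧
    Transports [.birth 0 (!s)] [.birth 0 s, .cross 0 e] := by
  have hw : ∀ (f : ℕ → ℕ → ℤ) (l m : ℕ) (st : List (Bool × ℕ)), (∀ a, f a a = 0) →
      weight f st [(.birth 0 s, l), (.cross 0 e, m)] = weight f st [(.birth 0 (!s), l)] := by
    intro f l m st hf
    simp [weight, Slice.weight, Slice.lact, hf]
  have he : ∀ (l m : ℕ) (st : List (Bool × ℕ)),
      erase st [(.birth 0 s, l), (.cross 0 e, m)] = erase st [(.birth 0 (!s), l)] ∨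
      IsotopyMove (erase st [(.birth 0 s, l), (.cross 0 e, m)])
        (erase st [(.birth 0 (!s), l)]) := by
    intro l m st
    by_cases hl : l = 0
    · left; simp [erase, Slice.erase, Slice.lact, hl]
    · right; right; left
      simpa [erase, Slice.erase, Slice.lact, hl] using ReidemeisterOneTwo.oneMax 0 s e
  constructor
  · intro w st st' h hr hy
    obtain ⟨l, m, rfl⟩ := map_fst_eq_pair h
    refine ⟨[(.birth 0 (!s), l)], rfl, ?_, fun f _ hf => hw f l m st hf,
      (he l m st).imp id .inl⟩
    simpa [lrun, Slice.lact] using hr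
  · intro w st st' h hr hy
    obtain ⟨l, rfl⟩ := map_fst_eq_single h
    refine ⟨[(.birth 0 s, l), (.cross 0 e, 0)], rfl, ?_, fun f _ hf => (hw f l 0 st hf).symm,
      (he l 0 st).imp Eq.symm .inr⟩
    simpa [lrun, Slice.lact] using hr

theorem transports_oneMin (e : Bool) :
    Transports [.cross 0 e, .death 0] [.death 0] ∧
    Transports [.death 0] [.cross 0 e, .death 0] := by
  have hw : ∀ (f : ℕ → ℕ → ℤ) (l m n : ℕ) (a b la) (st : List (Bool × ℕ)), (∀ a, f a a = 0) →
      weight f ((a, la) :: (b, la) :: st) [(.cross 0 e, l), (.death 0, m)] =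
        weight f ((a, la) :: (b, la) :: st) [(.death 0, n)] := by
    intro f l m n a b la st hf
    by_cases hab : b = a
    · simp [weight, Slice.weight, Slice.lact, hf, hab]
    · simp [weight, Slice.weight, Slice.lact, hf, hab, Ne.symm hab]
  have he : ∀ (l m n : ℕ) (a b la) (st : List (Bool × ℕ)), a ≠ b →
      erase ((a, la) :: (b, la) :: st) [(.cross 0 e, l), (.death 0, m)] =
        erase ((a, la) :: (b, la) :: st) [(.death 0, n)] ∨
      IsotopyMove (erase ((a, la) :: (b, la) :: st) [(.cross 0 e, l), (.death 0, m)])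
        (erase ((a, la) :: (b, la) :: st) [(.death 0, n)]) := by
    intro l m n a b la st hab
    by_cases hl : la = 0
    · left; simp [erase, Slice.erase, Slice.lact, hl, hab, hab.symm]
    · right; right; left
      simpa [erase, Slice.erase, Slice.lact, hl, hab, hab.symm] using
        ReidemeisterOneTwo.oneMin 0 e
  constructor
  · intro w st st' h hr hy
    obtain ⟨l, m, rfl⟩ := map_fst_eq_pair h
    rcases st with _ | ⟨⟨a, la⟩, _ | ⟨⟨b, lb⟩, st⟩⟩
    · simp [lrun, Slice.lact] at hr
    · simp [lrun, Slice.lact] at hr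
    · simp [lrun, Slice.lact] at hr
      obtain ⟨⟨hab, rfl⟩, rfl⟩ := hr
      exact ⟨[(.death 0, 0)], rfl, by simp [lrun, Slice.lact, Ne.symm hab],
        fun f _ hf => hw f l m 0 a b _ st hf, (he l m 0 a b _ st (Ne.symm hab)).imp id .inl⟩
  · intro w st st' h hr hy
    obtain ⟨l, rfl⟩ := map_fst_eq_single h
    rcases st with _ | ⟨⟨a, la⟩, _ | ⟨⟨b, lb⟩, st⟩⟩
    · simp [lrun, Slice.lact] at hr
    · simp [lrun, Slice.lact] at hr
    · simp [lrun, Slice.lact] at hr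
      obtain ⟨⟨hab, rfl⟩, rfl⟩ := hr
      exact ⟨[(.cross 0 e, 0), (.death 0, 0)], rfl, by simp [lrun, Slice.lact, Ne.symm hab],
        fun f _ hf => (hw f 0 0 l a b _ st hf).symm, (he 0 0 l a b _ st hab).imp Eq.symm .inr⟩

/-- The two crossings of a bigon have the same pair of labels and opposite signs. -/
theorem transports_two (e : Bool) :
    Transports [.cross 0 e, .cross 0 (!e)] [] ∧ Transports [] [.cross 0 e, .cross 0 (!e)] := by
  have hw : ∀ (f : ℕ → ℕ → ℤ) (l m : ℕ) (a b la lb) (st : List (Bool × ℕ)),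
      (∀ a b, f a b = f b a) →
      weight f ((a, la) :: (b, lb) :: st) [(.cross 0 e, l), (.cross 0 (!e), m)] = 0 := by
    intro f l m a b la lb st hf
    rw [show weight f ((a, la) :: (b, lb) :: st) [(.cross 0 e, l), (.cross 0 (!e), m)] =
      (if crossingPositive a b e then f la lb else -f la lb) +
        (if crossingPositive b a (!e) then f lb la else -f lb la) by
        simp [weight, Slice.weight, Slice.lact]]
    rw [hf lb la]
    cases a <;> cases b <;> cases e <;> simp [crossingPositive]
  have he : ∀ (l m : ℕ) (a b la lb) (st : List (Bool × ℕ)),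
      erase ((a, la) :: (b, lb) :: st) [(.cross 0 e, l), (.cross 0 (!e), m)] = [] ∨
      IsotopyMove (erase ((a, la) :: (b, lb) :: st) [(.cross 0 e, l), (.cross 0 (!e), m)]) [] := by
    intro l m a b la lb st
    by_cases hl : la = 0
    · left; simp [erase, Slice.erase, Slice.lact, hl]
    · by_cases hl' : lb = 0
      · left; simp [erase, Slice.erase, Slice.lact, hl, hl']
      · right; right; left
        simpa [erase, Slice.erase, Slice.lact, hl, hl'] using ReidemeisterOneTwo.two 0 e
  constructor
  · intro w st st' h hr hy
    obtain ⟨l, m, rfl⟩ := map_fst_eq_pair h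
    rcases st with _ | ⟨⟨a, la⟩, _ | ⟨⟨b, lb⟩, st⟩⟩
    · simp [lrun, Slice.lact] at hr
    · simp [lrun, Slice.lact] at hr
    · refine ⟨[], rfl, by simpa [lrun, Slice.lact] using hr, fun f hf _ => hw f l m a b la lb st hf,
        (he l m a b la lb st).imp id .inl⟩
  · intro w st st' h hr hy
    obtain rfl : w = [] := by simpa using h
    rcases st with _ | ⟨⟨a, la⟩, _ | ⟨⟨b, lb⟩, st⟩⟩
    · simp [run_cons, Slice.act] at hy
    · simp [run_cons, Slice.act] at hy
    · refine ⟨[(.cross 0 e, 0), (.cross 0 (!e), 0)], rfl, by simpa [lrun, Slice.lact] using hr,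
        fun f hf _ => (hw f 0 0 a b la lb st hf).symm, (he 0 0 a b la lb st).imp Eq.symm .inr⟩

/-- Each pair of the three strands crosses once on either side, in the same left-right order and
with the same type. The two sums differ only in the order of their terms. -/
theorem weight_three (x y z : Bool) (f : ℕ → ℕ → ℤ) (l m n l' m' n' : ℕ) (a b c : Bool × ℕ)
    (st : List (Bool × ℕ)) :
    weight f (a :: b :: c :: st) [(.cross 0 x, l), (.cross 1 y, m), (.cross 0 z, n)] =
      weight f (a :: b :: c :: st) [(.cross 1 z, l'), (.cross 0 y, m'), (.cross 1 x, n')] := by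
  simp only [weight, Slice.weight, Slice.lact, List.drop_zero, List.take_zero,
    List.drop_succ_cons, List.take_succ_cons, List.nil_append, List.cons_append,
    Option.map_some, Option.getD_some]
  ring

/-- If one strand is erased, at most one crossing is left and it is the same on both sides;
otherwise the whole move survives. -/
theorem erase_three (x y z : Bool) (h : x = z → y = x) (l m n l' m' n' : ℕ) (a b c : Bool × ℕ)
    (st : List (Bool × ℕ)) :
    erase (a :: b :: c :: st) [(.cross 0 x, l), (.cross 1 y, m), (.cross 0 z, n)] =
      erase (a :: b :: c :: st) [(.cross 1 z, l'), (.cross 0 y, m'), (.cross 1 x, n')] ∨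
    IsotopyMove
      (erase (a :: b :: c :: st) [(.cross 0 x, l), (.cross 1 y, m), (.cross 0 z, n)])
      (erase (a :: b :: c :: st) [(.cross 1 z, l'), (.cross 0 y, m'), (.cross 1 x, n')]) := by
  obtain ⟨a, la⟩ := a
  obtain ⟨b, lb⟩ := b
  obtain ⟨c, lc⟩ := c
  by_cases h1 : la = 0
  · left
    by_cases h2 : lb = 0 <;> by_cases h3 : lc = 0 <;>
      simp [erase, Slice.erase, Slice.lact, h1, h2, h3]
  · by_cases h2 : lb = 0
    · left
      by_cases h3 : lc = 0 <;> simp [erase, Slice.erase, Slice.lact, h1, h2, h3]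
    · by_cases h3 : lc = 0
      · left; simp [erase, Slice.erase, Slice.lact, h1, h2, h3]
      · right; right; right
        simpa [erase, Slice.erase, Slice.lact, h1, h2, h3] using
          ReidemeisterThree.three 0 x y z h

theorem transports_three (x y z : Bool) (h : x = z → y = x) :
    Transports [.cross 0 x, .cross 1 y, .cross 0 z] [.cross 1 z, .cross 0 y, .cross 1 x] ∧
    Transports [.cross 1 z, .cross 0 y, .cross 1 x] [.cross 0 x, .cross 1 y, .cross 0 z] := by
  constructor
  · intro w st st' hw hr hy
    obtain ⟨l, m, n, rfl⟩ := map_fst_eq_triple hw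
    rcases st with _ | ⟨a, _ | ⟨b, _ | ⟨c, st⟩⟩⟩
    · simp [lrun, Slice.lact] at hr
    · simp [lrun, Slice.lact] at hr
    · simp [lrun, Slice.lact] at hr
    · exact ⟨[(.cross 1 z, 0), (.cross 0 y, 0), (.cross 1 x, 0)], rfl, hr,
        fun f _ _ => weight_three x y z f l m n 0 0 0 a b c st,
        (erase_three x y z h l m n 0 0 0 a b c st).imp id .inl⟩
  · intro w st st' hw hr hy
    obtain ⟨l, m, n, rfl⟩ := map_fst_eq_triple hw
    rcases st with _ | ⟨a, _ | ⟨b, _ | ⟨c, st⟩⟩⟩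
    · simp [lrun, Slice.lact] at hr
    · simp [lrun, Slice.lact] at hr
    · simp [lrun, Slice.lact] at hr
    · exact ⟨[(.cross 0 x, 0), (.cross 1 y, 0), (.cross 0 z, 0)], rfl, hr,
        fun f _ _ => (weight_three x y z f 0 0 0 l m n a b c st).symm,
        (erase_three x y z h 0 0 0 l m n a b c st).imp Eq.symm .inr⟩

theorem Transports.shift_both {x y : List Slice} (k : ℕ) (hxy : x ≠ [] ∨ y ≠ [])
    (h : Transports x y ∧ Transports y x) :
    Transports (sh k x) (sh k y) ∧ Transports (sh k y) (sh k x) :=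
  ⟨h.1.shift k hxy, h.2.shift k hxy.symm⟩

theorem IsotopyMove.transports {x y : List Slice} (h : IsotopyMove x y) :
    Transports x y ∧ Transports y x := by
  rcases h with h | h | h
  · cases h with
    | exchange a b d =>
      have h := Transports.shift_both a.pos (by simp) (transports_exchange (a.moveTo 0) b d (Slice.pos_moveTo _ _))
      have h1 : (a.moveTo 0).shift a.pos = a := by
        rw [Slice.shift_moveTo, Nat.zero_add, Slice.moveTo_pos]
      have h2 : (a.moveTo 0).ins = a.ins := by cases a <;> rfl
      have h3 : (a.moveTo 0).outs = a.outs := by cases a <;> rfl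
      simp only [sh_cons, sh_nil, h1, h2, h3, Slice.shift_moveTo] at h
      rwa [show a.pos + a.outs + d = d + a.outs + a.pos by omega,
        show a.pos + a.ins + d = d + a.ins + a.pos by omega]
    | zigzagLeft i s =>
      simpa [Slice.shift, Nat.add_comm] using
        Transports.shift_both i (by simp) (transports_zigzagLeft s)
    | zigzagRight i s =>
      simpa [Slice.shift, Nat.add_comm] using
        Transports.shift_both i (by simp) (transports_zigzagRight s)
    | slideMax i s e =>
      simpa [Slice.shift, Nat.add_comm] using
        Transports.shift_both i (by simp) (transports_slideMax s e)
    | slideMin i e =>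
      simpa [Slice.shift, Nat.add_comm] using
        Transports.shift_both i (by simp) (transports_slideMin e)
  · cases h with
    | oneMax i s e =>
      simpa [Slice.shift] using Transports.shift_both i (by simp) (transports_oneMax s e)
    | oneMin i e =>
      simpa [Slice.shift] using Transports.shift_both i (by simp) (transports_oneMin e)
    | two i e =>
      simpa [Slice.shift] using Transports.shift_both i (by simp) (transports_two e)
  · cases h with
    | three i x y z h =>
      simpa [Slice.shift, Nat.add_comm] using
        Transports.shift_both i (by simp) (transports_three x y z h)

/-- `w` is a labelling of the diagram `D`. -/
def Labels (w : LWord) (D : List Slice) : Prop := w.map Prod.fst = D ∧ lrun [] w = some []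

theorem Labels.isDiagram_erase {w : LWord} {D : List Slice} (h : Labels w D) :
    IsDiagram (erase [] w) := run_erase w h.2

theorem exists_of_map_fst_append {w : LWord} {u x v : List Slice}
    (h : w.map Prod.fst = u ++ x ++ v) : ∃ wu wx wv : LWord, w = wu ++ (wx ++ wv) ∧
      wu.map Prod.fst = u ∧ wx.map Prod.fst = x ∧ wv.map Prod.fst = v := by
  rw [List.append_assoc, List.map_eq_append_iff] at h
  obtain ⟨wu, w', rfl, hu, h⟩ := h
  rw [List.map_eq_append_iff] at h
  obtain ⟨wx, wv, rfl, hx, hv⟩ := h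
  exact ⟨wu, wx, wv, rfl, hu, hx, hv⟩

/-- The weight depends on an isotopy invariant function of pairs of components. -/
def LabelFunction (f : ℕ → ℕ → ℤ) : Prop := (∀ a b, f a b = f b a) ∧ ∀ a, f a a = 0

theorem Labels.transport {w : LWord} {u v x y : List Slice} (h : Transports x y)
    (hw : Labels w (u ++ x ++ v)) (hy : IsDiagram (u ++ y ++ v)) :
    ∃ w', Labels w' (u ++ y ++ v) ∧ (∀ f, LabelFunction f → weight f [] w = weight f [] w') ∧
      Isotopic (erase [] w) (erase [] w') := by
  have hd := hw.isDiagram_erase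
  obtain ⟨hw1, hw2⟩ := hw
  obtain ⟨wu, wx, wv, rfl, rfl, hx, rfl⟩ := exists_of_map_fst_append hw1
  rw [lrun_append] at hw2
  obtain ⟨s, hs, hw2⟩ := Option.bind_eq_some_iff.1 hw2
  rw [lrun_append] at hw2
  obtain ⟨s', hs', hw2⟩ := Option.bind_eq_some_iff.1 hw2
  have hru := run_of_lrun wu hs
  have hy' : (run (s.map Prod.fst) y).isSome := by
    rw [IsDiagram, List.append_assoc] at hy
    rw [List.map_nil] at hru
    rw [run_append_of hru, run_append] at hy
    obtain ⟨r, hr, -⟩ := Option.bind_eq_some_iff.1 hy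
    rw [hr]; rfl
  obtain ⟨wy, h1, h2, h3, h4⟩ := h wx s s' hx hs' hy'
  have hlab : Labels (wu ++ (wy ++ wv)) (wu.map Prod.fst ++ y ++ wv.map Prod.fst) := by
    refine ⟨by simp [h1], ?_⟩
    rw [lrun_append_of hs, lrun_append_of h2, hw2]
  refine ⟨_, hlab, ?_, ?_⟩
  · intro f hf
    rw [weight_append_of f wu hs, weight_append_of f wx hs', weight_append_of f wu hs,
      weight_append_of f wy h2, h3 f hf.1 hf.2]
  · have hd' := hlab.isDiagram_erase
    rw [erase_append_of wu hs, erase_append_of wx hs'] at hd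
    rw [erase_append_of wu hs, erase_append_of wy h2] at hd'
    rw [erase_append_of wu hs, erase_append_of wx hs', erase_append_of wu hs, erase_append_of wy h2]
    rcases h4 with h4 | h4 | h4
    · rw [h4]
      exact .refl _
    · exact .rel _ _ ⟨hd, hd', erase [] wu, erase s' wv, _, _, h4, by simp, by simp⟩
    · exact .symm _ _ (.rel _ _ ⟨hd', hd, erase [] wu, erase s' wv, _, _, h4, by simp, by simp⟩)

/-- Labels carry over along isotopies. -/
theorem Isotopic.transport {D D' : List Slice} (h : Isotopic D D') :
    (∀ w, Labels w D → ∃ w', Labels w' D' ∧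
      (∀ f, LabelFunction f → weight f [] w = weight f [] w') ∧
      Isotopic (erase [] w) (erase [] w')) ∧
    (∀ w, Labels w D' → ∃ w', Labels w' D ∧
      (∀ f, LabelFunction f → weight f [] w = weight f [] w') ∧
      Isotopic (erase [] w) (erase [] w')) := by
  induction h with
  | rel D D' h =>
    obtain ⟨hD, hD', u, v, x, y, hxy, rfl, rfl⟩ := h
    have ht := IsotopyMove.transports hxy
    exact ⟨fun w hw => hw.transport ht.1 hD', fun w hw => hw.transport ht.2 hD⟩
  | refl D =>
    exact ⟨fun w hw => ⟨w, hw, fun _ _ => rfl, .refl _⟩, fun w hw => ⟨w, hw, fun _ _ => rfl, .refl _⟩⟩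
  | symm D D' _ ih => exact ih.symm
  | trans D D' D'' _ _ ih ih' =>
    constructor
    · intro w hw
      obtain ⟨w1, h1, h2, h3⟩ := ih.1 w hw
      obtain ⟨w2, h4, h5, h6⟩ := ih'.1 w1 h1
      exact ⟨w2, h4, fun f hf => (h2 f hf).trans (h5 f hf), .trans _ _ _ h3 h6⟩
    · intro w hw
      obtain ⟨w1, h1, h2, h3⟩ := ih'.2 w hw
      obtain ⟨w2, h4, h5, h6⟩ := ih.2 w1 h1
      exact ⟨w2, h4, fun f hf => (h2 f hf).trans (h5 f hf), .trans _ _ _ h3 h6⟩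

/-- Labels carry over along crossing changes. -/
theorem CrossingChange.transport {D D' : List Slice} (h : CrossingChange D D') {w : LWord}
    (hw : Labels w D) : ∃ w', Labels w' D' ∧
      (erase [] w = erase [] w' ∨ CrossingChange (erase [] w) (erase [] w')) ∧
      ∃ a b : ℕ, ∃ ε : ℤ, (ε = 1 ∨ ε = -1) ∧
        ∀ f, weight f [] w' = weight f [] w + 2 * ε * f a b := by
  obtain ⟨hD, u, v, i, e, rfl, rfl⟩ := h
  have hd := hw.isDiagram_erase
  obtain ⟨hw1, hw2⟩ := hw
  obtain ⟨wu, wx, wv, rfl, rfl, hx, rfl⟩ := exists_of_map_fst_append (x := [Slice.cross i e])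
    (by simpa using hw1)
  obtain ⟨l, rfl⟩ := map_fst_eq_single hx
  rw [lrun_append] at hw2
  obtain ⟨s, hs, hw2⟩ := Option.bind_eq_some_iff.1 hw2
  rw [lrun_append] at hw2
  obtain ⟨s', hs', hw2⟩ := Option.bind_eq_some_iff.1 hw2
  have hx' : (Slice.cross i e).lact l s = some s' := by simpa [lrun] using hs'
  obtain ⟨A, ⟨a, m⟩, ⟨b, n⟩, B, rfl, rfl, rfl⟩ : ∃ A a b B, i = A.length ∧ s = A ++ a :: b :: B ∧
      s' = A ++ b :: a :: B := by
    rcases Slice.exists_of_lact hx' with ⟨_, _, _, _, h, _⟩ | ⟨_, _, _, _, _, h, _⟩ |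
      ⟨i', e', A, a, b, B, h, h1, h2, h3⟩
    · simp at h
    · simp at h
    · simp only [Slice.cross.injEq] at h
      exact ⟨A, a, b, B, by rw [h.1, h1], h2, h3⟩
  have hs2 : lrun (A ++ (a, m) :: (b, n) :: B) [(Slice.cross A.length !e, l)] =
      some (A ++ (b, n) :: (a, m) :: B) := by
    simp [lrun, Slice.lact_cross]
  -- A positive crossing contributes `f m n` before the change and `-f m n` after it, which explains
  -- `-1`; for a negative crossing it is the reverse.
  refine ⟨wu ++ ([(Slice.cross A.length !e, l)] ++ wv), ⟨by simp, ?_⟩, ?_, m, n,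
    if crossingPositive a b e then -1 else 1, by split_ifs <;> simp, ?_⟩
  · rw [lrun_append_of hs, lrun_append_of hs2, hw2]
  · rw [erase_append_of wu hs, erase_append_of _ hs'] at hd
    rw [erase_append_of wu hs, erase_append_of _ hs', erase_append_of wu hs, erase_append_of _ hs2]
    by_cases hm : m = 0 ∨ n = 0
    · left
      simp [erase, Slice.erase, Slice.lact_cross, hm]
    · right
      refine ⟨hd, erase [] wu, erase (A ++ (b, n) :: (a, m) :: B) wv, (eraseState A).length, e,
        ?_, ?_⟩ <;>
      simp [erase, Slice.erase, Slice.lact_cross, hm]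
  · intro f
    rw [weight_append_of f wu hs, weight_append_of f wu hs, weight_append_of f _ hs',
      weight_append_of f _ hs2]
    have : ∀ e, weight f (A ++ (a, m) :: (b, n) :: B) [(Slice.cross A.length e, l)] =
        if crossingPositive a b e then f m n else -f m n := by
      intro e
      simp [weight, Slice.weight, Slice.lact]
    rw [this, this]
    cases a <;> cases b <;> cases e <;> simp [crossingPositive] <;> ring

/-- A labelling of an unlink diagram has weight `0`, and removals of components yield unlinks. -/
theorem Labels.unlinkDiagram (m : ℕ) : ∀ {w : LWord}, Labels w (unlinkDiagram m) →
    (∀ f, weight f [] w = 0) ∧ ∃ m', erase [] w = _root_.unlinkDiagram m' := by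
  induction m with
  | zero =>
    rintro w ⟨hw, -⟩
    obtain rfl : w = [] := by simpa [unlinkDiagram_zero] using hw
    exact ⟨fun _ => rfl, 0, rfl⟩
  | succ m ih =>
    rintro w ⟨hw, hr⟩
    rw [unlinkDiagram_succ, List.map_eq_append_iff] at hw
    obtain ⟨wx, wv, rfl, hx, hv⟩ := hw
    obtain ⟨l, n, rfl⟩ := map_fst_eq_pair hx
    have h1 : lrun [] [(Slice.birth 0 true, l), (Slice.death 0, n)] = some [] := by
      simp [lrun, Slice.lact]
    rw [lrun_append_of h1] at hr
    obtain ⟨h2, m', h3⟩ := ih ⟨hv, hr⟩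
    refine ⟨fun f => ?_, ?_⟩
    · rw [weight_append_of f _ h1, h2]
      simp [weight, Slice.weight, Slice.lact]
    · rw [erase_append_of _ h1, h3]
      by_cases hl : l = 0
      · exact ⟨m', by simp [erase, Slice.erase, Slice.lact, hl]⟩
      · exact ⟨m' + 1, by simp [erase, Slice.erase, Slice.lact, hl, unlinkDiagram_succ]⟩

/-! ### Unknotting numbers -/

theorem UnknottedBy.of_isotopic {D D' : List Slice} {k : ℕ} (hD : IsDiagram D)
    (h : Isotopic D D') (hk : UnknottedBy D' k) : UnknottedBy D k := by
  cases hk with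
  | unlink m h' hD' => exact .unlink m (.trans _ _ _ h h') hD
  | change h₁ h₂ h₃ => exact .change (.trans _ _ _ h h₁) h₂ h₃

/-- A sublink is not harder to unknot. The labels follow the whole sequence; a crossing change with
an erased strand becomes void, any other one stays a crossing change, and a sublink of an unlink is
an unlink. -/
theorem UnknottedBy.erase {D : List Slice} {k : ℕ} (h : UnknottedBy D k) :
    ∀ {w : LWord}, Labels w D → ∃ k' ≤ k, UnknottedBy (erase [] w) k' := by
  induction h with
  | unlink m h hD =>
    intro w hw
    obtain ⟨w', h1, -, h3⟩ := h.transport.1 w hw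
    obtain ⟨m', hm'⟩ := (h1.unlinkDiagram m).2
    exact ⟨0, le_rfl, .unlink m' (hm' ▸ h3) hw.isDiagram_erase⟩
  | change h₁ h₂ _ ih =>
    intro w hw
    obtain ⟨w1, h1, -, h3⟩ := h₁.transport.1 w hw
    obtain ⟨w2, h4, h5, -⟩ := h₂.transport h1
    obtain ⟨k', hk', h6⟩ := ih h4
    rcases h5 with h5 | h5
    · rw [← h5] at h6
      exact ⟨k', by omega, h6.of_isotopic hw.isDiagram_erase h3⟩
    · exact ⟨k' + 1, by omega, .change h3 h5 h6⟩

/-- Labelling of a word in which all maxima have the label `l`. -/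
def constLabels (l : ℕ) (w : List Slice) : LWord := w.map fun x => (x, l)

/-- A constant label is always consistent. It is used with `1` for the part of a diagram that is
kept and with `0` for the part that is erased. -/
theorem lrun_constLabels (l : ℕ) (w : List Slice) : ∀ {st st' : List Bool},
    run st w = some st' →
    lrun (st.map fun a => (a, l)) (constLabels l w) = some (st'.map fun a => (a, l)) ∧
    (l ≠ 0 → erase (st.map fun a => (a, l)) (constLabels l w) = w) ∧
    (l = 0 → erase (st.map fun a => (a, l)) (constLabels l w) = []) := by
  have he : ∀ st : List Bool, l ≠ 0 → eraseState (st.map fun a => (a, l)) = st := by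
    intro st hl
    induction st with
    | nil => rfl
    | cons a st ih => simp [hl, ih]
  induction w with
  | nil => intro st st' h; simp_all [constLabels, lrun, erase]
  | cons x w ih =>
    intro st st' h
    rw [run_cons, Option.bind_eq_some_iff] at h
    obtain ⟨s, hs, h⟩ := h
    obtain ⟨h1, h2, h3⟩ := ih h
    have key : x.lact l (st.map fun a => (a, l)) = some (s.map fun a => (a, l)) ∧
        (l ≠ 0 → x.erase l (st.map fun a => (a, l)) = [x]) ∧
        (l = 0 → x.erase l (st.map fun a => (a, l)) = []) := by
      have hlen : x.pos ≤ st.length := by have := (x.length_of_act hs).1; omega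
      cases x with
      | birth i e =>
        simp only [Slice.pos] at hlen
        simp only [Slice.act, hlen, if_true, Option.some.injEq] at hs
        subst hs
        refine ⟨by simp [Slice.lact, hlen], fun hl => ?_, fun hl => by simp [Slice.erase, hl]⟩
        rw [Slice.erase, if_neg hl, ← List.map_take, he _ hl, List.length_take_of_le hlen]
      | death i =>
        simp only [Slice.pos] at hlen
        simp only [Slice.act] at hs
        rcases hd : st.drop i with _ | ⟨a, _ | ⟨b, r⟩⟩ <;> simp only [hd, reduceCtorEq] at hs
        split_ifs at hs with hab
        simp only [Option.some.injEq] at hs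
        subst hs
        refine ⟨by simp [Slice.lact, ← List.map_drop, hd, hab], fun hl => ?_, fun hl => ?_⟩
        · simp [Slice.erase, ← List.map_drop, hd, hl, ← List.map_take, he _ hl, hlen]
        · simp [Slice.erase, ← List.map_drop, hd, hl]
      | cross i e =>
        simp only [Slice.pos] at hlen
        simp only [Slice.act] at hs
        rcases hd : st.drop i with _ | ⟨a, _ | ⟨b, r⟩⟩ <;> simp only [hd, reduceCtorEq] at hs
        simp only [Option.some.injEq] at hs
        subst hs
        refine ⟨by simp [Slice.lact, ← List.map_drop, hd], fun hl => ?_, fun hl => ?_⟩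
        · simp [Slice.erase, ← List.map_drop, hd, hl, ← List.map_take, he _ hl, hlen]
        · simp [Slice.erase, ← List.map_drop, hd, hl]
    obtain ⟨k1, k2, k3⟩ := key
    refine ⟨?_, fun hl => ?_, fun hl => ?_⟩
    · simp only [constLabels, List.map_cons, lrun, k1]
      exact h1
    · simp only [constLabels, List.map_cons, _root_.erase, k1, k2 hl]
      simpa [constLabels] using h2 hl
    · simp only [constLabels, List.map_cons, _root_.erase, k1, k3 hl]
      simpa [constLabels] using h3 hl

/-- Split circles do not help to unknot a link. -/
theorem UnknottedBy.of_append_unlinkDiagram {D : List Slice} {j k : ℕ} (hD : IsDiagram D)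
    (h : UnknottedBy (D ++ unlinkDiagram j) k) : ∃ k' ≤ k, UnknottedBy D k' := by
  obtain ⟨h1, h2, -⟩ := lrun_constLabels 1 D hD
  obtain ⟨h3, -, h4⟩ := lrun_constLabels 0 (unlinkDiagram j) (run_unlinkDiagram [] j)
  have hw : Labels (constLabels 1 D ++ constLabels 0 (unlinkDiagram j))
      (D ++ unlinkDiagram j) := by
    refine ⟨by simp [constLabels, Function.comp_def], ?_⟩
    rw [lrun_append_of (by simpa using h1)]
    simpa using h3
  obtain ⟨k', hk', h5⟩ := h.erase hw
  refine ⟨k', hk', ?_⟩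
  rw [erase_append_of _ (by simpa using h1)] at h5
  have h2' := h2 one_ne_zero
  have h4' := h4 rfl
  simp only [List.map_nil] at h2' h4'
  rwa [h2', h4', List.append_nil] at h5

theorem IsDiagram.append {D D' : List Slice} (h : IsDiagram D) (h' : IsDiagram D') :
    IsDiagram (D ++ D') := by
  rw [IsDiagram, run_append_of h]
  exact h'

theorem isDiagram_unlinkDiagram (m : ℕ) : IsDiagram (unlinkDiagram m) := run_unlinkDiagram [] m

theorem Isotopic.append_right {D D' v : List Slice} (hv : IsDiagram v) (h : Isotopic D D') :
    Isotopic (D ++ v) (D' ++ v) := by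
  induction h with
  | rel D D' h =>
    obtain ⟨hD, hD', u, v', x, y, hxy, rfl, rfl⟩ := h
    exact .rel _ _ ⟨hD.append hv, hD'.append hv, u, v' ++ v, x, y, hxy, by simp, by simp⟩
  | refl => exact .refl _
  | symm _ _ _ ih => exact .symm _ _ ih
  | trans _ _ _ _ _ ih ih' => exact .trans _ _ _ ih ih'

theorem UnknottedBy.append_unlinkDiagram {D : List Slice} {k : ℕ} (h : UnknottedBy D k) (j : ℕ) :
    UnknottedBy (D ++ unlinkDiagram j) k := by
  have hj := isDiagram_unlinkDiagram j
  induction h with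
  | unlink m h hD =>
    refine .unlink (m + j) ?_ (hD.append hj)
    rw [unlinkDiagram_add]
    exact h.append_right hj
  | change h₁ h₂ _ ih =>
    refine .change (h₁.append_right hj) ?_ ih
    obtain ⟨hD, u, v, i, e, rfl, rfl⟩ := h₂
    exact ⟨hD.append hj, u, v ++ unlinkDiagram j, i, e, by simp, by simp⟩

theorem UnknottedBy.of_splitsTo {D D' : List Slice} {j k : ℕ} (hD : IsDiagram D)
    (h : SplitsTo [] j D D') (hk : UnknottedBy D' k) : UnknottedBy D k :=
  (hk.append_unlinkDiagram j).of_isotopic hD (TangleEq.isotopic h hD)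

/-- Deleting circles from a diagram could a priori destroy an unknotting that makes use of them;
erasure of labels shows that it does not. -/
theorem UnknottedBy.of_splitsTo_symm {D D' : List Slice} {j k : ℕ} (hD : IsDiagram D)
    (h : SplitsTo [] j D D') (hk : UnknottedBy D k) : ∃ k' ≤ k, UnknottedBy D' k' := by
  have hD' := h.isDiagram hD
  refine UnknottedBy.of_append_unlinkDiagram (j := j) hD' ?_
  exact hk.of_isotopic (hD'.append (isDiagram_unlinkDiagram j)) (.symm _ _ (TangleEq.isotopic h hD))

theorem UnknottedBy.unknottingNumber_le {D : List Slice} {k : ℕ} (h : UnknottedBy D k) :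
    unknottingNumber D ≤ k := sInf_le ⟨k, rfl, h⟩

/-- A reduction with `k` applications of the sixth move unknots the link by `k` crossing changes. -/
theorem Reduction.unknottedBy {T : TTree} {k : ℕ} (h : Reduction T k) :
    UnknottedBy T.positivePair.link k := by
  induction h with
  | empty =>
    refine .unlink 1 ?_ (TTree.isDiagram_positivePair _)
    exact TangleEq.isotopic (.circle false (Nat.zero_le _)) (TTree.isDiagram_positivePair _)
  | caret =>
    -- Up to circles a caret is a cap, and the closure of a cap is the chain with a single ring,
    -- that is, an unknot.
    have h1 := TTree.caret.link_positivePair.splitsTo.trans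
      (((TTree.splitsTo_caret true).closeTangle (TTree.caret.run_tangle true)).trans
        (SplitsTo.trans (TangleEq.of_eq _ (by simp [chainStrand])).splitsTo
          (closeTangle_chain 0)))
    refine .of_splitsTo (TTree.isDiagram_positivePair _) h1 (.unlink 1 ?_ rfl)
    exact TangleEq.isotopic (.circle false (Nat.zero_le _)) rfl
  | other h hm _ ih =>
    obtain ⟨j, hj⟩ := h.splitsTo_link hm
    exact ih.of_splitsTo (TTree.isDiagram_positivePair _) hj
  | @six T T' k h _ ih =>
    obtain ⟨j, D, D', h1, h2, h3⟩ := h.splitsTo_link_six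
    have hT := T.isDiagram_positivePair
    obtain ⟨hD, u, v, i, e, p, a, b, q, rfl, rfl, hu, -, -⟩ := h2
    refine .of_splitsTo hT h1 (.change (.refl _) ⟨hD, u, v, i, e, rfl, rfl⟩ ?_)
    have hD' : IsDiagram (u ++ Slice.cross i (!e) :: v) := by
      rw [IsDiagram, h3.run_eq]
      exact T'.isDiagram_positivePair
    exact ih.of_isotopic hD' (h3.isotopic hD')

/-! ### Linking numbers of chains -/

/-- The function that counts the crossings of the labels `j + 1` and `j + 2`. -/
def adjacentLabels (j a b : ℕ) : ℤ :=
  if (a = j + 1 ∧ b = j + 2) ∨ (a = j + 2 ∧ b = j + 1) then 1 else 0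

theorem labelFunction_adjacentLabels (j : ℕ) : LabelFunction (adjacentLabels j) := by
  refine ⟨fun a b => ?_, fun a => ?_⟩
  · unfold adjacentLabels
    congr 1
    apply propext
    omega
  · unfold adjacentLabels
    rw [if_neg (by omega)]

/-- An unordered pair of labels is of the form `{j + 1, j + 2}` for at most one `j`. So a crossing
change affects at most one of the consecutive linking numbers. -/
theorem sum_adjacentLabels_le (n a b : ℕ) :
    ∑ j ∈ Finset.range n, |adjacentLabels j a b| ≤ 1 := by
  by_cases h : ∃ j ∈ Finset.range n, adjacentLabels j a b ≠ 0
  · obtain ⟨j, hj, h⟩ := h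
    rw [Finset.sum_eq_single_of_mem j hj]
    · unfold adjacentLabels; split_ifs <;> simp
    · intro i _ hij
      unfold adjacentLabels at h ⊢
      split_ifs at h with h1
      · rw [if_neg (by omega)]; rfl
      · simp at h
  · push Not at h
    rw [Finset.sum_eq_zero fun j hj => by rw [h j hj]; rfl]
    exact zero_le_one

/-- The `j`-th weight is twice the linking number of the parts labelled `j + 1` and `j + 2`. It is
constant along isotopies and zero for unlinks, and one crossing change alters the sum of the
absolute values by at most two. -/
theorem UnknottedBy.sum_weight_le {D : List Slice} {k : ℕ} (h : UnknottedBy D k) (n : ℕ) :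
    ∀ {w : LWord}, Labels w D →
      ∑ j ∈ Finset.range n, |weight (adjacentLabels j) [] w| ≤ 2 * k := by
  induction h with
  | unlink m h hD =>
    intro w hw
    obtain ⟨w', h1, h2, -⟩ := h.transport.1 w hw
    rw [Finset.sum_eq_zero]
    · simp
    · intro j _
      rw [h2 _ (labelFunction_adjacentLabels j), (h1.unlinkDiagram m).1]
      rfl
  | @change D D₁ D₂ k h₁ h₂ _ ih =>
    intro w hw
    obtain ⟨w1, h1, h2, -⟩ := h₁.transport.1 w hw
    obtain ⟨w2, h4, -, a, b, ε, hε, h5⟩ := h₂.transport h1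
    have hstep : ∀ j, |weight (adjacentLabels j) [] w| ≤
        |weight (adjacentLabels j) [] w2| + 2 * |adjacentLabels j a b| := by
      intro j
      rw [h2 _ (labelFunction_adjacentLabels j), h5]
      have hab : |2 * ε * adjacentLabels j a b| = 2 * |adjacentLabels j a b| := by
        rcases hε with rfl | rfl <;> simp [abs_mul]
      rw [← hab]
      have := abs_sub (weight (adjacentLabels j) [] w1 + 2 * ε * adjacentLabels j a b)
        (2 * ε * adjacentLabels j a b)
      rwa [add_sub_cancel_right] at this
    calc ∑ j ∈ Finset.range n, |weight (adjacentLabels j) [] w|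
        ≤ ∑ j ∈ Finset.range n,
            (|weight (adjacentLabels j) [] w2| + 2 * |adjacentLabels j a b|) :=
          Finset.sum_le_sum fun j _ => hstep j
      _ = ∑ j ∈ Finset.range n, |weight (adjacentLabels j) [] w2| +
            2 * ∑ j ∈ Finset.range n, |adjacentLabels j a b| := by
          rw [Finset.sum_add_distrib, Finset.mul_sum]
      _ ≤ 2 * k + 2 * 1 := by
          have := ih h4
          have := sum_adjacentLabels_le n a b
          linarith
      _ = 2 * ((k + 1 : ℕ) : ℤ) := by push_cast; ring

/-- The maxima of the rings of a chain with labels `l`, `l + 1`, … -/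
def labelledMaxima : ℕ → Bool → ℕ → LWord
  | 0, _, _ => []
  | n + 1, c, l => (.birth 0 c, l) :: lsh 2 (labelledMaxima n (!c) (l + 1))

/-- The labelled strands of the rings of a chain. -/
def labelledRings : ℕ → Bool → ℕ → List (Bool × ℕ)
  | 0, _, _ => []
  | n + 1, c, l => (c, l) :: (!c, l) :: labelledRings n (!c) (l + 1)

theorem map_fst_labelledMaxima (n : ℕ) : ∀ (c : Bool) (l : ℕ),
    (labelledMaxima n c l).map Prod.fst = ringMaxima n c := by
  induction n with
  | zero => exact fun _ _ => rfl
  | succ n ih => intro c l; simp [labelledMaxima, ringMaxima, map_fst_lsh, ih]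

theorem lrun_labelledMaxima (n : ℕ) : ∀ (c : Bool) (l : ℕ),
    lrun [] (labelledMaxima n c l) = some (labelledRings n c l) ∧
    ∀ f, weight f [] (labelledMaxima n c l) = 0 := by
  induction n with
  | zero => exact fun _ _ => ⟨rfl, fun _ => rfl⟩
  | succ n ih =>
    intro c l
    obtain ⟨h1, h2⟩ := ih (!c) (l + 1)
    have h3 := lrun_lsh (labelledMaxima n (!c) (l + 1)) [(c, l), (!c, l)] []
    rw [h1] at h3
    have h4 := fun f => weight_lsh f (labelledMaxima n (!c) (l + 1)) [(c, l), (!c, l)] []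
    refine ⟨?_, fun f => ?_⟩
    · simpa [labelledMaxima, labelledRings, lrun, Slice.lact] using h3
    · simpa [labelledMaxima, weight, Slice.lact, Slice.weight, h2] using h4 f

theorem constLabels_sh (k l : ℕ) (w : List Slice) :
    constLabels l (sh k w) = lsh k (constLabels l w) := by
  simp [constLabels, sh, lsh, Function.comp_def]

/-- The strands that meet in a clasp are the right leg of one ring and the left leg of the next,
both of orientation `!c`. For equal orientations the type `false` is positive, so each clasp
contributes twice. The label `0` of the crossings is a dummy, since labels are read at maxima only.
-/
theorem lrun_ringClasps (n : ℕ) : ∀ (c : Bool) (l : ℕ),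
    lrun (labelledRings (n + 1) c l) (constLabels 0 (ringClasps n)) =
      some (labelledRings (n + 1) c l) ∧
    ∀ f, LabelFunction f → weight f (labelledRings (n + 1) c l) (constLabels 0 (ringClasps n)) =
      ∑ i ∈ Finset.range n, 2 * f (l + i) (l + i + 1) := by
  induction n with
  | zero => exact fun _ _ => ⟨rfl, fun _ _ => rfl⟩
  | succ n ih =>
    intro c l
    obtain ⟨h1, h2⟩ := ih (!c) (l + 1)
    have hx : lrun (labelledRings (n + 2) c l)
        [(.cross 1 false, 0), (.cross 1 false, 0)] = some (labelledRings (n + 2) c l) := rfl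
    have hw : ∀ f, LabelFunction f → weight f (labelledRings (n + 2) c l)
        [(.cross 1 false, 0), (.cross 1 false, 0)] = 2 * f l (l + 1) := by
      intro f hf
      have := hf.1 l (l + 1)
      simp [weight, labelledRings, Slice.weight, Slice.lact, crossingPositive, this]
      ring
    have h3 := lrun_lsh (constLabels 0 (ringClasps n)) [(c, l), (!c, l)]
      (labelledRings (n + 1) (!c) (l + 1))
    have h4 := fun f => weight_lsh f (constLabels 0 (ringClasps n)) [(c, l), (!c, l)]
      (labelledRings (n + 1) (!c) (l + 1))
    have e : constLabels 0 (ringClasps (n + 1)) =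
        [(.cross 1 false, 0), (.cross 1 false, 0)] ++ lsh 2 (constLabels 0 (ringClasps n)) := by
      rw [← constLabels_sh, ringClasps]
      simp [constLabels]
    rw [e]
    refine ⟨?_, fun f hf => ?_⟩
    · rw [lrun_append_of hx]
      rw [h1] at h3
      exact h3
    · rw [weight_append_of f _ hx, hw f hf]
      have h5 : weight f (labelledRings (n + 2) c l) (lsh 2 (constLabels 0 (ringClasps n))) =
          ∑ i ∈ Finset.range n, 2 * f (l + 1 + i) (l + 1 + i + 1) := (h4 f).trans (h2 f hf)
      rw [h5, Finset.sum_range_succ', add_comm]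
      congr 1
      refine Finset.sum_congr rfl fun i _ => ?_
      rw [show l + 1 + i = l + (i + 1) by omega]

theorem lrun_ringMinima (n : ℕ) : ∀ (c : Bool) (l : ℕ),
    lrun (labelledRings n c l) (constLabels 0 (List.replicate n (Slice.death 0))) = some [] ∧
    ∀ f, weight f (labelledRings n c l) (constLabels 0 (List.replicate n (Slice.death 0))) = 0 := by
  induction n with
  | zero => exact fun _ _ => ⟨rfl, fun _ => rfl⟩
  | succ n ih =>
    intro c l
    obtain ⟨h1, h2⟩ := ih (!c) (l + 1)
    simp only [constLabels] at h1 h2 ⊢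
    refine ⟨?_, fun f => ?_⟩
    · simpa [List.replicate_succ, lrun, labelledRings, Slice.lact] using h1
    · simpa [List.replicate_succ, weight, labelledRings, Slice.lact, Slice.weight] using h2 f

/-- The labelling of the chain in which the `j`-th ring has the label `j + 1`. -/
theorem exists_labels_chainDiagram (n : ℕ) : ∃ w, Labels w (chainDiagram n) ∧
    ∀ j < n, weight (adjacentLabels j) [] w = 2 := by
  obtain ⟨h1, h2⟩ := lrun_labelledMaxima (n + 1) false 1
  obtain ⟨h3, h4⟩ := lrun_ringClasps n false 1
  obtain ⟨h5, h6⟩ := lrun_ringMinima (n + 1) false 1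
  refine ⟨labelledMaxima (n + 1) false 1 ++ (constLabels 0 (ringClasps n) ++
    constLabels 0 (List.replicate (n + 1) (Slice.death 0))), ⟨?_, ?_⟩, fun j hj => ?_⟩
  · simp [map_fst_labelledMaxima, chainDiagram_eq, constLabels, Function.comp_def]
  · rw [lrun_append_of h1, lrun_append_of h3, h5]
  · rw [weight_append_of _ _ h1, weight_append_of _ _ h3, h2, h6,
      h4 _ (labelFunction_adjacentLabels j), Finset.sum_eq_single_of_mem j (by simpa using hj)]
    · rw [adjacentLabels, if_pos (by omega)]
      norm_num
    · intro i _ hij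
      rw [adjacentLabels, if_neg (by omega), mul_zero]

/-- A chain of `n + 1` rings cannot be unknotted by less than `n` crossing changes. -/
theorem UnknottedBy.le_of_chainDiagram {n k : ℕ} (h : UnknottedBy (chainDiagram n) k) : n ≤ k := by
  obtain ⟨w, hw, hw'⟩ := exists_labels_chainDiagram n
  have h1 := h.sum_weight_le n hw
  rw [Finset.sum_congr rfl fun j hj => by rw [hw' j (by simpa using hj)]] at h1
  simp at h1
  omega

/-- The reduction gives the upper bound. For the lower bound, an unknotting of the link yields one
of the chain after its split circles are erased, and the linking numbers of the chain apply. -/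
theorem unknottingNumber_chainTree (n : ℕ) :
    unknottingNumber (chainTree n).positivePair.link = n := by
  refine le_antisymm (reduction_chainTree n).unknottedBy.unknottingNumber_le (le_sInf ?_)
  rintro _ ⟨k, rfl, hk⟩
  obtain ⟨j, hj⟩ := splitsTo_chainDiagram n
  obtain ⟨k', hk', h⟩ := hk.of_splitsTo_symm (TTree.isDiagram_positivePair _) hj
  exact_mod_cast h.le_of_chainDiagram.trans hk'

namespace BTree

/-! ### Attaching carets -/

/-- Attach a caret to the `i`-th leaf. -/
def attach : BTree → ℕ → BTree
  | leaf, _ => node leaf leaf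
  | node l r, i => if i < l.leaves then node (l.attach i) r else node l (r.attach (i - l.leaves))

theorem leaves_attach : ∀ (T : BTree) (i : ℕ), (T.attach i).leaves = T.leaves + 1
  | leaf, _ => rfl
  | node l r, i => by
    unfold attach
    split_ifs
    · simp only [leaves, l.leaves_attach]; omega
    · simp only [leaves, r.leaves_attach]; omega

/-- Effect of the attachment of a caret to the `i`-th leaf on the position of a point. -/
def splitAt (i : ℕ) (p : ℕ × Stream' Bool) : ℕ × Stream' Bool :=
  if p.1 < i then p
  else if p.1 = i then (if p.2.head = false then (i, p.2.tail) else (i + 1, p.2.tail))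
  else (p.1 + 1, p.2)

theorem locate_attach : ∀ (T : BTree) (i : ℕ) (s : Stream' Bool), i < T.leaves →
    (T.attach i).locate s = splitAt i (T.locate s)
  | leaf, i, s, h => by
    obtain rfl : i = 0 := by simpa [leaves] using h
    simp [attach, locate, splitAt, leaves]
  | node l r, i, s, h => by
    have hl := l.locate_lt s.tail
    unfold attach
    split_ifs with hi
    · by_cases hs : s.head = false
      · simp [locate, hs, l.locate_attach i s.tail hi]
      · simp only [locate, hs, leaves_attach, splitAt]
        simp
        split_ifs <;> first | omega | (ext1 <;> simp; try omega)
    · simp only [leaves] at h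
      by_cases hs : s.head = false
      · simp only [locate, hs, splitAt]
        simp
        intro h'
        omega
      · simp only [locate, hs, r.locate_attach (i - l.leaves) s.tail (by omega), splitAt]
        simp
        split_ifs <;> first | omega | (ext1 <;> simp; try omega)

/-- A tree with a caret sends points beginning with `true` to a leaf of positive number, which a
trivial tree does not; below a caret the two halves are recovered separately. -/
theorem ext_locate : ∀ {T S : BTree}, (∀ s, T.locate s = S.locate s) → T = S
  | leaf, leaf, _ => rfl
  | leaf, node l r, h => by
    have h1 := congrArg Prod.fst (h (Stream'.cons true (Stream'.const true)))
    have := l.leaves_pos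
    simp [locate] at h1
    omega
  | node l r, leaf, h => by
    have h1 := congrArg Prod.fst (h (Stream'.cons true (Stream'.const true)))
    have := l.leaves_pos
    simp [locate] at h1
    omega
  | node l r, node l' r', h => by
    have hl : l = l' := ext_locate fun s => by
      have h1 := h (Stream'.cons false s)
      simpa [locate] using h1
    subst hl
    have hr : r = r' := ext_locate fun s => by
      have h1 := h (Stream'.cons true s)
      simp only [locate, Stream'.head_cons, Stream'.tail_cons] at h1
      simpa [Prod.ext_iff] using h1
    rw [hr]

theorem colours_eq_cons : ∀ (T : BTree) (c : Bool), ∃ L, T.colours c = c :: L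
  | leaf, _ => ⟨[], rfl⟩
  | node l r, c => by
    obtain ⟨L, h⟩ := l.colours_eq_cons c
    exact ⟨L ++ r.colours (!c), by rw [colours, h]; rfl⟩

/-- A new caret keeps the colour of its leaf on the left and puts the opposite colour to the right
of it. -/
theorem colours_attach : ∀ (T : BTree) (i : ℕ) (c : Bool), i < T.leaves →
    ∃ X a Y, T.colours c = X ++ a :: Y ∧ X.length = i ∧
      (T.attach i).colours c = X ++ a :: (!a) :: Y
  | leaf, i, c, h => ⟨[], c, [], rfl, by simpa [leaves, eq_comm] using h, rfl⟩
  | node l r, i, c, h => by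
    unfold attach
    split_ifs with hi
    · obtain ⟨X, a, Y, h1, h2, h3⟩ := l.colours_attach i c hi
      exact ⟨X, a, Y ++ r.colours (!c), by simp [colours, h1], h2, by simp [colours, h3]⟩
    · obtain ⟨X, a, Y, h1, h2, h3⟩ := r.colours_attach (i - l.leaves) (!c)
        (by simp only [leaves] at h; omega)
      refine ⟨l.colours c ++ X, a, Y, by simp [colours, h1], ?_, by simp [colours, h3]⟩
      rw [List.length_append, length_colours, h2]
      omega

/-- `S` arises from `T` by attaching carets. -/
def Grows : BTree → BTree → Prop :=
  ReflTransGen fun T S => ∃ i < T.leaves, S = T.attach i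

theorem Grows.node {l l' r r' : BTree} (h : Grows l l') (h' : Grows r r') :
    Grows (.node l r) (.node l' r') := by
  have h1 : Grows (.node l r) (.node l' r) := by
    induction h with
    | refl => exact .refl
    | @tail b c _ h ih =>
      obtain ⟨i, hi, rfl⟩ := h
      exact ih.tail ⟨i, by simp only [leaves]; omega, by rw [attach, if_pos hi]⟩
  refine h1.trans ?_
  induction h' with
  | refl => exact .refl
  | @tail b c _ h ih =>
    obtain ⟨i, hi, rfl⟩ := h
    exact ih.tail ⟨l'.leaves + i, by simp only [leaves]; omega, by
      rw [attach, if_neg (by omega), Nat.add_sub_cancel_left]⟩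

theorem grows_leaf : ∀ T : BTree, Grows leaf T
  | leaf => .refl
  | node l r => .head ⟨0, Nat.one_pos, rfl⟩ ((grows_leaf l).node (grows_leaf r))

theorem exists_common_growth : ∀ T S : BTree, ∃ R, Grows T R ∧ Grows S R
  | leaf, S => ⟨S, grows_leaf S, .refl⟩
  | node l r, leaf => ⟨node l r, .refl, grows_leaf _⟩
  | node l r, node l' r' => by
    obtain ⟨R, h1, h2⟩ := exists_common_growth l l'
    obtain ⟨R', h3, h4⟩ := exists_common_growth r r'
    exact ⟨node R R', h1.node h3, h2.node h4⟩

/-- The tangle of a caret attached to a leaf can be moved to the bottom of the upper tangle. -/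
theorem upperTangle_attach : ∀ (T : BTree) (i : ℕ) (c : Bool), i < T.leaves →
    ∃ s, TangleEq [c] ((T.attach i).upperTangle c 0)
      (T.upperTangle c 0 ++ [.birth (2 * i) s, .cross (2 * i + 1) true])
  | leaf, i, c, h => by
    obtain rfl : i = 0 := by simpa [leaves] using h
    exact ⟨c, .of_eq _ rfl⟩
  | node l r, i, c, h => by
    have h0 : run [c] [.birth 0 c, .cross 1 true] = some ([c, c] ++ [!c] ++ []) := by
      simp [run_cons, Slice.act]
    unfold attach
    split_ifs with hi
    · obtain ⟨s, hs⟩ := l.upperTangle_attach i c hi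
      refine ⟨s, ?_⟩
      rw [upperTangle_node, upperTangle_node, List.append_assoc _ (l.upperTangle c 0)]
      have h1 : run [c] ([.birth 0 c, .cross 1 true] ++ sh 2 (r.upperTangle (!c) 0)) =
          some ([c] ++ (c :: r.strands (!c))) := by
        rw [run_append_of h0]
        have h2 : run ([c, c] ++ [!c] ++ []) (sh 2 (r.upperTangle (!c) 0)) =
          some ([c, c] ++ r.strands (!c) ++ []) := run_whisker [c, c] [] (r.run_upperTangle (!c))
        simpa using h2
      exact (hs.whisker_right (c :: r.strands (!c))).append_left h1
    · obtain ⟨j, rfl⟩ : ∃ j, i = l.leaves + j := ⟨i - l.leaves, by omega⟩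
      have hj : j < r.leaves := by simp only [leaves] at h; omega
      rw [Nat.add_sub_cancel_left]
      obtain ⟨s, hs⟩ := r.upperTangle_attach j (!c) hj
      refine ⟨s, ?_⟩
      rw [upperTangle_node, upperTangle_node]
      have hr := (r.attach j).run_upperTangle (!c)
      have h1 : TangleEq [c] ([.birth 0 c, .cross 1 true] ++
          sh 2 ((r.attach j).upperTangle (!c) 0) ++ l.upperTangle c 0)
          ([.birth 0 c, .cross 1 true] ++ sh 2 (r.upperTangle (!c) 0 ++
            [.birth (2 * j) s, .cross (2 * j + 1) true]) ++ l.upperTangle c 0) :=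
        .congr _ h0 (hs.whisker [c, c] [])
      rw [hs.run_eq, run_append_of (r.run_upperTangle (!c))] at hr
      have h2 : run (c :: r.strands (!c))
          (sh 1 [.birth (2 * j) s, .cross (2 * j + 1) true]) =
          some (c :: (r.attach j).strands (!c)) := by
        have h : run ([c] ++ r.strands (!c) ++ [])
          (sh 1 [.birth (2 * j) s, .cross (2 * j + 1) true]) =
          some ([c] ++ (r.attach j).strands (!c) ++ []) := run_whisker [c] [] hr
        simpa using h
      have h3 := (TangleEq.exchange _ (l.run_upperTangle c) h2).symm
      have h4 : run [c] ([.birth 0 c, .cross 1 true] ++ sh 2 (r.upperTangle (!c) 0)) =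
          some ([c] ++ (c :: r.strands (!c))) := by
        rw [run_append_of h0]
        have h : run ([c, c] ++ [!c] ++ []) (sh 2 (r.upperTangle (!c) 0)) =
          some ([c, c] ++ r.strands (!c) ++ []) := run_whisker [c, c] [] (r.run_upperTangle (!c))
        simpa using h
      have h5 := h3.append_left h4
      have hl := l.length_strands c
      -- The left subtree has `2 * l.leaves - 1` strands at the axis, and the vertical strand of the
      -- root caret adds one.
      have e1 : 2 * (l.leaves + j) = 2 * j + 1 + (l.strands c).length := by omega
      refine h1.trans ((TangleEq.of_eq _ ?_).trans (h5.trans (TangleEq.of_eq _ ?_)))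
      · simp [Slice.shift]
      · simp [Slice.shift, e1, Nat.add_right_comm _ 1]

theorem lowerTangle_node (l r : BTree) : (node l r).lowerTangle 0 =
    l.lowerTangle 0 ++ (sh 2 (r.lowerTangle 0) ++ [.cross 1 false, .death 0]) := by
  rw [lowerTangle, r.lowerTangle_eq_sh (0 + 2)]; simp

/-- The tangle of a caret attached to a leaf can be moved to the top of the lower tangle. -/
theorem lowerTangle_attach : ∀ (T : BTree) (i : ℕ) (c : Bool), i < T.leaves →
    TangleEq ((T.attach i).strands c) ((T.attach i).lowerTangle 0)
      ([.cross (2 * i + 1) false, .death (2 * i)] ++ T.lowerTangle 0)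
  | leaf, i, c, h => by
    obtain rfl : i = 0 := by simpa [leaves] using h
    exact .of_eq _ rfl
  | node l r, i, c, h => by
    unfold attach
    split_ifs with hi
    · rw [lowerTangle_node, lowerTangle_node, strands, ← List.append_assoc _ (l.lowerTangle 0)]
      exact ((l.lowerTangle_attach i c hi).whisker_right _).append_right _
    · obtain ⟨j, rfl⟩ : ∃ j, i = l.leaves + j := ⟨i - l.leaves, by omega⟩
      have hj : j < r.leaves := by simp only [leaves] at h; omega
      rw [Nat.add_sub_cancel_left]
      have hs := r.lowerTangle_attach j (!c) hj
      rw [lowerTangle_node, lowerTangle_node, strands]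
      have hl := run_append_right _ (c :: (r.attach j).strands (!c)) (l.run_lowerTangle c)
      have h1 : TangleEq ([c] ++ c :: (r.attach j).strands (!c))
          (sh 2 ((r.attach j).lowerTangle 0))
          (sh 2 ([.cross (2 * j + 1) false, .death (2 * j)] ++ r.lowerTangle 0)) := by
        have h : TangleEq ([c, c] ++ (r.attach j).strands (!c) ++ [])
          (sh 2 ((r.attach j).lowerTangle 0))
          (sh 2 ([.cross (2 * j + 1) false, .death (2 * j)] ++ r.lowerTangle 0)) :=
          hs.whisker [c, c] []
        simpa using h
      have hr := (r.attach j).run_lowerTangle (!c)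
      rw [hs.run_eq, run_append] at hr
      obtain ⟨t, ht, -⟩ := Option.bind_eq_some_iff.1 hr
      have h2 : run (c :: (r.attach j).strands (!c))
          (sh 1 [.cross (2 * j + 1) false, .death (2 * j)]) = some (c :: t) := by
        have h : run ([c] ++ (r.attach j).strands (!c) ++ [])
          (sh 1 [.cross (2 * j + 1) false, .death (2 * j)]) =
          some ([c] ++ t ++ []) := run_whisker [c] [] ht
        simpa using h
      have h3 := TangleEq.exchange _ (l.run_lowerTangle c) h2
      have h4 := TangleEq.congr [.cross 1 false, .death 0] hl h1
      have h5 := h3.append_right (sh 2 (r.lowerTangle 0) ++ [.cross 1 false, .death 0])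
      have hlen := l.length_strands c
      have e1 : 2 * (l.leaves + j) = 2 * j + 1 + (l.strands c).length := by omega
      refine (TangleEq.of_eq _ ?_).trans (h4.trans ((TangleEq.of_eq _ ?_).trans
        (h5.trans (TangleEq.of_eq _ ?_))))
      · simp
      · simp [Slice.shift]
      · simp [Slice.shift, e1, Nat.add_right_comm _ 1]

end BTree

/-! ### Insertion of opposing carets -/

namespace TreePair

theorem eq_of_top_of_bot {P Q : TreePair} (h : P.top = Q.top) (h' : P.bot = Q.bot) : P = Q := by
  cases P; cases Q; simp_all

/-- Insertion of opposing carets at the `i`-th leaf. -/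
def expand (P : TreePair) (i : ℕ) : TreePair where
  top := P.top.attach i
  bot := P.bot.attach i
  leaves_eq := by rw [BTree.leaves_attach, BTree.leaves_attach, P.leaves_eq]

theorem toPerm_apply (P : TreePair) (s : Stream' Bool) :
    P.toPerm s = P.top.place (P.bot.locate s).1 (P.bot.locate s).2 := rfl

theorem locate_toPerm (P : TreePair) (s : Stream' Bool) :
    P.top.locate (P.toPerm s) = P.bot.locate s := by
  rw [toPerm_apply, P.top.locate_place]
  rw [P.leaves_eq]
  exact P.bot.locate_lt s

/-- The homeomorphism of a pair is characterised by carrying positions in the bottom tree to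
positions in the top tree. Identities between elements can thus be checked on `locate`, without
computing `place`. -/
theorem toPerm_eq_of_locate {P : TreePair} {g : Equiv.Perm (Stream' Bool)}
    (h : ∀ s, P.top.locate (g s) = P.bot.locate s) : P.toPerm = g := by
  ext1 s
  rw [toPerm_apply, ← h s, P.top.place_locate]

theorem toPerm_expand {P : TreePair} {i : ℕ} (hi : i < P.top.leaves) :
    (P.expand i).toPerm = P.toPerm := by
  refine toPerm_eq_of_locate fun s => ?_
  simp only [expand]
  rw [BTree.locate_attach _ _ _ hi, BTree.locate_attach _ _ _ (P.leaves_eq ▸ hi), locate_toPerm]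

theorem toPerm_mul {P Q R : TreePair} (h : P.bot = Q.top) (h1 : R.top = P.top)
    (h2 : R.bot = Q.bot) : R.toPerm = P.toPerm * Q.toPerm := by
  refine toPerm_eq_of_locate fun s => ?_
  rw [Equiv.Perm.mul_apply, h1, h2, locate_toPerm, h, locate_toPerm]

/-- Both colour sequences get the opposite of their `i`-th entry inserted after it, so they agree
afterwards iff they agreed before. -/
theorem coloured_expand {P : TreePair} {i : ℕ} (hi : i < P.top.leaves) :
    (P.expand i).Coloured ↔ P.Coloured := by
  obtain ⟨X, a, Y, h1, h2, h3⟩ := P.top.colours_attach i true hi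
  obtain ⟨X', a', Y', h1', h2', h3'⟩ := P.bot.colours_attach i true (P.leaves_eq ▸ hi)
  simp only [Coloured, expand]
  rw [h1, h1', h3, h3']
  constructor <;> intro h <;> obtain ⟨rfl, h⟩ := List.append_inj h (h2.trans h2'.symm) <;> simp_all

theorem run_cross_cross {st st' : List Bool} {i : ℕ} {e e' : Bool}
    (h : run st [.cross i e, .cross i e'] = some st') : st' = st := by
  simp only [run_cons, Option.bind_eq_some_iff, run_nil, Option.some.injEq] at h
  obtain ⟨s1, h1, s2, h2, rfl⟩ := h
  have hi : i ≤ st.length := by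
    have := (Slice.length_of_act _ h1).1
    simp only [Slice.pos] at this
    omega
  obtain ⟨A, B, rfl, rfl⟩ : ∃ A B, st = A ++ B ∧ A.length = i :=
    ⟨st.take i, st.drop i, by simp, by simp [hi]⟩
  rcases B with _ | ⟨a, _ | ⟨b, B⟩⟩
  · simp [Slice.act] at h1
  · simp [Slice.act] at h1
  · simp only [Slice.act, List.drop_left, List.take_left, Option.some.injEq] at h1
    subst h1
    simpa [Slice.act] using h2.symm

/-- Opposing carets contribute a split circle to the link. -/
theorem splitsTo_expand {P : TreePair} {i : ℕ} (hi : i < P.top.leaves) (hP : P.Coloured) :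
    SplitsTo [] 1 (P.expand i).link P.link := by
  have hcol := (coloured_expand hi).2 hP
  have hst : (P.top.attach i).strands true = (P.bot.attach i).strands true :=
    BTree.strands_congr hcol
  obtain ⟨s, hu⟩ := P.top.upperTangle_attach i true hi
  have hl := P.bot.lowerTangle_attach i true (P.leaves_eq ▸ hi)
  have hru := (P.top.attach i).run_upperTangle true
  have hrl := (P.bot.attach i).run_lowerTangle true
  rw [hst] at hru
  have hrtop := P.top.run_upperTangle true
  rw [BTree.strands_congr hP] at hrtop
  have hrbot := P.bot.run_lowerTangle true
  -- the opposing carets between the two tangles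
  have h1 := hu.append hru hl
  -- Only needed to know that the four slices in the middle fit, since the orientation `s` is not
  -- known explicitly.
  have hall : run [true] (P.top.upperTangle true 0 ++
      [.birth (2 * i) s, .cross (2 * i + 1) true, .cross (2 * i + 1) false, .death (2 * i)] ++
      P.bot.lowerTangle 0) = some [true] := by
    have h := h1.run_eq
    rw [run_append_of hru, hrl] at h
    simpa using h.symm
  rw [List.append_assoc, run_append_of hrtop, run_append] at hall
  obtain ⟨t, ht, -⟩ := Option.bind_eq_some_iff.1 hall
  have hlen : 2 * i ≤ (P.bot.strands true).length := by
    have := P.bot.length_strands true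
    rw [← P.leaves_eq] at this
    omega
  have h2 : TangleEq (P.bot.strands true)
      [.birth (2 * i) s, .cross (2 * i + 1) true, .cross (2 * i + 1) false, .death (2 * i)]
      (unlinkDiagram 1) := by
    refine TangleEq.trans ?_ (.circle s hlen)
    rw [show [Slice.birth (2 * i) s, .cross (2 * i + 1) true, .cross (2 * i + 1) false,
      .death (2 * i)] = [.birth (2 * i) s] ++ [.cross (2 * i + 1) true, .cross (2 * i + 1) false] ++
      [.death (2 * i)] by rfl] at ht ⊢
    rw [List.append_assoc, run_append] at ht
    obtain ⟨t1, ht1, ht⟩ := Option.bind_eq_some_iff.1 ht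
    rw [run_append] at ht
    obtain ⟨t2, ht2, ht⟩ := Option.bind_eq_some_iff.1 ht
    -- Two crossings at the same place restore the state, so the Reidemeister move II has equal
    -- boundaries for any orientations.
    obtain rfl := run_cross_cross ht2
    have h3 : TangleEq t2 [.cross (2 * i + 1) true, .cross (2 * i + 1) false] [] :=
      .step (.inr (.two _ _)) ht2 rfl
    simpa using TangleEq.congr [.death (2 * i)] ht1 h3
  have h3 : TangleEq [true] ((P.expand i).top.upperTangle true 0 ++
      (P.expand i).bot.lowerTangle 0)
      (P.top.upperTangle true 0 ++ P.bot.lowerTangle 0 ++ unlinkDiagram 1) := by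
    refine h1.trans ((TangleEq.of_eq _ ?_).trans ((TangleEq.congr (P.bot.lowerTangle 0) hrtop
      h2).trans ?_))
    · simp
    · rw [List.append_assoc, List.append_assoc]
      exact (TangleEq.unlinkDiagram_comm 1 hrbot).append_left hrtop
  have hr : run [true] ((P.expand i).top.upperTangle true 0 ++
      (P.expand i).bot.lowerTangle 0) = some [true] := by
    rw [expand, run_append_of hru, hrl]
  rw [link_eq, link_eq]
  have h4 : run ([false] ++ [true] ++ []) (sh 1 ((P.expand i).top.upperTangle true 0 ++
      (P.expand i).bot.lowerTangle 0)) = some ([false] ++ [true] ++ []) := run_whisker [false] [] hr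
  refine SplitsTo.append_right (st₁ := [false, true]) (st₂ := []) ?_ rfl
    (.append_left (st₁ := [false] ++ [true] ++ []) rfl h4 (SplitsTo.whisker [false] [] hr h3))
  rw [run_append_of (st' := [false] ++ [true] ++ []) rfl, h4]
  rfl

/-- `Q` arises from `P` by insertions of opposing carets. -/
def Expands : TreePair → TreePair → Prop :=
  ReflTransGen fun P Q => ∃ i < P.top.leaves, Q = P.expand i

theorem Expands.toPerm_eq {P Q : TreePair} (h : Expands P Q) : Q.toPerm = P.toPerm := by
  induction h with
  | refl => rfl
  | tail _ h ih =>
    obtain ⟨i, hi, rfl⟩ := h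
    rw [toPerm_expand hi, ih]

theorem Expands.coloured_iff {P Q : TreePair} (h : Expands P Q) : Q.Coloured ↔ P.Coloured := by
  induction h with
  | refl => rfl
  | tail _ h ih =>
    obtain ⟨i, hi, rfl⟩ := h
    rw [coloured_expand hi, ih]

theorem Expands.splitsTo {P Q : TreePair} (h : Expands P Q) (hP : P.Coloured) :
    ∃ j, SplitsTo [] j Q.link P.link := by
  induction h with
  | refl => exact ⟨0, .refl _ _⟩
  | tail h' h ih =>
    obtain ⟨i, hi, rfl⟩ := h
    obtain ⟨j, hj⟩ := ih
    exact ⟨_, (splitsTo_expand hi ((Expands.coloured_iff h').2 hP)).trans hj⟩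

theorem exists_expands {P : TreePair} {R : BTree} (h : BTree.Grows P.bot R) :
    ∃ Q, Expands P Q ∧ Q.bot = R := by
  induction h with
  | refl => exact ⟨P, .refl, rfl⟩
  | tail _ h ih =>
    obtain ⟨i, hi, rfl⟩ := h
    obtain ⟨Q, h1, rfl⟩ := ih
    exact ⟨Q.expand i, h1.tail ⟨i, by rwa [Q.leaves_eq], rfl⟩, rfl⟩

/-- Two pairs that describe the same element have a common expansion. -/
theorem exists_common_expansion {P Q : TreePair} (h : P.toPerm = Q.toPerm) :
    ∃ R, Expands P R ∧ Expands Q R := by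
  obtain ⟨B, h1, h2⟩ := BTree.exists_common_growth P.bot Q.bot
  obtain ⟨P', hP, rfl⟩ := exists_expands h1
  obtain ⟨Q', hQ, hb⟩ := exists_expands h2
  have hperm : P'.toPerm = Q'.toPerm := by rw [hP.toPerm_eq, hQ.toPerm_eq, h]
  -- The element is surjective, so it and the bottom tree determine the position of every point in
  -- the top tree.
  have htop : P'.top = Q'.top := BTree.ext_locate fun s => by
    obtain ⟨t, rfl⟩ := P'.toPerm.surjective s
    rw [locate_toPerm, hperm, locate_toPerm, hb]
  obtain rfl := eq_of_top_of_bot htop hb.symm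
  exact ⟨P', hP, hQ⟩

/-! ### Positive elements -/

/-- The pair of a binary tree and the right comb with the same number of leaves. -/
def combPair (T : BTree) : TreePair where
  top := T
  bot := BTree.rightComb (T.leaves - 1)
  leaves_eq := by
    have := T.leaves_pos
    rw [BTree.leaves_rightComb]
    omega

end TreePair

namespace BTree

/-- Attach a caret to the last leaf. -/
def attachLast (T : BTree) : BTree := T.attach (T.leaves - 1)

theorem attachLast_node (l r : BTree) : (node l r).attachLast = node l r.attachLast := by
  have := r.leaves_pos
  simp only [attachLast, leaves]
  rw [attach, if_neg (by omega)]
  congr 2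
  omega

theorem attachLast_rightComb (n : ℕ) : (rightComb n).attachLast = rightComb (n + 1) := by
  induction n with
  | zero => rfl
  | succ n ih => rw [rightComb, attachLast_node, ih]; rfl

theorem attach_node_leaf (T : BTree) (i : ℕ) :
    (node leaf T).attach (i + 1) = node leaf (T.attach i) := by
  rw [attach, if_neg (by simp [leaves])]
  rfl

theorem attachLast_attach_rightComb (i m : ℕ) :
    ((rightComb (i + 1 + m)).attach i).attachLast = (rightComb (i + 1 + (m + 1))).attach i := by
  induction i with
  | zero =>
    rw [Nat.zero_add, Nat.add_comm 1, Nat.add_comm 1, rightComb, rightComb]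
    simp only [attach, leaves, Nat.one_pos, if_true]
    rw [attachLast_node, attachLast_rightComb]
  | succ i ih =>
    rw [show i + 1 + 1 + m = (i + 1 + m) + 1 by omega,
      show i + 1 + 1 + (m + 1) = (i + 1 + (m + 1)) + 1 by omega, rightComb, rightComb]
    rw [attach_node_leaf, attach_node_leaf, attachLast_node, ih]

/-- Every nontrivial tree has a caret both of whose children are leaves; it can be taken off. -/
theorem exists_attach : ∀ {T : BTree}, T ≠ leaf →
    ∃ (S : BTree) (i : ℕ), i < S.leaves ∧ T = S.attach i
  | leaf, h => absurd rfl h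
  | node leaf leaf, _ => ⟨leaf, 0, Nat.one_pos, rfl⟩
  | node (node a b) r, _ => by
    obtain ⟨S, i, hi, h⟩ := exists_attach (T := node a b) (by simp)
    exact ⟨node S r, i, by simp only [leaves]; omega, by rw [attach, if_pos hi, h]⟩
  | node leaf (node a b), _ => by
    obtain ⟨S, i, hi, h⟩ := exists_attach (T := node a b) (by simp)
    exact ⟨node leaf S, i + 1, by simp only [leaves]; omega, by rw [attach_node_leaf, h]⟩

end BTree

namespace TreePair

/-- A caret at the last leaf of a right comb gives a right comb again, so this is an insertion of
opposing carets. -/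
theorem combPair_attachLast (T : BTree) :
    (combPair T.attachLast).toPerm = (combPair T).toPerm := by
  have hT := T.leaves_pos
  rw [← toPerm_expand (P := combPair T) (i := T.leaves - 1) (by simp only [combPair]; omega)]
  congr 1
  refine eq_of_top_of_bot rfl ?_
  have h := BTree.attachLast_rightComb (T.leaves - 1)
  rw [BTree.attachLast, BTree.leaves_rightComb, Nat.add_sub_cancel] at h
  simp only [combPair, expand, h, BTree.attachLast, BTree.leaves_attach]
  congr 1
  omega

theorem gen_eq (n : ℕ) : gen n = combPair ((BTree.rightComb (n + 1)).attach n) := by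
  refine eq_of_top_of_bot ?_ ?_
  · induction n with
    | zero => rfl
    | succ n ih =>
      simp only [gen, shift, ih, combPair]
      rw [BTree.rightComb.eq_def (n + 1 + 1)]
      simp [BTree.attach, BTree.leaves]
  · have : ∀ n, (gen n).bot = BTree.rightComb (n + 2) := by
      intro n
      induction n with
      | zero => rfl
      | succ n ih => simp only [gen, shift, ih]; rfl
    rw [this]
    simp only [combPair, BTree.leaves_attach, BTree.leaves_rightComb]
    congr 1

/-- Supplies pairs of arbitrary size for a generator, by carets at the last leaf. In products the
size can then be fitted to that of the other factor. -/
theorem toPerm_gen {i m : ℕ} (h : i < m) :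
    (gen i).toPerm = (combPair ((BTree.rightComb m).attach i)).toPerm := by
  obtain ⟨d, rfl⟩ := Nat.exists_eq_add_of_lt h
  rw [show i + d + 1 = i + 1 + d by omega]
  clear h
  induction d with
  | zero => rw [gen_eq, Nat.add_zero]
  | succ d ih => rw [← BTree.attachLast_attach_rightComb, combPair_attachLast, ih]

/-- Insert opposing carets at the `i`-th leaf of the pair of `T`. Its bottom tree is then a comb
with a caret at the `i`-th leaf, which is the top tree of a pair for the `i`-th generator. The last
leaf is excluded, as a caret there does not change the element. -/
theorem combPair_attach {T : BTree} {i : ℕ} (h : i + 1 < T.leaves) :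
    (combPair (T.attach i)).toPerm = (combPair T).toPerm * (gen i).toPerm := by
  rw [toPerm_gen (m := T.leaves - 1) (by omega),
    ← toPerm_expand (P := combPair T) (i := i) (by simp only [combPair]; omega)]
  refine toPerm_mul rfl rfl ?_
  simp only [combPair, BTree.leaves_attach, BTree.leaves_rightComb]
  congr 1
  omega

theorem combPair_mem_positiveF (T : BTree) : (combPair T).toPerm ∈ positiveF := by
  induction h : T.leaves using Nat.strong_induction_on generalizing T with
  | _ n ih =>
    by_cases hT : T = .leaf
    · subst hT
      have : (combPair .leaf).toPerm = 1 := toPerm_eq_of_locate fun s => rfl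
      rw [this]
      exact one_mem _
    · obtain ⟨S, i, hi, rfl⟩ := BTree.exists_attach hT
      rw [BTree.leaves_attach] at h
      have hS := ih _ (by omega) S rfl
      by_cases hl : i + 1 < S.leaves
      · rw [combPair_attach hl]
        exact mul_mem hS (Submonoid.subset_closure ⟨i, rfl⟩)
      · have e : S.attach i = S.attachLast := by
          rw [BTree.attachLast]
          congr 1
          omega
        rw [e, combPair_attachLast]
        exact hS

theorem exists_combPair_of_mem_positiveF {g : Equiv.Perm (Stream' Bool)} (h : g ∈ positiveF) :
    ∃ T, (combPair T).toPerm = g := by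
  induction h using Submonoid.closure_induction_right with
  | one => exact ⟨.leaf, toPerm_eq_of_locate fun s => rfl⟩
  | mul_right x _ y hy ih =>
    obtain ⟨n, rfl⟩ := hy
    obtain ⟨T, rfl⟩ := ih
    -- The tree is enlarged at its last leaf until the leaf `n` exists and is not the last one.
    have key : ∀ d : ℕ, ∃ S : BTree, d ≤ S.leaves ∧
        (combPair S).toPerm = (combPair T).toPerm := by
      intro d
      induction d with
      | zero => exact ⟨T, Nat.zero_le _, rfl⟩
      | succ d ih =>
        obtain ⟨S, h1, h2⟩ := ih
        refine ⟨S.attachLast, ?_, by rw [combPair_attachLast, h2]⟩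
        rw [BTree.attachLast, BTree.leaves_attach]
        omega
    obtain ⟨S, h1, h2⟩ := key (n + 2)
    exact ⟨S.attach n, by rw [combPair_attach (by omega), h2]⟩

/-! ### Bipartite Tait graphs -/

theorem lt_of_mem_taitEdges : ∀ {T : BTree} {k a b : ℕ}, (a, b) ∈ T.taitEdges k →
    a < b ∧ b < k + T.leaves
  | .leaf, _, _, _, h => by simp [BTree.taitEdges] at h
  | .node l r, k, a, b, h => by
    have hl := l.leaves_pos
    have hr := r.leaves_pos
    simp only [BTree.taitEdges, List.mem_cons, Prod.mk.injEq, List.mem_append] at h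
    simp only [BTree.leaves]
    rcases h with ⟨rfl, rfl⟩ | h | h
    · omega
    · have := lt_of_mem_taitEdges h
      omega
    · have := lt_of_mem_taitEdges h
      omega

/-- The edge of a caret joins the leftmost vertices of its two subtrees, and `colours` changes sign
there. So a proper colouring has no freedom beyond its value at the first vertex. -/
theorem colours_of_taitEdges (f : ℕ → Bool) : ∀ (T : BTree) (k : ℕ),
    (∀ a b, (a, b) ∈ T.taitEdges k → f b = !f a) →
    T.colours (f k) = (List.range' k T.leaves).map f
  | .leaf, k, _ => rfl
  | .node l r, k, h => by
    have h0 : f (k + l.leaves) = !f k := h _ _ (by simp [BTree.taitEdges])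
    have hl := colours_of_taitEdges f l k fun a b hab => h a b (by simp [BTree.taitEdges, hab])
    have hr := colours_of_taitEdges f r (k + l.leaves) fun a b hab =>
      h a b (by simp [BTree.taitEdges, hab])
    rw [h0] at hr
    rw [BTree.colours, hl, hr, BTree.leaves, ← List.map_append, List.range'_append_1]

theorem coloured_of_isBipartite {P : TreePair} (h : P.tait.IsBipartite) : P.Coloured := by
  obtain ⟨C⟩ := h
  have h0 := P.top.leaves_pos
  -- The given two-colouring is normalised so that the leftmost vertex is `true`. The value beyond
  -- the last leaf does not matter, since no edge reaches there.
  let f : ℕ → Bool := fun k => if hk : k < P.top.leaves then decide (C ⟨k, hk⟩ = C ⟨0, h0⟩) else true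
  have hf0 : f 0 = true := by simp [f, h0]
  have hf : ∀ a b, (a, b) ∈ P.top.taitEdges 0 ∨ (a, b) ∈ P.bot.taitEdges 0 → f b = !f a := by
    intro a b hab
    have hlt : a < b ∧ b < P.top.leaves := by
      rcases hab with h | h
      · have := lt_of_mem_taitEdges h
        omega
      · have := lt_of_mem_taitEdges h
        rw [P.leaves_eq]
        omega
    have ha : a < P.top.leaves := by omega
    have hadj : P.tait.Adj ⟨a, ha⟩ ⟨b, hlt.2⟩ := by
      rw [tait, SimpleGraph.fromRel_adj]
      exact ⟨by simp; omega, .inl hab⟩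
    have hC := C.valid hadj
    simp only [f, ha, hlt.2, dif_pos]
    generalize C ⟨a, ha⟩ = x at *
    generalize C ⟨b, hlt.2⟩ = y at *
    generalize C ⟨0, h0⟩ = z at *
    revert hC
    clear * -
    revert x y z
    decide
  have h1 := colours_of_taitEdges f P.top 0 fun a b h => hf a b (.inl h)
  have h2 := colours_of_taitEdges f P.bot 0 fun a b h => hf a b (.inr h)
  rw [hf0] at h1 h2
  rw [Coloured, h1, h2, P.leaves_eq]

end TreePair

/-- An edge spans a subtree of `α(T)` that is itself `α` of a ternary tree and so has oddly many
leaves. Hence the parity of the vertex is a proper two-colouring. -/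
theorem TTree.odd_of_mem_taitEdges : ∀ {T : TTree} {k a b : ℕ}, (a, b) ∈ T.alpha.taitEdges k →
    Odd (a + b)
  | leaf, _, _, _, h => by simp [alpha, BTree.taitEdges] at h
  | node x y z, k, a, b, h => by
    obtain ⟨m, hm⟩ := x.odd_leaves_alpha
    obtain ⟨n, hn⟩ := y.odd_leaves_alpha
    simp only [alpha, BTree.taitEdges, List.mem_cons, Prod.mk.injEq, List.mem_append] at h
    rcases h with ⟨rfl, rfl⟩ | h | ⟨rfl, rfl⟩ | h | h
    · exact ⟨a + m, by omega⟩
    · exact odd_of_mem_taitEdges h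
    · exact ⟨k + 2 * m + 1 + n, by omega⟩
    · exact odd_of_mem_taitEdges h
    · exact odd_of_mem_taitEdges h

theorem BTree.odd_of_mem_taitEdges_rightComb (n : ℕ) : ∀ {k a b : ℕ},
    (a, b) ∈ (rightComb n).taitEdges k → Odd (a + b) := by
  induction n with
  | zero => intro k a b h; simp [rightComb, taitEdges] at h
  | succ n ih =>
    intro k a b h
    simp only [rightComb, taitEdges, leaves, List.nil_append, List.mem_cons, Prod.mk.injEq] at h
    rcases h with ⟨rfl, rfl⟩ | h
    · exact ⟨a, by omega⟩
    · exact ih h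

theorem TTree.isBipartite_positivePair (T : TTree) : T.positivePair.tait.IsBipartite := by
  refine ⟨SimpleGraph.Coloring.mk (fun j => (⟨(j : ℕ) % 2, Nat.mod_lt _ two_pos⟩ : Fin 2)) ?_⟩
  intro i j hij
  rw [TreePair.tait, SimpleGraph.fromRel_adj] at hij
  have : Odd ((i : ℕ) + j) := by
    rcases hij.2 with (h | h) | (h | h)
    · exact odd_of_mem_taitEdges h
    · exact BTree.odd_of_mem_taitEdges_rightComb _ h
    · rw [Nat.add_comm]; exact odd_of_mem_taitEdges h
    · rw [Nat.add_comm]; exact BTree.odd_of_mem_taitEdges_rightComb _ h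
  obtain ⟨m, hm⟩ := this
  simp only [ne_eq, Fin.mk.injEq]
  omega

theorem TTree.toPerm_mem (T : TTree) : T.positivePair.toPerm ∈ orientedPositiveF :=
  ⟨⟨_, rfl, T.isBipartite_positivePair⟩, TreePair.combPair_mem_positiveF T.alpha⟩

/-! ### Ternary trees from alternating colours -/

/-- The right subtree begins with the colour `!c`. In an alternating sequence this happens only
after an odd number of entries. -/
theorem BTree.alternating_node {l r : BTree} {c : Bool}
    (h : (node l r).colours c = alternating (node l r).leaves c) :
    Odd l.leaves ∧ l.colours c = alternating l.leaves c ∧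
      r.colours (!c) = alternating r.leaves (!c) := by
  rw [colours, leaves, alternating_add] at h
  obtain ⟨h1, h2⟩ := List.append_inj h (by rw [length_colours, length_alternating])
  obtain ⟨L, hL⟩ := r.colours_eq_cons (!c)
  obtain ⟨n, hn⟩ := Nat.exists_eq_succ_of_ne_zero r.leaves_pos.ne'
  have h3 := h2
  rw [hL, hn, alternating] at h3
  by_cases he : Even l.leaves
  · simp [he] at h3
  · simp only [he, if_false] at h2
    exact ⟨Nat.not_even_iff_odd.1 he, h1, h2⟩

/-- Carets are taken off the right spine in pairs; both left subtrees are odd and alternating, hence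
ternary. The parity of the number of leaves is kept for the remaining right subtree. If it is even,
the spine ends with an unpaired caret, which a caret at the last leaf completes. -/
theorem BTree.exists_ternary : ∀ (S : BTree) (c : Bool), S.colours c = alternating S.leaves c →
    (Odd S.leaves → ∃ T : TTree, T.alpha = S) ∧
    (Even S.leaves → ∃ T : TTree, T.alpha = S.attachLast)
  | leaf, _, _ => ⟨fun _ => ⟨.leaf, rfl⟩, fun h => by simp [leaves] at h⟩
  | node l leaf, c, h => by
    obtain ⟨hl, h1, -⟩ := alternating_node h
    obtain ⟨a, ha⟩ := (exists_ternary l c h1).1 hl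
    refine ⟨fun h => ?_, fun _ => ⟨.node a .leaf .leaf, ?_⟩⟩
    · simp only [leaves] at h
      exact absurd hl (by simpa [Nat.odd_add_one] using h)
    · rw [attachLast_node, TTree.alpha, ha]
      rfl
  | node l (node m r), c, h => by
    obtain ⟨hl, h1, h2⟩ := alternating_node h
    obtain ⟨hm, h3, h4⟩ := alternating_node h2
    obtain ⟨a, ha⟩ := (exists_ternary l c h1).1 hl
    obtain ⟨b, hb⟩ := (exists_ternary m _ h3).1 hm
    have ih := exists_ternary r _ h4
    have hpar : Odd (node l (node m r)).leaves ↔ Odd r.leaves := by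
      obtain ⟨x, hx⟩ := hl
      obtain ⟨y, hy⟩ := hm
      simp only [leaves, Nat.odd_iff]
      omega
    constructor
    · intro ho
      obtain ⟨e, he⟩ := ih.1 (hpar.1 ho)
      exact ⟨.node a b e, by rw [TTree.alpha, ha, hb, he]⟩
    · intro ho
      obtain ⟨e, he⟩ := ih.2 (by rw [← Nat.not_odd_iff_even, ← hpar, Nat.not_odd_iff_even]; exact ho)
      exact ⟨.node a b e, by rw [TTree.alpha, ha, hb, he, attachLast_node, attachLast_node]⟩

/-- Equality of the colours of both trees does not depend on the pair. For the pair with the comb it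
says that the colours alternate. A caret needed at the last leaf does not change the element. -/
theorem exists_ternary_of_mem {g : Equiv.Perm (Stream' Bool)} (h : g ∈ orientedPositiveF) :
    ∃ T : TTree, T.positivePair.toPerm = g := by
  obtain ⟨⟨P, rfl, hP⟩, hpos⟩ := h
  obtain ⟨S, hS⟩ := TreePair.exists_combPair_of_mem_positiveF hpos
  obtain ⟨R, h1, h2⟩ := TreePair.exists_common_expansion hS
  have hcol := h1.coloured_iff.1 (h2.coloured_iff.2 (TreePair.coloured_of_isBipartite hP))
  have halt : S.colours true = BTree.alternating S.leaves true := by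
    have := S.leaves_pos
    simp only [TreePair.Coloured, TreePair.combPair] at hcol
    rw [hcol, BTree.colours_rightComb, Nat.sub_add_cancel this]
  obtain ⟨h3, h4⟩ := BTree.exists_ternary S true halt
  rcases Nat.even_or_odd S.leaves with he | ho
  · obtain ⟨T, hT⟩ := h4 he
    refine ⟨T, ?_⟩
    rw [← hS, ← TreePair.combPair_attachLast, ← hT]
    rfl
  · obtain ⟨T, hT⟩ := h3 ho
    refine ⟨T, ?_⟩
    rw [← hS, ← hT]
    rfl

/-! ### Existence of reductions -/

theorem Move.sizeOf_lt {m : ℕ} {T T' : TTree} (h : Move m T T') : sizeOf T' < sizeOf T := by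
  induction h with
  | left | middle | right => simp only [TTree.node.sizeOf_spec]; omega
  | _ => decide

open TTree in
-- At a caret whose subtrees are all trivial there are eight triples of leaves and carets: the
-- triple of leaves is the single caret, and each other triple is the left side of one of the seven
-- moves.
theorem TTree.exists_move (T : TTree) :
    T = leaf ∨ T = caret ∨ ∃ (m : ℕ) (T' : TTree), Move m T T' := by
  induction T with
  | leaf => exact .inl rfl
  | node a b c iha ihb ihc =>
    right
    rcases iha with rfl | rfl | ⟨m, a', h⟩
    · rcases ihb with rfl | rfl | ⟨m, b', h⟩
      · rcases ihc with rfl | rfl | ⟨m, c', h⟩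
        · exact .inl rfl
        · exact .inr ⟨_, _, .move3⟩
        · exact .inr ⟨_, _, .right _ _ h⟩
      · rcases ihc with rfl | rfl | ⟨m, c', h⟩
        · exact .inr ⟨_, _, .move2⟩
        · exact .inr ⟨_, _, .move4⟩
        · exact .inr ⟨_, _, .right _ _ h⟩
      · exact .inr ⟨_, _, .middle _ _ h⟩
    · rcases ihb with rfl | rfl | ⟨m, b', h⟩
      · rcases ihc with rfl | rfl | ⟨m, c', h⟩
        · exact .inr ⟨_, _, .move1⟩
        · exact .inr ⟨_, _, .move5⟩
        · exact .inr ⟨_, _, .right _ _ h⟩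
      · rcases ihc with rfl | rfl | ⟨m, c', h⟩
        · exact .inr ⟨_, _, .move6⟩
        · exact .inr ⟨_, _, .move7⟩
        · exact .inr ⟨_, _, .right _ _ h⟩
      · exact .inr ⟨_, _, .middle _ _ h⟩
    · exact .inr ⟨_, _, .left _ _ h⟩

theorem TTree.exists_reduction (T : TTree) : ∃ k : ℕ, Reduction T k := by
  rcases T.exists_move with rfl | rfl | ⟨m, T', h⟩
  · exact ⟨0, .empty⟩
  · exact ⟨0, .caret⟩
  · have := h.sizeOf_lt
    obtain ⟨k, hk⟩ := T'.exists_reduction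
    by_cases hm : m = 6
    · subst hm
      exact ⟨k + 1, .six h hk⟩
    · exact ⟨k, .other h hm hk⟩
termination_by sizeOf T

/-! ### Comparison of tree pairs of the same element -/

theorem TTree.coloured_positivePair (T : TTree) : T.positivePair.Coloured :=
  T.colours_positivePair true

theorem TreePair.coloured_of_toPerm_eq {P Q : TreePair} (h : P.toPerm = Q.toPerm)
    (hQ : Q.Coloured) : P.Coloured := by
  obtain ⟨R, h1, h2⟩ := exists_common_expansion h
  rwa [← h1.coloured_iff, h2.coloured_iff]

/-- The link of a common expansion is that of either pair with split circles. An unknotting passes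
up to it unchanged, and down from it by erasing the circles, possibly becoming shorter. -/
theorem TreePair.unknottedBy_of_toPerm_eq {P Q : TreePair} (h : P.toPerm = Q.toPerm)
    (hQ : Q.Coloured) {k : ℕ} (hk : UnknottedBy Q.link k) : ∃ k' ≤ k, UnknottedBy P.link k' := by
  obtain ⟨R, h1, h2⟩ := exists_common_expansion h
  have hR : R.Coloured := h2.coloured_iff.2 hQ
  obtain ⟨j, hj⟩ := h2.splitsTo hQ
  obtain ⟨i, hi⟩ := h1.splitsTo (h1.coloured_iff.1 hR)
  exact UnknottedBy.of_splitsTo_symm hR.isDiagram hi (.of_splitsTo hR.isDiagram hj hk)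

/-! ### The theorem -/

/-- First, every ternary tree can be reduced.  Second, the moves other than the sixth change the
link only by Reidemeister moves I and II and deletions of split unknots.  Third, up to these
operations, the sixth move turns one positive crossing into a negative one.  Fourth, every positive
element `g` of the oriented Thompson group comes from a ternary tree, and the unknotting number of
its link, drawn from any tree pair of `g`, is at most the number of applications of the sixth move
in any reduction of any ternary tree of `g`.  Fifth, the bound is attained by chain links. -/
theorem theorem2 :
    (∀ T : TTree, ∃ k : ℕ, Reduction T k) ∧
    (∀ (m : ℕ) (T T' : TTree), Move m T T' → m ≠ 6 →
      SimplifiesTo T.positivePair.link T'.positivePair.link) ∧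
    (∀ T T' : TTree, Move 6 T T' → ∃ D D' : List Slice,
      SimplifiesTo T.positivePair.link D ∧ PositiveToNegative D D' ∧
      SimplifiesTo D' T'.positivePair.link) ∧
    (∀ g ∈ orientedPositiveF,
      (∃ T : TTree, T.positivePair.toPerm = g) ∧
      ∀ P : TreePair, P.toPerm = g →
        IsDiagram P.link ∧
        ∀ T : TTree, T.positivePair.toPerm = g → ∀ k : ℕ, Reduction T k →
          unknottingNumber P.link ≤ k) ∧
    (∀ n : ℕ, ∃ g ∈ orientedPositiveF, ∃ T : TTree, T.positivePair.toPerm = g ∧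
      Reduction T n ∧ SimplifiesTo T.positivePair.link (chainDiagram n) ∧
      unknottingNumber T.positivePair.link = n) := by
  refine ⟨TTree.exists_reduction, fun m T T' h hm => ?_, fun T T' h => ?_, fun g hg => ?_,
    fun n => ?_⟩
  · obtain ⟨j, hj⟩ := h.splitsTo_link hm
    exact hj.simplifiesTo T.isDiagram_positivePair
  · obtain ⟨j, D, D', h1, h2, h3⟩ := h.splitsTo_link_six
    have hD : IsDiagram D' := h3.run_eq.trans T'.isDiagram_positivePair
    exact ⟨D, D', h1.simplifiesTo T.isDiagram_positivePair, h2, h3.simplifiesTo hD⟩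
  · obtain ⟨S, hS⟩ := exists_ternary_of_mem hg
    refine ⟨⟨S, hS⟩, fun P hP => ⟨?_, fun T hT k hk => ?_⟩⟩
    · exact (TreePair.coloured_of_toPerm_eq (hP.trans hS.symm) S.coloured_positivePair).isDiagram
    · obtain ⟨k', h1, h2⟩ := TreePair.unknottedBy_of_toPerm_eq (hP.trans hT.symm)
        T.coloured_positivePair hk.unknottedBy
      exact h2.unknottingNumber_le.trans (by exact_mod_cast h1)
  · obtain ⟨j, hj⟩ := splitsTo_chainDiagram n
    exact ⟨_, (chainTree n).toPerm_mem, chainTree n, rfl, reduction_chainTree n,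
      hj.simplifiesTo (chainTree n).isDiagram_positivePair, unknottingNumber_chainTree n⟩
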